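/- **Setting.** Let $\Omega\subset\mathbb R^2$ be a bounded convex polygonal domain, $T,\mu,\lambda>0$, $u_a<u_b$, $G(\cdot,t),y_d(\cdot,t)\in L^2(\Omega)$ and $\mathbf b(\cdot,t)\in W^{1,\infty}(\Omega)^2$ with $\operatorname{div}\mathbf b(\cdot,t)=0$ for $t\in[0,T]$ and $\sup_t\|\mathbf b(\cdot,t)\|_{L^\infty}<\infty$. Put $\mathbb U_{ad}=\{u\in L^2(\Omega):u_a\le u\le u_b\text{ a.e.}\}$ (admissible controls at one time level). Let $\mathcal T_h$ be a conforming triangulation of $\overline\Omega$, $h$ its largest triangle diameter, with nodes $Z_i$ (boundary nodes included), hat functions $\phi_i$, and $\mathcal S_h$ the continuous piecewise linear functions vanishing on $\partial\Omega$; $v_i=v(Z_i)$. Let $N_0\ge1$, $k=T/N_0$, $t^n=nk$, and write $f^n=f(\cdot,t^n)$ for $f=\mathbf b,G,y_d$. Let $(\cdot,\cdot)$ be the $L^2(\Omega)$ inner product, $(\psi,\chi)_h=\sum_{K\in\mathcal T_h}\frac{|K|}3\sum_{Z\in K}\psi(Z)\chi(Z)$ (sum over the vertices $Z$ of $K$),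 and define $\widetilde P_h:L^2(\Omega)\to\mathcal S_h$ by $(\widetilde P_hv,\chi)_h=(v,\chi)$ for $\chi\in\mathcal S_h$. For each fixed $t$ let $m_{ij}=(\phi_i,\phi_j)$, $\tau_{ij}=(\mathbf b\cdot\nabla\phi_j,\phi_i)$ and, for $i\ne j$, $d_{ij}=\min\{-\tau_{ij},0,-\tau_{ji}\}$, $\widehat d_{ij}=\max\{-\tau_{ij},0,-\tau_{ji}\}$. **Correction factors.** Given fluxes $p_{ij}$, coefficients $q_i\ge0$ and nodal values $\delta_i$, let $P_i^{+}=\sum_j\max\{0,p_{ij}\}$ and $P_i^-=\sum_j\min\{0,p_{ij}\}$ (sums over the nodes $j$ adjacent to $i$), $Q_i^+=q_i(\delta_i^{\max}-\delta_i)$ and $Q_i^-=q_i(\delta_i^{\min}-\delta_i)$ (maximum and minimum over $Z_i$ and its adjacent nodes), $R_i^\pm=\min\{1,Q_i^\pm/P_i^\pm\}$. Let $\overline a_{ij}=R_i^+,1,R_i^-$ according as $p_{ij}>0,=0,<0$ if $Z_i$ is an interior node, $\overline a_{ij}=1$ if $Z_i\in\partial\Omega$, and $a_{ij}=\min\{\overline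 a_{ij},\overline a_{ji}\}$. Let $\gamma_i>0$ satisfy $v_i-v_i^{\min}\le\gamma_i(v_i^{\max}-v_i)$ for all affine $v$ and all interior nodes $Z_i$. Then * $\mathfrak a_{ij}(v)$ uses $p_{ij}=d_{ij}(v_j-v_i)$, $q_i=\gamma_i\sum_j|d_{ij}|$, $\delta=v$; * $\widehat{\mathfrak a}_{ij}(v)$ uses $p_{ij}=\widehat d_{ij}(v_i-v_j)$, $q_i=\gamma_i\sum_j\widehat d_{ij}$, $\delta=v$; * $\mathrm a_{ij}(v,w)$ uses $p_{ij}=m_{ij}((v-w)_i-(v-w)_j)$, $q_i=\gamma_i\sum_jm_{ij}$, $\delta=v$ (the sums in $q_i$ are over the nodes adjacent to $i$). With sums over all pairs of nodes let $\widehat d_{D}(v;z,\chi)=\sum_{i,j}d_{ij}(1-\mathfrak a_{ij}(v))(z_i-z_j)\chi_i$, $\widehat d_{\widehat D}(v;z,\chi)=\sum_{i,j}\widehat d_{ij}(1-\widehat{\mathfrak a}_{ij}(v))(z_i-z_j)\chi_i$ and $\widehat d_{M}(v,w;z,\chi)=\sum_{i,j}m_{ij}(1-\mathrm a_{ij}(v,w))(z_i-z_j)\chi_i$.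 Denote by $d_D,d_{\widehat D},d_M$ the forms with all factors $1-a_{ij}$ replaced by $1$, and put $\widetilde d_\bullet=d_\bullet-\widehat d_\bullet$. For $d_{ij}$ in the equation of the state at $t^n$ take $\mathbf b^n$, for $\widehat d_{ij}$ in the equation of the co-state at $t^{n-1}$ take $\mathbf b^{n-1}$. **State/co-state scheme.** Fix $y_h^0,p_h^{N_0}\in\mathcal S_h$ (e.g. $p_h^{N_0}=0$). For given $\psi^1,\dots,\psi^{N_0}\in\mathbb U_{ad}$ find $Y^0,\dots,Y^{N_0},P^0,\dots,P^{N_0}\in\mathcal S_h$ with $Y^0=y_h^0$, $P^{N_0}=p_h^{N_0}$ such that, for $n=1,\dots,N_0$ and all $\chi\in\mathcal S_h$, $$(Y^n-Y^{n-1},\chi)+\mu k(\nabla Y^n,\nabla\chi)+k(\mathbf b^n\cdot\nabla Y^n,\chi)-k\,\widehat d_D(Y^n;Y^n,\chi)+\widehat d_M(Y^n,Y^{n-1};Y^n-Y^{n-1},\chi)=k(\widetilde P_h\psi^n,\chi)_h+k(G^n,\chi),\tag{1}$$ $$(P^{n-1}-P^n,\chi)+\mu k(\nabla P^{n-1},\nabla\chi)-k(\mathbf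 b^{n-1}\cdot\nabla P^{n-1},\chi)+k\,\widehat d_{\widehat D}(P^{n-1};P^{n-1},\chi)+\widehat d_M(P^{n-1},P^n;P^{n-1}-P^n,\chi)=k(Y^n,\chi)_h-k(y_d^n,\chi).\tag{2}$$ The induced controls $\widetilde U^n\in\mathbb U_{ad}$ are defined by $$(\lambda\widetilde U^n+P^{n-1},v-\widetilde U^n)\ge0\quad\forall v\in\mathbb U_{ad}.\tag{3}$$ The full nonlinear scheme is (1)--(3) with $\psi^n=\widetilde U^n=:U^n$ unknown (equations (1), (2) may be divided by $k$). **Fixed-point iteration at one time level.** For known $Y^{n-1},P^n\in\mathcal S_h$ and $\psi\in\mathbb U_{ad}$, the map $(v,w)\mapsto(v',w')$ on $\mathcal S_h\times\mathcal S_h$ is given by the linear problems, for all $\chi\in\mathcal S_h$, $$(v'-Y^{n-1},\chi)+\mu k(\nabla v',\nabla\chi)+k(\mathbf b^n\cdot\nabla v',\chi)-k\,d_D(v',\chi)+d_M(v'-Y^{n-1},\chi)-\widetilde d_M(v,Y^{n-1};v-Y^{n-1},\chi)=-k\,\widetilde d_D(v;v,\chi)+k(\widetilde P_h\psi,\chi)_h+k(G^n,\chi),$$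 $$(w'-P^n,\chi)+\mu k(\nabla w',\nabla\chi)-k(\mathbf b^{n-1}\cdot\nabla w',\chi)+k\,d_{\widehat D}(w',\chi)+d_M(w'-P^n,\chi)-\widetilde d_M(w,P^n;w-P^n,\chi)=k\,\widetilde d_{\widehat D}(w;w,\chi)+k(v',\chi)_h-k(y_d^n,\chi).$$ **Theorem.** Let $0<\epsilon<1$, $c_1>0$, and let $c_2,\sigma,\varrho,\Gamma$ be constants. There are $h_0,C>0$, depending only on these constants and on the data $\Omega,T,\mu,\lambda,\mathbf b,G,y_d,u_a,u_b$, such that the following holds for all triangulations with $\operatorname{diam}K\le\sigma\varrho_K$ ($\varrho_K$ the diameter of the inscribed disc) and $\operatorname{diam}K\le\varrho\operatorname{diam}K'$ for all triangles $K,K'$, all $\gamma_i\le\Gamma$ as above, all $y_h^0,p_h^{N_0}\in\mathcal S_h$, and all $h\le h_0$ and $k=T/N_0$ with $c_1h^{1+\epsilon}\le k\le c_2h^{1+\epsilon}$. One has $C(k+k^{-1}h^2)<1$ and $Ck<1$, and: 1. At each time level, for all known $Y^{n-1},P^n\in\mathcal S_h$ and $\psi\in\mathbb U_{ad}$, the fixed-point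 map is well defined and satisfies $\|v_1'-v_2'\|_{L^2}^2+\|w_1'-w_2'\|_{L^2}^2\le C(k+k^{-1}h^2)\big(\|v_1-v_2\|_{L^2}^2+\|w_1-w_2\|_{L^2}^2\big)$; its iterates converge from every starting point to the unique solution $(Y^n,P^{n-1})$ of (1), (2) at that level. 2. For all given $\psi^1,\dots,\psi^{N_0}\in\mathbb U_{ad}$ the scheme (1), (2) has a unique solution. 3. The map $\psi^n\mapsto\widetilde U^n(\psi^n)$ is a well-defined contraction of $\mathbb U_{ad}$: $\|\widetilde U^n(\psi_1^n)-\widetilde U^n(\psi_2^n)\|_{L^2}\le Ck\|\psi^n_1-\psi^n_2\|_{L^2}$. This holds for the map of one time level, with $Y^{n-1}$ and $P^n$ known and fixed, and also for the $n$-th control obtained from the whole scheme (1)--(3) when $\psi^n$ varies and the controls of the other time levels are fixed. 4. The full nonlinear fully discrete scheme has a unique solution $(Y^n)_{n},(P^n)_{n}\subset\mathcal S_h$, $(U^n)_{n}\subset\mathbb U_{ad}$. -/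

import Mathlib

open MeasureTheory Set Filter Topology
open scoped ContDiff

noncomputable section

namespace AFC

/-- The Euclidean plane `ℝ²`. -/
abbrev Plane := EuclideanSpace ℝ (Fin 2)

/-- The space `L²(Ω)`. -/
abbrev L2 (Ω : Set Plane) := Lp ℝ 2 (volume.restrict Ω)

/-! ### The continuous problem -/

/-- `φ ∈ C_c^∞(Ω)`. -/
def IsTestFunction (Ω : Set Plane) (φ : Plane → ℝ) : Prop :=
  ContDiff ℝ ∞ φ ∧ HasCompactSupport φ ∧ tsupport φ ⊆ Ω

/-- `g` is the weak partial derivative `∂ᵢ f` in `Ω`. -/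
def HasWeakPartial (Ω : Set Plane) (f g : Plane → ℝ) (i : Fin 2) : Prop :=
  ∀ φ : Plane → ℝ, IsTestFunction Ω φ →
    ∫ x in Ω, f x * fderiv ℝ φ x (EuclideanSpace.single i 1) = -∫ x in Ω, g x * φ x

/-- `f ∈ W^{1,∞}(Ω)`. -/
def MemW1Inf (Ω : Set Plane) (f : Plane → ℝ) : Prop :=
  MemLp f ⊤ (volume.restrict Ω) ∧
    ∀ i, ∃ g : Plane → ℝ, MemLp g ⊤ (volume.restrict Ω) ∧ HasWeakPartial Ω f g i

/-- `div b = 0` in `Ω`, in the weak sense. -/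
def IsDivFree (Ω : Set Plane) (b : Plane → Plane) : Prop :=
  ∀ φ : Plane → ℝ, IsTestFunction Ω φ → ∫ x in Ω, inner ℝ (b x) (gradient φ x) = 0

/-- `Ω` is a (nonempty, open, bounded) convex polygonal domain. -/
def IsConvexPolygon (Ω : Set Plane) : Prop :=
  IsOpen Ω ∧ Ω.Nonempty ∧ Convex ℝ Ω ∧
    ∃ V : Finset Plane, closure Ω = convexHull ℝ (V : Set Plane)

/-- The data of the control problem: diffusion `μ`, regularization `lam`, final time `tEnd`,
velocity `b(t,x)`, source `G(t,x)`, desired state `yd(t,x)` and control bounds `ua`, `ub`. -/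
structure Problem where
  μ : ℝ
  lam : ℝ
  tEnd : ℝ
  b : ℝ → Plane → Plane
  G : ℝ → Plane → ℝ
  yd : ℝ → Plane → ℝ
  ua : ℝ
  ub : ℝ

/-- The standing assumptions on the data. -/
structure Problem.Valid (Ω : Set Plane) (p : Problem) : Prop where
  μ_pos : 0 < p.μ
  lam_pos : 0 < p.lam
  tEnd_pos : 0 < p.tEnd
  bounds : p.ua < p.ub
  b_mem : ∀ t ∈ Icc 0 p.tEnd, ∀ i, MemW1Inf Ω (fun x => p.b t x i)
  b_div : ∀ t ∈ Icc 0 p.tEnd, IsDivFree Ω (p.b t)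
  b_bdd : ∃ B : ℝ, ∀ t ∈ Icc 0 p.tEnd, ∀ᵐ x ∂volume.restrict Ω, ‖p.b t x‖ ≤ B
  G_mem : ∀ t ∈ Icc 0 p.tEnd, MemLp (p.G t) 2 (volume.restrict Ω)
  yd_mem : ∀ t ∈ Icc 0 p.tEnd, MemLp (p.yd t) 2 (volume.restrict Ω)

/-- The set of admissible controls at one time level. -/
def Uad (Ω : Set Plane) (p : Problem) : Set (L2 Ω) :=
  {u | ∀ᵐ x ∂volume.restrict Ω, p.ua ≤ u x ∧ u x ≤ p.ub}

/-! ### Bilinear forms -/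

/-- `(f, g) = ∫_Ω f g`. -/
def ip (Ω : Set Plane) (f g : Plane → ℝ) : ℝ := ∫ x in Ω, f x * g x

/-- `(∇f, ∇g)`. -/
def gradIp (Ω : Set Plane) (f g : Plane → ℝ) : ℝ :=
  ∫ x in Ω, inner ℝ (gradient f x) (gradient g x)

/-- `(b · ∇f, g)`. -/
def convIp (Ω : Set Plane) (b : Plane → Plane) (f g : Plane → ℝ) : ℝ :=
  ∫ x in Ω, inner ℝ (b x) (gradient f x) * g x

/-! ### Triangulations and linear finite elements -/

/-- A conforming triangulation of `closure Ω`. A triangle is given by the set of its vertices; two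
triangles meet in the convex hull of their common vertices (empty, a vertex, an edge, or the whole
triangle). -/
structure Triangulation (Ω : Set Plane) where
  triangles : Finset (Finset Plane)
  card_eq_three : ∀ K ∈ triangles, K.card = 3
  affineIndependent : ∀ K ∈ triangles, AffineIndependent ℝ (fun z : K => (z : Plane))
  cover : ⋃ K ∈ triangles, convexHull ℝ (K : Set Plane) = closure Ω
  conforming : ∀ K ∈ triangles, ∀ K' ∈ triangles,
    convexHull ℝ (K : Set Plane) ∩ convexHull ℝ (K' : Set Plane) =
      convexHull ℝ ((K : Set Plane) ∩ (K' : Set Plane))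

namespace Triangulation

variable {Ω : Set Plane} (𝒯 : Triangulation Ω)

/-- The mesh size `h`, the largest diameter of a triangle. -/
def meshSize : ℝ := ⨆ K : 𝒯.triangles, Metric.diam (convexHull ℝ ((K : Finset Plane) : Set Plane))

/-- The diameter of the largest disc contained in the triangle with vertex set `K`. -/
def inscribedDiam (K : Finset Plane) : ℝ :=
  2 * sSup {r : ℝ | 0 ≤ r ∧ ∃ c, Metric.closedBall c r ⊆ convexHull ℝ (K : Set Plane)}

/-- Shape regularity with constant `σ`. -/
def ShapeRegular (σ : ℝ) : Prop :=
  ∀ K ∈ 𝒯.triangles, Metric.diam (convexHull ℝ (K : Set Plane)) ≤ σ * inscribedDiam K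

/-- Quasiuniformity with constant `ρ`. -/
def QuasiUniform (ρ : ℝ) : Prop :=
  ∀ K ∈ 𝒯.triangles, ∀ K' ∈ 𝒯.triangles,
    Metric.diam (convexHull ℝ (K : Set Plane)) ≤ ρ * Metric.diam (convexHull ℝ (K' : Set Plane))

open Classical in
/-- All nodes of the triangulation, those on the boundary included. A node `Z` is interior if
`Z ∈ Ω`. -/
def nodes : Finset Plane := 𝒯.triangles.biUnion id

open Classical in
/-- The nodes adjacent to `Z` (joined to `Z` by an edge). -/
def adj (Z : Plane) : Finset Plane :=
  𝒯.nodes.filter fun Z' => Z' ≠ Z ∧ ∃ K ∈ 𝒯.triangles, Z ∈ K ∧ Z' ∈ K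

/-- The finite element space `S_h`: continuous functions that are affine on every triangle and
vanish on the boundary. They are extended by zero to the plane. -/
def fe : Submodule ℝ (Plane → ℝ) where
  carrier := {χ | Continuous χ ∧
    (∀ K ∈ 𝒯.triangles, ∃ A : Plane →ᵃ[ℝ] ℝ, EqOn χ A (convexHull ℝ (K : Set Plane))) ∧
    ∀ x, x ∉ Ω → χ x = 0}
  zero_mem' := ⟨continuous_const, fun _ _ => ⟨0, fun _ _ => rfl⟩, fun _ _ => rfl⟩
  add_mem' := by
    rintro f g ⟨hf, hf', hf''⟩ ⟨hg, hg', hg''⟩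
    refine ⟨hf.add hg, fun K hK => ?_, fun x hx => by simp [hf'' x hx, hg'' x hx]⟩
    obtain ⟨A, hA⟩ := hf' K hK
    obtain ⟨B, hB⟩ := hg' K hK
    exact ⟨A + B, fun x hx => by simp [hA hx, hB hx]⟩
  smul_mem' := by
    rintro c f ⟨hf, hf', hf''⟩
    refine ⟨hf.const_smul c, fun K hK => ?_, fun x hx => by simp [hf'' x hx]⟩
    obtain ⟨A, hA⟩ := hf' K hK
    exact ⟨c • A, fun x hx => by simp [hA hx]⟩

/-- `w` are the barycentric coordinates of `x` in the triangle with vertex set `K`. -/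
def IsBarycentric (K : Finset Plane) (w : Plane → ℝ) (x : Plane) : Prop :=
  (∀ y ∈ K, 0 ≤ w y) ∧ ∑ y ∈ K, w y = 1 ∧ ∑ y ∈ K, w y • y = x

open Classical in
/-- The nodal (hat) function `φ_Z`: at `x` it is the barycentric coordinate of `x` that belongs to
the vertex `Z` in a triangle containing `x` and having `Z` as a vertex, and it is `0` if there is no
such triangle. -/
def hat (Z x : Plane) : ℝ :=
  if H : ∃ t : ℝ, ∃ K ∈ 𝒯.triangles, Z ∈ K ∧ ∃ w, IsBarycentric K w x ∧ w Z = t then H.choose else 0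

/-- The quadrature inner product `(v, z)_h`. -/
def lumpIp (v z : Plane → ℝ) : ℝ :=
  ∑ K ∈ 𝒯.triangles,
    (1 / 3) * (volume (convexHull ℝ (K : Set Plane))).toReal * ∑ Z ∈ K, v Z * z Z

open Classical in
/-- The modified `L²`-projection `P̃_h v ∈ S_h`, defined by `(P̃_h v, χ)_h = (v, χ)` for all
`χ ∈ S_h`. -/
def proj (v : Plane → ℝ) : Plane → ℝ :=
  if H : ∃ w ∈ 𝒯.fe, ∀ χ ∈ 𝒯.fe, 𝒯.lumpIp w χ = ip Ω v χ then H.choose else 0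

/-- The entries `m_ij` of the mass matrix. -/
def mass (Z Z' : Plane) : ℝ := ip Ω (𝒯.hat Z) (𝒯.hat Z')

/-- The entries `τ_ij = (b · ∇φ_j, φ_i)` of the convection matrix. -/
def conv (b : Plane → Plane) (Z Z' : Plane) : ℝ := convIp Ω b (𝒯.hat Z') (𝒯.hat Z)

/-- The off-diagonal entries `d_ij` of the artificial diffusion operator of the state equation. -/
def diff (b : Plane → Plane) (Z Z' : Plane) : ℝ :=
  min (min (-𝒯.conv b Z Z') 0) (-𝒯.conv b Z' Z)

/-- The off-diagonal entries of the artificial diffusion operator of the co-state equation. -/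
def diffHat (b : Plane → Plane) (Z Z' : Plane) : ℝ :=
  max (max (-𝒯.conv b Z Z') 0) (-𝒯.conv b Z' Z)

/-- `∑_{i,j} c_ij (v_i - v_j) z_i`, the sum being over all nodes. -/
def stab (c : Plane → Plane → ℝ) (v z : Plane → ℝ) : ℝ :=
  ∑ Z ∈ 𝒯.nodes, ∑ Z' ∈ 𝒯.nodes, c Z Z' * (v Z - v Z') * z Z

/-! ### Correction factors -/

/-- The maximum of the nodal values of `δ` over the patch of triangles around `Z`. -/
def locMax (δ : Plane → ℝ) (Z : Plane) : ℝ := by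
  classical exact (insert Z (𝒯.adj Z)).sup' (Finset.insert_nonempty _ _) δ

/-- The minimum of the nodal values of `δ` over the patch of triangles around `Z`. -/
def locMin (δ : Plane → ℝ) (Z : Plane) : ℝ := by
  classical exact (insert Z (𝒯.adj Z)).inf' (Finset.insert_nonempty _ _) δ

/-- `R_i^+ = min {1, Q_i^+ / P_i^+}` for the fluxes `flux`, coefficients `q` and nodal values `δ`. -/
def ratioPos (flux : Plane → Plane → ℝ) (q δ : Plane → ℝ) (Z : Plane) : ℝ :=
  min 1 (q Z * (𝒯.locMax δ Z - δ Z) / ∑ Z' ∈ 𝒯.adj Z, max 0 (flux Z Z'))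

/-- `R_i^- = min {1, Q_i^- / P_i^-}`. -/
def ratioNeg (flux : Plane → Plane → ℝ) (q δ : Plane → ℝ) (Z : Plane) : ℝ :=
  min 1 (q Z * (𝒯.locMin δ Z - δ Z) / ∑ Z' ∈ 𝒯.adj Z, min 0 (flux Z Z'))

open Classical in
/-- The one-sided factors; they are `1` at Dirichlet nodes. -/
def preFactor (flux : Plane → Plane → ℝ) (q δ : Plane → ℝ) (Z Z' : Plane) : ℝ :=
  if Z ∈ Ω then
    if 0 < flux Z Z' then 𝒯.ratioPos flux q δ Z
    else if flux Z Z' < 0 then 𝒯.ratioNeg flux q δ Z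
    else 1
  else 1

/-- The correction factors. -/
def factor (flux : Plane → Plane → ℝ) (q δ : Plane → ℝ) (Z Z' : Plane) : ℝ :=
  min (𝒯.preFactor flux q δ Z Z') (𝒯.preFactor flux q δ Z' Z)

/-- `γ` is an admissible family of constants for the linearity preservation of the limiter:
`v_i - v_i^min ≤ γ_i (v_i^max - v_i)` for all affine `v` and all interior nodes. -/
def IsGamma (γ : Plane → ℝ) : Prop :=
  ∀ Z ∈ 𝒯.nodes, Z ∈ Ω → 0 < γ Z ∧
    ∀ v : Plane →ᵃ[ℝ] ℝ, v Z - 𝒯.locMin v Z ≤ γ Z * (𝒯.locMax v Z - v Z)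

/-- The coefficients `q_i = γ_i ∑_j |c_ij|`, the sum being over the nodes adjacent to `Z_i`. -/
def qCoef (γ : Plane → ℝ) (c : Plane → Plane → ℝ) (Z : Plane) : ℝ :=
  γ Z * ∑ Z' ∈ 𝒯.adj Z, |c Z Z'|

/-- Correction factors of the state stabilization, with fluxes `d_ij (v_j - v_i)`. -/
def facD (γ : Plane → ℝ) (b : Plane → Plane) (v : Plane → ℝ) : Plane → Plane → ℝ :=
  𝒯.factor (fun Z Z' => 𝒯.diff b Z Z' * (v Z' - v Z)) (𝒯.qCoef γ (𝒯.diff b)) v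

/-- Correction factors of the co-state stabilization, with fluxes `d̂_ij (v_i - v_j)`. -/
def facDHat (γ : Plane → ℝ) (b : Plane → Plane) (v : Plane → ℝ) : Plane → Plane → ℝ :=
  𝒯.factor (fun Z Z' => 𝒯.diffHat b Z Z' * (v Z - v Z')) (𝒯.qCoef γ (𝒯.diffHat b)) v

/-- Correction factors of the mass lumping: the fluxes are those of the increment `v - w` from the
known level `w` to the unknown level `v`, the bounds `Q` are those of `v`. -/
def facM (γ v w : Plane → ℝ) : Plane → Plane → ℝ :=
  𝒯.factor (fun Z Z' => 𝒯.mass Z Z' * ((v Z - w Z) - (v Z' - w Z'))) (𝒯.qCoef γ 𝒯.mass) v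

/-- The state stabilization with factors computed from `w`. -/
def stabD (γ : Plane → ℝ) (b : Plane → Plane) (w v z : Plane → ℝ) : ℝ :=
  𝒯.stab (fun Z Z' => 𝒯.diff b Z Z' * (1 - 𝒯.facD γ b w Z Z')) v z

/-- The co-state stabilization with factors computed from `w`. -/
def stabDHat (γ : Plane → ℝ) (b : Plane → Plane) (w v z : Plane → ℝ) : ℝ :=
  𝒯.stab (fun Z Z' => 𝒯.diffHat b Z Z' * (1 - 𝒯.facDHat γ b w Z Z')) v z

/-- The mass stabilization with factors computed from the step from `w₀` to `w`. -/
def stabM (γ w w₀ v z : Plane → ℝ) : ℝ :=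
  𝒯.stab (fun Z Z' => 𝒯.mass Z Z' * (1 - 𝒯.facM γ w w₀ Z Z')) v z

/-- The antidiffusive part removed from the state stabilization. -/
def antiD (γ : Plane → ℝ) (b : Plane → Plane) (w v z : Plane → ℝ) : ℝ :=
  𝒯.stab (𝒯.diff b) v z - 𝒯.stabD γ b w v z

/-- The antidiffusive part removed from the co-state stabilization. -/
def antiDHat (γ : Plane → ℝ) (b : Plane → Plane) (w v z : Plane → ℝ) : ℝ :=
  𝒯.stab (𝒯.diffHat b) v z - 𝒯.stabDHat γ b w v z

/-- The antidiffusive part removed from the mass stabilization. -/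
def antiM (γ w w₀ v z : Plane → ℝ) : ℝ :=
  𝒯.stab 𝒯.mass v z - 𝒯.stabM γ w w₀ v z

end Triangulation

/-! ### The fully discrete schemes -/

/-- Discretization data: a mesh, the constants `γ_i`, the number of time steps, the initial value
of the state and the terminal value of the co-state. -/
structure Discretization (Ω : Set Plane) where
  mesh : Triangulation Ω
  γ : Plane → ℝ
  N₀ : ℕ
  y₀ : mesh.fe
  pT : mesh.fe

section Schemes

variable {Ω : Set Plane} (p : Problem) (d : Discretization Ω)

/-- The time step `k = T / N₀`. -/
def step : ℝ := p.tEnd / d.N₀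

/-- The time level `t^n = n k`. -/
def time (n : ℕ) : ℝ := n * step p d

/-- `n : Fin N₀` stands for the step from `t^n` to `t^{n+1}`. The state equation, multiplied by
`k`, for the new state `y` with old state `yOld` and control `ψ`. -/
def StateStep (n : Fin d.N₀) (ψ : L2 Ω) (yOld y : d.mesh.fe) : Prop :=
  let k := step p d
  let b := p.b (time p d ((n : ℕ) + 1))
  ∀ χ : d.mesh.fe,
    ip Ω (y - yOld : d.mesh.fe) χ + p.μ * k * gradIp Ω y χ + k * convIp Ω b y χ
      - k * d.mesh.stabD d.γ b y y χ + d.mesh.stabM d.γ y yOld (y - yOld : d.mesh.fe) χ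
    = k * d.mesh.lumpIp (d.mesh.proj ψ) χ + k * ip Ω (p.G (time p d ((n : ℕ) + 1))) χ

/-- The co-state equation, multiplied by `k`, for the co-state `w` at `t^n`, with known co-state
`wNext` at `t^{n+1}` and state `y` at `t^{n+1}`. -/
def CostateStep (n : Fin d.N₀) (y wNext w : d.mesh.fe) : Prop :=
  let k := step p d
  let b := p.b (time p d n)
  ∀ χ : d.mesh.fe,
    ip Ω (w - wNext : d.mesh.fe) χ + p.μ * k * gradIp Ω w χ - k * convIp Ω b w χ
      + k * d.mesh.stabDHat d.γ b w w χ + d.mesh.stabM d.γ w wNext (w - wNext : d.mesh.fe) χ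
    = k * d.mesh.lumpIp y χ - k * ip Ω (p.yd (time p d ((n : ℕ) + 1))) χ

/-- `(Y, P)` solves the nonlinear state/co-state scheme for the given controls `ψ`. -/
def SolvesGiven (ψ : Fin d.N₀ → L2 Ω) (Y P : Fin (d.N₀ + 1) → d.mesh.fe) : Prop :=
  Y 0 = d.y₀ ∧ P (Fin.last d.N₀) = d.pT ∧
    ∀ n : Fin d.N₀, StateStep p d n (ψ n) (Y n.castSucc) (Y n.succ) ∧
      CostateStep p d n (Y n.succ) (P n.succ) (P n.castSucc)

/-- `u` is the admissible control belonging to the co-state `w`: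
`(lam u + w, v - u) ≥ 0` for all admissible `v`. -/
def IsControl (w : d.mesh.fe) (u : L2 Ω) : Prop :=
  u ∈ Uad Ω p ∧ ∀ v ∈ Uad Ω p,
    0 ≤ ip Ω (fun x => p.lam * u x + (w : Plane → ℝ) x) (fun x => v x - u x)

/-- `(Y, P, U)` solves the full nonlinear fully discrete scheme; `U n` is the control for the step
from `t^n` to `t^{n+1}`, and `dY`, `dP` are the backward difference quotients. -/
def SolvesFull (Y P : Fin (d.N₀ + 1) → d.mesh.fe) (U : Fin d.N₀ → L2 Ω) : Prop :=
  Y 0 = d.y₀ ∧ P (Fin.last d.N₀) = d.pT ∧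
    ∀ n : Fin d.N₀,
      let k := step p d
      let b₀ := p.b (time p d n)
      let b₁ := p.b (time p d ((n : ℕ) + 1))
      let dY : d.mesh.fe := k⁻¹ • (Y n.succ - Y n.castSucc)
      let dP : d.mesh.fe := k⁻¹ • (P n.succ - P n.castSucc)
      (∀ χ : d.mesh.fe,
        ip Ω dY χ + p.μ * gradIp Ω (Y n.succ) χ + convIp Ω b₁ (Y n.succ) χ
          - d.mesh.stabD d.γ b₁ (Y n.succ) (Y n.succ) χ
          + d.mesh.stabM d.γ (Y n.succ) (Y n.castSucc) dY χ
        = d.mesh.lumpIp (d.mesh.proj (U n)) χ + ip Ω (p.G (time p d ((n : ℕ) + 1))) χ) ∧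
      (∀ χ : d.mesh.fe,
        -ip Ω dP χ + p.μ * gradIp Ω (P n.castSucc) χ - convIp Ω b₀ (P n.castSucc) χ
          + d.mesh.stabDHat d.γ b₀ (P n.castSucc) (P n.castSucc) χ
          - d.mesh.stabM d.γ (P n.castSucc) (P n.succ) dP χ
        = d.mesh.lumpIp (Y n.succ) χ - ip Ω (p.yd (time p d ((n : ℕ) + 1))) χ) ∧
      IsControl p d (P n.castSucc) (U n)

/-- One sweep of the fixed-point iteration at a time level: from the iterates `(v, w)` for the state
at `t^{n+1}` and the co-state at `t^n` to the new iterates `(v', w')`, by two linear problems. -/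
def IterStep (n : Fin d.N₀) (ψ : L2 Ω) (yOld wNext : d.mesh.fe)
    (s s' : d.mesh.fe × d.mesh.fe) : Prop :=
  let k := step p d
  let b₀ := p.b (time p d n)
  let b₁ := p.b (time p d ((n : ℕ) + 1))
  (∀ χ : d.mesh.fe,
    ip Ω (s'.1 - yOld : d.mesh.fe) χ + p.μ * k * gradIp Ω s'.1 χ + k * convIp Ω b₁ s'.1 χ
      - k * d.mesh.stab (d.mesh.diff b₁) s'.1 χ
      + d.mesh.stab d.mesh.mass (s'.1 - yOld : d.mesh.fe) χ
      - d.mesh.antiM d.γ s.1 yOld (s.1 - yOld : d.mesh.fe) χ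
    = -k * d.mesh.antiD d.γ b₁ s.1 s.1 χ + k * d.mesh.lumpIp (d.mesh.proj ψ) χ
      + k * ip Ω (p.G (time p d ((n : ℕ) + 1))) χ) ∧
  (∀ χ : d.mesh.fe,
    ip Ω (s'.2 - wNext : d.mesh.fe) χ + p.μ * k * gradIp Ω s'.2 χ - k * convIp Ω b₀ s'.2 χ
      + k * d.mesh.stab (d.mesh.diffHat b₀) s'.2 χ
      + d.mesh.stab d.mesh.mass (s'.2 - wNext : d.mesh.fe) χ
      - d.mesh.antiM d.γ s.2 wNext (s.2 - wNext : d.mesh.fe) χ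
    = k * d.mesh.antiDHat d.γ b₀ s.2 s.2 χ + k * d.mesh.lumpIp s'.1 χ
      - k * ip Ω (p.yd (time p d ((n : ℕ) + 1))) χ)

/-- `‖s₁ - s₁'‖² + ‖s₂ - s₂'‖²` in `L²(Ω)`. -/
def distSq (s s' : d.mesh.fe × d.mesh.fe) : ℝ :=
  ip Ω (s.1 - s'.1 : d.mesh.fe) (s.1 - s'.1 : d.mesh.fe) +
    ip Ω (s.2 - s'.2 : d.mesh.fe) (s.2 - s'.2 : d.mesh.fe)

end Schemes

end AFC

end

open AFC

namespace AFC

/-! ### Variational inequalities -/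

section VariationalInequality

/-! Everything rests on one smallness. Mass entries are O(h²), convection entries are O(h), and in
two dimensions the squared nodal jumps along the edges are bounded by the squared L² norm of the
gradient with no power of h (`Triangulation.IsRegular.sqrt_jumpSq_le`). Limited fluxes are Lipschitz
functions of the nodal differences (`abs_mul_min_div_sub_le`,
`Triangulation.abs_stab_limited_sub_le`). Hence every stabilization and correction term of a time
step is at most kη‖∇·‖‖∇·‖ with η of order h²/k + h, which tends to zero because k is comparable to
h^(1+ε) with ε < 1. These terms are a small perturbation of the diffusion μk‖∇·‖². `StepForms` and
`SchemeForms` record this situation, the argument is carried out abstractly for them, and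
`exists_schemeForms` shows that the finite element scheme is an instance.

One time level: the linear problems are definite, since convection is skew (div b = 0) and the full
stabilizations are semidefinite. Subtracting two sweeps, testing with the difference and absorbing
gradients by Young's inequality leaves kη²/(4μ) times the squared gradient of the difference of the
old iterates. The inverse inequality turns this into a factor of order kη²/h², that is k + h²/k, and
Banach's fixed point theorem applies.

Given controls: the state equations do not contain the co-state, so a forward recursion followed by
a backward one solves the scheme. If only one control varies, the energy estimate moves the
co-states by O(k) times that variation, and the control is a projection of -P/λ, hence 1/λ-Lipschitz
in P.

Full scheme: contraction no longer suffices. When all T/k controls vary together the factor k is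
lost, and the Lipschitz constant of the control map need not be small. Instead, the map from
controls to co-states is shown to be monotone up to a small defect
(`SchemeForms.neg_defect_le_sum`). Testing the state differences e with the co-state differences f,
and conversely, makes the diffusion cancel and the mass terms telescope. State and co-state use b at
different times and b has no regularity in t, but by skewness the convection terms can be regrouped
as a telescoping sum of k(bᵐ·∇eᵐ, fᵐ). The price is gradients times time increments, which the
energy estimates bound with a factor √k. The lumped term has the good sign. Once the defect is at
most λ/2, ψ ↦ λψ + P(ψ) is strongly monotone and Lipschitz, and its variational inequality has
exactly one solution (`existsUnique_variationalInequality`). -/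

theorem norm_sub_le_of_convexProjection {E : Type*} [NormedAddCommGroup E]
    [InnerProductSpace ℝ E] {K : Set E} {x y a b : E} (ha : a ∈ K) (hb : b ∈ K)
    (hx : ∀ v ∈ K, inner ℝ (x - a) (v - a) ≤ 0) (hy : ∀ v ∈ K, inner ℝ (y - b) (v - b) ≤ 0) :
    ‖a - b‖ ≤ ‖x - y‖ := by
  have h₁ := hx b hb
  have h₂ := hy a ha
  have h₃ : ‖a - b‖ * ‖a - b‖ ≤ ‖x - y‖ * ‖a - b‖ := by
    rw [← real_inner_self_eq_norm_mul_norm]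
    refine le_trans ?_ (real_inner_le_norm _ _)
    simp only [inner_sub_left, inner_sub_right] at *
    linarith
  rcases (norm_nonneg (a - b)).eq_or_lt with h | h
  · rw [← h]; positivity
  · exact le_of_mul_le_mul_right h₃ h

variable {E : Type*} [NormedAddCommGroup E] [InnerProductSpace ℝ E] [CompleteSpace E]

theorem exists_convexProjection {K : Set E} (hne : K.Nonempty) (hcl : IsClosed K)
    (hK : Convex ℝ K) :
    ∃ π : E → E, (∀ x, π x ∈ K) ∧ ∀ x, ∀ v ∈ K, inner ℝ (x - π x) (v - π x) ≤ 0 := by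
  have h : ∀ x, ∃ y ∈ K, ∀ v ∈ K, inner ℝ (x - y) (v - y) ≤ 0 := fun x => by
    obtain ⟨y, hy, hy'⟩ := exists_norm_eq_iInf_of_complete_convex hne hcl.isComplete hK x
    exact ⟨y, hy, (norm_eq_iInf_iff_real_inner_le_zero hK hy).1 hy'⟩
  choose π h₁ h₂ using h
  exact ⟨π, h₁, h₂⟩

/-- The Lions–Stampacchia argument: a fixed point of x ↦ π(x - r A x) solves the inequality, and
strong monotonicity makes this map a contraction for a suitable r. Uniqueness follows from testing
two solutions with each other. -/
theorem existsUnique_variationalInequality {K : Set E} (hne : K.Nonempty) (hcl : IsClosed K)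
    (hK : Convex ℝ K) {A : E → E} {m L : ℝ} (hm : 0 < m)
    (hmono : ∀ x y, m * ‖x - y‖ ^ 2 ≤ inner ℝ (A x - A y) (x - y))
    (hL : ∀ x y, ‖A x - A y‖ ≤ L * ‖x - y‖) :
    ∃! x, x ∈ K ∧ ∀ v ∈ K, 0 ≤ inner ℝ (A x) (v - x) := by
  obtain ⟨π, hπK, hπ⟩ := exists_convexProjection hne hcl hK
  -- Enlarging the Lipschitz constant to M ≥ m > 0 ensures q ≥ 0 below.
  set M := |L| + m with hM
  have hMpos : 0 < M := by positivity
  have hmM : m ≤ M := by simp [hM]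
  have hLM : ∀ x y, ‖A x - A y‖ ≤ M * ‖x - y‖ := fun x y => (hL x y).trans <| by
    gcongr; exact (le_abs_self L).trans (by simp [hM, hm.le])
  -- This r minimizes the squared contraction factor 1 - 2mr + M²r²; the minimum is q.
  set r := m / M ^ 2
  have hr : 0 < r := by positivity
  set q := 1 - m ^ 2 / M ^ 2
  have hq : 0 ≤ q := by
    have : m ^ 2 / M ^ 2 ≤ 1 := by rw [div_le_one (by positivity)]; gcongr
    simp only [q]; linarith
  have hq1 : q < 1 := by
    have : 0 < m ^ 2 / M ^ 2 := by positivity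
    simp only [q]; linarith
  set T : E → E := fun x => π (x - r • A x)
  have hT : ∀ x y, ‖T x - T y‖ ≤ √q * ‖x - y‖ := fun x y => by
    refine (norm_sub_le_of_convexProjection (hπK _) (hπK _) (hπ _) (hπ _)).trans ?_
    refine abs_le_of_sq_le_sq' ?_ (by positivity) |>.2
    rw [mul_pow, Real.sq_sqrt hq,
      show x - r • A x - (y - r • A y) = (x - y) - r • (A x - A y) by module,
      @norm_sub_sq_real, inner_smul_right, norm_smul, Real.norm_of_nonneg hr.le,
      real_inner_comm]
    have h₁ := hmono x y
    have h₂ : ‖A x - A y‖ ^ 2 ≤ M ^ 2 * ‖x - y‖ ^ 2 := by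
      rw [← mul_pow]; gcongr; exact hLM x y
    have h₃ : (r * ‖A x - A y‖) ^ 2 ≤ r ^ 2 * (M ^ 2 * ‖x - y‖ ^ 2) := by
      rw [mul_pow]; gcongr
    have h₄ : r ^ 2 * (M ^ 2 * ‖x - y‖ ^ 2) = m ^ 2 / M ^ 2 * ‖x - y‖ ^ 2 := by
      simp only [r]; field_simp
    have h₅ : r * (m * ‖x - y‖ ^ 2) = m ^ 2 / M ^ 2 * ‖x - y‖ ^ 2 := by
      simp only [r]; field_simp
    have h₆ := mul_le_mul_of_nonneg_left h₁ hr.le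
    simp only [q]
    linarith
  have hcontr : ContractingWith (√q).toNNReal T := by
    refine ⟨?_, LipschitzWith.of_dist_le_mul fun x y => ?_⟩
    · rw [Real.toNNReal_lt_one]
      exact (Real.sqrt_lt' one_pos).2 (by simpa using hq1)
    · rw [dist_eq_norm, dist_eq_norm, Real.coe_toNNReal _ (Real.sqrt_nonneg q)]; exact hT x y
  have hfix : T (hcontr.fixedPoint T) = hcontr.fixedPoint T := hcontr.fixedPoint_isFixedPt
  set x := hcontr.fixedPoint T
  have hx : x ∈ K ∧ ∀ v ∈ K, 0 ≤ inner ℝ (A x) (v - x) := by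
    refine ⟨hfix ▸ hπK _, fun v hv => ?_⟩
    have := hπ (x - r • A x) v hv
    rw [show π (x - r • A x) = x from hfix] at this
    rw [sub_sub_cancel_left, inner_neg_left, inner_smul_left] at this
    have h2 : 0 ≤ r * inner ℝ (A x) (v - x) := by simpa using this
    exact nonneg_of_mul_nonneg_right h2 hr
  refine ⟨x, hx, fun y hy => ?_⟩
  have h₁ := hx.2 y hy.1
  have h₂ := hy.2 x hx.1
  have h₃ := hmono y x
  have h₄ : inner ℝ (A y - A x) (y - x) ≤ 0 := by
    simp only [inner_sub_left, inner_sub_right] at *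
    linarith
  have h₅ : ‖y - x‖ ^ 2 ≤ 0 := by
    by_contra! h
    have := mul_pos hm h
    linarith
  have : ‖y - x‖ = 0 := by
    have := sq_nonneg ‖y - x‖
    exact pow_eq_zero_iff (two_ne_zero) |>.1 (le_antisymm h₅ this)
  exact sub_eq_zero.1 (norm_eq_zero.1 this)

end VariationalInequality

/-! ### Recursively defined families -/

section Recursion

theorem existsUnique_forward {V : Type*} {N : ℕ} (y₀ : V) {Q : Fin N → V → V → Prop}
    (hQ : ∀ n o, ∃! y, Q n o y) :
    ∃! Y : Fin (N + 1) → V, Y 0 = y₀ ∧ ∀ n : Fin N, Q n (Y n.castSucc) (Y n.succ) := by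
  choose g hg hg' using hQ
  refine ⟨fun m => Fin.induction y₀ (fun n y => g n y) m, ⟨rfl, fun n => ?_⟩, fun Z hZ => ?_⟩
  · exact hg n _
  · funext m
    induction m using Fin.induction with
    | zero => exact hZ.1
    | succ n ih => exact (hg' n _ _ (hZ.2 n)).trans (by rw [ih]; rfl)

/-- Reversing the order of the time levels reduces this to the forward recursion. -/
theorem existsUnique_backward {V : Type*} {N : ℕ} (p₀ : V) {Q : Fin N → V → V → Prop}
    (hQ : ∀ n o, ∃! y, Q n o y) :
    ∃! P : Fin (N + 1) → V, P (Fin.last N) = p₀ ∧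
      ∀ n : Fin N, Q n (P n.succ) (P n.castSucc) := by
  obtain ⟨Y, hY, hY'⟩ := existsUnique_forward p₀ (Q := fun n => Q n.rev) fun n => hQ n.rev
  refine ⟨fun m => Y m.rev, ⟨by simpa using hY.1, fun n => ?_⟩, fun P hP => ?_⟩
  · have := hY.2 n.rev
    simpa [Fin.rev_succ, Fin.rev_castSucc] using this
  · have := hY' (fun m => P m.rev) ⟨by simpa using hP.1, fun n => by
      simpa [Fin.rev_succ, Fin.rev_castSucc] using hP.2 n.rev⟩
    funext m
    simpa using congrFun this m.rev

theorem fin_sum_telescope {N : ℕ} (a : Fin (N + 1) → ℝ) :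
    ∑ n : Fin N, (a n.succ - a n.castSucc) = a (Fin.last N) - a 0 := by
  induction N with
  | zero => simp
  | succ N ih =>
    rw [Fin.sum_univ_castSucc]
    have := ih fun m => a m.castSucc
    simp only [Fin.succ_castSucc] at this ⊢
    rw [this]
    simp

theorem le_add_sum_of_step_le {N : ℕ} (a : Fin (N + 1) → ℝ) (c : Fin N → ℝ) (hc : ∀ n, 0 ≤ c n)
    (h : ∀ n : Fin N, a n.succ ≤ a n.castSucc + c n) (m : Fin (N + 1)) :
    a m ≤ a 0 + ∑ n, c n := by
  induction N with
  | zero =>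
    have : m = 0 := Subsingleton.elim (α := Fin 1) _ _
    simp [this]
  | succ N ih =>
    rw [Fin.sum_univ_castSucc, ← add_assoc]
    have key : ∀ m : Fin (N + 1), a m.castSucc ≤ a 0 + ∑ n : Fin N, c n.castSucc := fun m => by
      refine ih (fun m => a m.castSucc) (fun n => c n.castSucc) (fun n => hc _) (fun n => ?_) m
      exact h n.castSucc
    induction m using Fin.lastCases with
    | last =>
      have := h (Fin.last N)
      have := key (Fin.last N)
      simp only [Fin.succ_last] at *
      linarith
    | cast m => have := key m; have := hc (Fin.last N); linarith

/-- Discrete energy estimate with a forcing that is linear in the solution. -/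
theorem energy_of_step_le {N : ℕ} {k : ℝ} (hk : 0 ≤ k) {x Φ : Fin (N + 1) → ℝ} {g r : Fin N → ℝ}
    (hx : ∀ m, 0 ≤ x m) (hr : ∀ n, 0 ≤ r n) (hg : ∀ n, 0 ≤ g n) (hΦ : ∀ m, x m ^ 2 ≤ Φ m)
    (hΦ0 : Φ 0 = 0)
    (h : ∀ n : Fin N, Φ n.succ + g n ≤ Φ n.castSucc + 2 * k * r n * x n.succ) :
    (∀ m, x m ≤ 2 * k * ∑ n, r n) ∧ ∑ n, g n ≤ (2 * k * ∑ n, r n) ^ 2 := by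
  -- At a level where x is largest the accumulated forcing is at most W · x m₀ with W = 2k ∑ r, so x
  -- m₀ ^ 2 ≤ W · x m₀. This avoids a Gronwall argument.
  obtain ⟨m₀, hm₀⟩ := Finite.exists_max x
  have hW : 0 ≤ 2 * k * ∑ n, r n := by have := Finset.sum_nonneg fun n (_ : n ∈ Finset.univ) => hr n
                                       positivity
  have hsum : ∑ n : Fin N, 2 * k * r n * x n.succ ≤ (2 * k * ∑ n, r n) * x m₀ := by
    rw [Finset.mul_sum, Finset.sum_mul]
    refine Finset.sum_le_sum fun n _ => ?_
    have := hr n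
    gcongr
    exact hm₀ _
  have hbd : ∀ m, x m ≤ 2 * k * ∑ n, r n := fun m => by
    refine (hm₀ m).trans ?_
    have h1 := le_add_sum_of_step_le Φ (fun n => 2 * k * r n * x n.succ)
      (fun n => by have := hr n; have := hx n.succ; positivity)
      (fun n => by have := h n; have := hg n; linarith) m₀
    have h2 : x m₀ * x m₀ ≤ (2 * k * ∑ n, r n) * x m₀ := by
      have := hΦ m₀
      nlinarith
    rcases (hx m₀).eq_or_lt with h0 | h0
    · rw [← h0]; exact hW
    · exact le_of_mul_le_mul_right h2 h0
  refine ⟨hbd, ?_⟩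
  have h3 : ∑ n, g n ≤ ∑ n : Fin N, (2 * k * r n * x n.succ - (Φ n.succ - Φ n.castSucc)) :=
    Finset.sum_le_sum fun n _ => by have := h n; linarith
  rw [Finset.sum_sub_distrib, fin_sum_telescope] at h3
  have h4 := (sq_nonneg _).trans (hΦ (Fin.last N))
  have h5 := mul_le_mul_of_nonneg_left (hbd m₀) hW
  nlinarith

end Recursion

end AFC

namespace AFC

/-! ### One implicit time step in abstract form -/

section AbstractStep

variable {V H₁ H₂ : Type*} [AddCommGroup V] [Module ℝ V]
  [NormedAddCommGroup H₁] [InnerProductSpace ℝ H₁]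
  [NormedAddCommGroup H₂] [InnerProductSpace ℝ H₂]

/-- A definite form embeds V into its dual, which has the same dimension. -/
theorem existsUnique_of_definite [FiniteDimensional ℝ V] (B : V →ₗ[ℝ] V →ₗ[ℝ] ℝ)
    (hB : ∀ v, B v v ≤ 0 → v = 0) (f : V →ₗ[ℝ] ℝ) : ∃! v, ∀ w, B v w = f w := by
  have hinj : Function.Injective B := by
    rw [← LinearMap.ker_eq_bot, LinearMap.ker_eq_bot']
    exact fun v hv => hB v (by simp [hv])
  have hsurj : Function.Surjective B :=
    (LinearMap.injective_iff_surjective_of_finrank_eq_finrank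
      (Subspace.dual_finrank_eq (K := ℝ) (V := V)).symm).1 hinj
  obtain ⟨v, hv⟩ := hsurj f
  exact ⟨v, fun w => by rw [hv], fun u hu => hinj (by rw [hv]; exact LinearMap.ext hu)⟩

/-- The forms of an implicit time step, multiplied by the step size `k`: a skew part `c`, a
stabilization `T₁` of the new value, a stabilization `T₂` of the increment, and a nonlinear
correction `R` depending on the new and the old value. The mass form is `⟪I ·, I ·⟫` and the
diffusion is `μ k ⟪D ·, D ·⟫`. -/
structure StepForms (I : V →ₗ[ℝ] H₁) (D : V →ₗ[ℝ] H₂) (μ k η : ℝ) where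
  c : V →ₗ[ℝ] V →ₗ[ℝ] ℝ
  T₁ : V →ₗ[ℝ] V →ₗ[ℝ] ℝ
  T₂ : V →ₗ[ℝ] V →ₗ[ℝ] ℝ
  R : V → V → V →ₗ[ℝ] ℝ
  c_self : ∀ v, c v v = 0
  T₁_nonneg : ∀ v, 0 ≤ T₁ v v
  T₂_nonneg : ∀ v, 0 ≤ T₂ v v
  -- These three bounds carry the smallness: compared with the diffusion μk‖D ·‖², all
  -- stabilizations and corrections have the relative size η/μ.
  T₁_le : ∀ v w, |T₁ v w| ≤ k * η * ‖D v‖ * ‖D w‖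
  T₂_le : ∀ v w, |T₂ v w| ≤ k * η * ‖D v‖ * ‖D w‖
  R_le : ∀ v o v' o' w, |R v o w - R v' o' w| ≤ k * η * (‖D (v - v')‖ + ‖D (o - o')‖) * ‖D w‖

namespace StepForms

variable {I : V →ₗ[ℝ] H₁} {D : V →ₗ[ℝ] H₂} {μ k η : ℝ} (S : StepForms I D μ k η)

/-- `y` is obtained from the old value `o` by the linear step whose correction is computed from
`v`, with right-hand side `f`. -/
def Iterates (f : V →ₗ[ℝ] ℝ) (o v y : V) : Prop :=
  ∀ χ, inner ℝ (I (y - o)) (I χ) + μ * k * inner ℝ (D y) (D χ) + S.c y χ + S.T₁ y χ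
    + S.T₂ (y - o) χ - S.R v o χ = f χ

/-- `y` is obtained from the old value `o` by the nonlinear step with right-hand side `f`. -/
def Solves (f : V →ₗ[ℝ] ℝ) (o y : V) : Prop := S.Iterates f o y y

/-- The bilinear part is definite: on the diagonal `c` vanishes, `T₁`, `T₂` and the diffusion are
nonnegative, and the mass form is positive because `I` is injective. The correction is evaluated at
v and therefore belongs to the data. -/
theorem exists_map [FiniteDimensional ℝ V] (hI : Function.Injective I) (hμk : 0 ≤ μ * k)
    (f : V →ₗ[ℝ] ℝ) (o : V) : ∃ g : V → V, ∀ v y, S.Iterates f o v y ↔ y = g v := by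
  set M : V →ₗ[ℝ] V →ₗ[ℝ] ℝ := (innerₗ H₁).compl₁₂ I I
  set G : V →ₗ[ℝ] V →ₗ[ℝ] ℝ := (innerₗ H₂).compl₁₂ D D
  set B : V →ₗ[ℝ] V →ₗ[ℝ] ℝ := M + (μ * k) • G + S.c + S.T₁ + S.T₂ with hB
  have hdef : ∀ v, B v v ≤ 0 → v = 0 := fun v hv => by
    have h1 : B v v = ‖I v‖ ^ 2 + μ * k * ‖D v‖ ^ 2 + S.c v v + S.T₁ v v + S.T₂ v v := by
      simp [hB, M, G]
    rw [h1, S.c_self] at hv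
    have := S.T₁_nonneg v
    have := S.T₂_nonneg v
    have h2 : 0 ≤ μ * k * ‖D v‖ ^ 2 := by positivity
    have h3 : ‖I v‖ ^ 2 = 0 := le_antisymm (by linarith) (sq_nonneg _)
    exact hI (by simpa using h3)
  choose g hg hg' using fun v => existsUnique_of_definite B hdef (f + S.R v o + M o + S.T₂ o)
  have key : ∀ v y, S.Iterates f o v y ↔ ∀ w, B y w = (f + S.R v o + M o + S.T₂ o) w := by
    refine fun v y => forall_congr' fun w => ?_
    simp only [hB, M, G, LinearMap.add_apply, LinearMap.smul_apply, LinearMap.compl₁₂_apply,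
      innerₗ_apply_apply, map_sub, inner_sub_left, LinearMap.sub_apply, smul_eq_mul]
    constructor <;> intro h <;> linarith
  refine ⟨g, fun v y => (key v y).trans ⟨fun h => hg' v y h, ?_⟩⟩
  rintro rfl
  exact hg v

/-- Test the difference of the equations with y₁ - y₂. The old value is common to both, so it
cancels in `T₂` and only v₁ - v₂ survives in the bound for `R`. -/
theorem iterates_sub {f₁ f₂ : V →ₗ[ℝ] ℝ} {o v₁ v₂ y₁ y₂ : V} (h₁ : S.Iterates f₁ o v₁ y₁)
    (h₂ : S.Iterates f₂ o v₂ y₂) :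
    ‖I (y₁ - y₂)‖ ^ 2 + μ * k * ‖D (y₁ - y₂)‖ ^ 2 ≤
      k * η * ‖D (v₁ - v₂)‖ * ‖D (y₁ - y₂)‖ + (f₁ (y₁ - y₂) - f₂ (y₁ - y₂)) := by
  have e₁ := h₁ (y₁ - y₂)
  have e₂ := h₂ (y₁ - y₂)
  have hc := S.c_self (y₁ - y₂)
  have hT₁ := S.T₁_nonneg (y₁ - y₂)
  have hT₂ := S.T₂_nonneg (y₁ - y₂)
  have hR := (abs_le.1 (S.R_le v₁ o v₂ o (y₁ - y₂))).2
  rw [sub_self, map_zero, norm_zero, add_zero] at hR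
  rw [← real_inner_self_eq_norm_sq, ← real_inner_self_eq_norm_sq]
  generalize S.R v₁ o (y₁ - y₂) = r₁ at *
  generalize S.R v₂ o (y₁ - y₂) = r₂ at *
  generalize f₁ (y₁ - y₂) = s₁ at *
  generalize f₂ (y₁ - y₂) = s₂ at *
  generalize hχ : y₁ - y₂ = χ at *
  have a₁ : inner ℝ (I χ) (I χ) = inner ℝ (I (y₁ - o)) (I χ) - inner ℝ (I (y₂ - o)) (I χ) := by
    rw [← inner_sub_left, ← map_sub, sub_sub_sub_cancel_right, hχ]
  have a₂ : inner ℝ (D χ) (D χ) = inner ℝ (D y₁) (D χ) - inner ℝ (D y₂) (D χ) := by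
    rw [← inner_sub_left, ← map_sub, hχ]
  have a₃ : S.c χ χ = S.c y₁ χ - S.c y₂ χ := by
    rw [← LinearMap.sub_apply, ← map_sub, hχ]
  have a₄ : S.T₁ χ χ = S.T₁ y₁ χ - S.T₁ y₂ χ := by
    rw [← LinearMap.sub_apply, ← map_sub, hχ]
  have a₅ : S.T₂ χ χ = S.T₂ (y₁ - o) χ - S.T₂ (y₂ - o) χ := by
    rw [← LinearMap.sub_apply, ← map_sub, sub_sub_sub_cancel_right, hχ]
  rw [a₁, a₂]
  rw [a₃] at hc
  rw [a₄] at hT₁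
  rw [a₅] at hT₂
  linarith

/-- The difference of two nonlinear steps, tested with an arbitrary element. -/
theorem solves_sub_test (hkη : 0 ≤ k * η) {f₁ f₂ : V →ₗ[ℝ] ℝ} {o₁ o₂ y₁ y₂ : V}
    (h₁ : S.Solves f₁ o₁ y₁) (h₂ : S.Solves f₂ o₂ y₂) (χ : V) :
    |inner ℝ (I ((y₁ - y₂) - (o₁ - o₂))) (I χ) + μ * k * inner ℝ (D (y₁ - y₂)) (D χ)
      + S.c (y₁ - y₂) χ - (f₁ χ - f₂ χ)|
      ≤ 3 * (k * η) * (‖D (y₁ - y₂)‖ + ‖D (o₁ - o₂)‖) * ‖D χ‖ := by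
  have e₁ := h₁ χ
  have e₂ := h₂ χ
  have b₁ := S.T₁_le (y₁ - y₂) χ
  have b₂ := S.T₂_le ((y₁ - y₂) - (o₁ - o₂)) χ
  have b₃ := S.R_le y₁ o₁ y₂ o₂ χ
  have b₄ : ‖D ((y₁ - y₂) - (o₁ - o₂))‖ ≤ ‖D (y₁ - y₂)‖ + ‖D (o₁ - o₂)‖ := by
    rw [map_sub]; exact norm_sub_le _ _
  have b₅ : k * η * ‖D ((y₁ - y₂) - (o₁ - o₂))‖ * ‖D χ‖
      ≤ k * η * (‖D (y₁ - y₂)‖ + ‖D (o₁ - o₂)‖) * ‖D χ‖ := by gcongr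
  have b₆ : k * η * ‖D (y₁ - y₂)‖ * ‖D χ‖
      ≤ k * η * (‖D (y₁ - y₂)‖ + ‖D (o₁ - o₂)‖) * ‖D χ‖ := by
    gcongr; exact le_add_of_nonneg_right (norm_nonneg _)
  have key : inner ℝ (I ((y₁ - y₂) - (o₁ - o₂))) (I χ) + μ * k * inner ℝ (D (y₁ - y₂)) (D χ)
      + S.c (y₁ - y₂) χ - (f₁ χ - f₂ χ) = -(S.T₁ (y₁ - y₂) χ)
        - S.T₂ ((y₁ - y₂) - (o₁ - o₂)) χ + (S.R y₁ o₁ χ - S.R y₂ o₂ χ) := by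
    simp only [map_sub, inner_sub_left, LinearMap.sub_apply] at e₁ e₂ ⊢
    linarith
  rw [key, abs_le]
  rw [abs_le] at b₁ b₂ b₃
  constructor <;> linarith

/-- Test with the difference and use 2⟪a - b, a⟫ = ‖a‖² - ‖b‖² + ‖a - b‖². Through `T₂` and `R` the
gradient of the old difference enters, which ‖I ·‖ does not control uniformly. The quarter of the
diffusion included in the energy on both sides takes it up: Young's inequality produces 2kη‖D(o₁ -
o₂)‖², and 8η ≤ μ makes this at most μk/4 times the same square. -/
theorem solves_energy (hk : 0 ≤ k) (hη : 0 ≤ η) (hημ : 8 * η ≤ μ) {f₁ f₂ : V →ₗ[ℝ] ℝ}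
    {o₁ o₂ y₁ y₂ : V} (h₁ : S.Solves f₁ o₁ y₁) (h₂ : S.Solves f₂ o₂ y₂) :
    ‖I (y₁ - y₂)‖ ^ 2 + μ * k / 4 * ‖D (y₁ - y₂)‖ ^ 2
      + (‖I (y₁ - y₂) - I (o₁ - o₂)‖ ^ 2 + μ * k * ‖D (y₁ - y₂)‖ ^ 2)
      ≤ ‖I (o₁ - o₂)‖ ^ 2 + μ * k / 4 * ‖D (o₁ - o₂)‖ ^ 2
        + 2 * (f₁ (y₁ - y₂) - f₂ (y₁ - y₂)) := by
  have e₁ := h₁ (y₁ - y₂)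
  have e₂ := h₂ (y₁ - y₂)
  have hc := S.c_self (y₁ - y₂)
  have hT₁ := S.T₁_nonneg (y₁ - y₂)
  have hT₂ := S.T₂_nonneg (y₁ - y₂)
  have hT₂' := (abs_le.1 (S.T₂_le (o₁ - o₂) (y₁ - y₂))).2
  have hR := (abs_le.1 (S.R_le y₁ o₁ y₂ o₂ (y₁ - y₂))).2
  have key : inner ℝ (I (y₁ - y₂) - I (o₁ - o₂)) (I (y₁ - y₂))
      + μ * k * inner ℝ (D (y₁ - y₂)) (D (y₁ - y₂)) + S.c (y₁ - y₂) (y₁ - y₂)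
      + S.T₁ (y₁ - y₂) (y₁ - y₂) + S.T₂ (y₁ - y₂) (y₁ - y₂) - S.T₂ (o₁ - o₂) (y₁ - y₂)
      - (S.R y₁ o₁ (y₁ - y₂) - S.R y₂ o₂ (y₁ - y₂)) = f₁ (y₁ - y₂) - f₂ (y₁ - y₂) := by
    generalize S.R y₁ o₁ (y₁ - y₂) = r₁ at *
    generalize S.R y₂ o₂ (y₁ - y₂) = r₂ at *
    generalize f₁ (y₁ - y₂) = s₁ at *
    generalize f₂ (y₁ - y₂) = s₂ at *
    generalize hχ : y₁ - y₂ = χ at *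
    have hy : y₁ = y₂ + χ := by rw [← hχ]; abel
    subst hy
    simp only [map_sub, map_add, inner_sub_left, inner_add_left, LinearMap.sub_apply,
      LinearMap.add_apply] at e₁ e₂ ⊢
    linarith
  rw [real_inner_self_eq_norm_sq] at key
  have hsq := norm_sub_sq_real (I (y₁ - y₂)) (I (o₁ - o₂))
  rw [inner_sub_left, real_inner_self_eq_norm_sq] at key
  rw [real_inner_comm] at hsq
  have hkη : 8 * (k * η) ≤ μ * k := by nlinarith
  have hkη0 : 0 ≤ k * η := mul_nonneg hk hη
  set x := ‖D (y₁ - y₂)‖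
  set z := ‖D (o₁ - o₂)‖
  have q₁ : k * η * (z * x) ≤ k * η * ((z ^ 2 + x ^ 2) / 2) := by
    gcongr; nlinarith [sq_nonneg (z - x)]
  have q₂ : 8 * (k * η) * x ^ 2 ≤ μ * k * x ^ 2 := by gcongr
  have q₃ : 8 * (k * η) * z ^ 2 ≤ μ * k * z ^ 2 := by gcongr
  nlinarith

/-- Solutions are the fixed points of the map of `exists_map`. In `iterates_sub` the gradient of the
image difference is absorbed by Young's inequality, and the remaining kη²/(4μ)‖D(v - w)‖² is at most
θ‖I(v - w)‖² by the hypothesis `hinv`, the place where an inverse inequality enters. -/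
theorem existsUnique_solves [FiniteDimensional ℝ V] (hI : Function.Injective I) (hμ : 0 < μ)
    (hk : 0 ≤ k) {θ : ℝ} (hθ : θ < 1)
    (hinv : ∀ v, k * η ^ 2 * ‖D v‖ ^ 2 ≤ 4 * μ * θ * ‖I v‖ ^ 2)
    (f : V →ₗ[ℝ] ℝ) (o : V) : ∃! y, S.Solves f o y := by
  obtain ⟨g, hg⟩ := S.exists_map hI (by positivity) f o
  have hcon : ∀ v w, ‖I (g v - g w)‖ ^ 2 ≤ θ * ‖I (v - w)‖ ^ 2 := fun v w => by
    have h := S.iterates_sub ((hg v _).2 rfl) ((hg w _).2 rfl)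
    have h' := hinv (v - w)
    set x := ‖D (v - w)‖
    set z := ‖D (g v - g w)‖
    have : 4 * μ * (k * η * x * z) ≤ k * η ^ 2 * x ^ 2 + 4 * μ ^ 2 * k * z ^ 2 := by
      nlinarith [mul_nonneg hk (sq_nonneg (η * x - 2 * μ * z))]
    have h4 : 4 * μ * ‖I (g v - g w)‖ ^ 2 ≤ 4 * μ * (θ * ‖I (v - w)‖ ^ 2) := by nlinarith
    exact le_of_mul_le_mul_left h4 (by positivity)
  -- The contraction holds in the norm pulled back along I, for which V is complete by finite
  -- dimension.
  let _ : NormedAddCommGroup V := NormedAddCommGroup.induced V H₁ I hI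
  let _ : NormedSpace ℝ V := NormedSpace.induced ℝ V H₁ I
  have : CompleteSpace V := FiniteDimensional.complete ℝ V
  have hn : ∀ v : V, ‖v‖ = ‖I v‖ := fun v => rfl
  have hcontr : ContractingWith (√θ).toNNReal g := by
    refine ⟨?_, LipschitzWith.of_dist_le_mul fun x y => ?_⟩
    · rw [Real.toNNReal_lt_one]
      exact (Real.sqrt_lt' one_pos).2 (by simpa using hθ)
    · rw [dist_eq_norm, dist_eq_norm, Real.coe_toNNReal _ (Real.sqrt_nonneg θ), hn, hn]
      -- For negative θ the square root is 0, and the estimate already forces the images to coincide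
      -- under I.
      rcases le_or_gt 0 θ with h0 | h0
      · refine abs_le_of_sq_le_sq' ?_ (by positivity) |>.2
        rw [mul_pow, Real.sq_sqrt h0]
        exact hcon x y
      · have h1 := hcon x y
        have h2 : θ * ‖I (x - y)‖ ^ 2 ≤ 0 := mul_nonpos_of_nonpos_of_nonneg h0.le (sq_nonneg _)
        have h3 : ‖I (g x - g y)‖ ^ 2 = 0 := le_antisymm (by linarith) (sq_nonneg _)
        rw [pow_eq_zero_iff two_ne_zero] at h3
        rw [h3]; positivity
  have hiff : ∀ y, S.Solves f o y ↔ Function.IsFixedPt g y := fun y =>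
    (hg y y).trans eq_comm
  have : Nonempty V := ⟨0⟩
  refine ⟨hcontr.fixedPoint g, (hiff _).2 hcontr.fixedPoint_isFixedPt, fun y hy => ?_⟩
  exact hcontr.fixedPoint_unique ((hiff y).1 hy)

end StepForms

end AbstractStep

end AFC

namespace AFC

noncomputable section

/-! ### The coupled forward-backward scheme in abstract form -/

section AbstractScheme

variable {V H₁ H₂ : Type*} [AddCommGroup V] [Module ℝ V]
  [NormedAddCommGroup H₁] [InnerProductSpace ℝ H₁]
  [NormedAddCommGroup H₂] [InnerProductSpace ℝ H₂]

/-- The forms of a forward-backward scheme with `N` steps. The state steps carry the convection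
forms `cv` at the new time levels, the co-state steps carry `-cv` at their (lower) levels. -/
structure SchemeForms (I : V →ₗ[ℝ] H₁) (D : V →ₗ[ℝ] H₂) (μ k η : ℝ) (N : ℕ) where
  st : Fin N → StepForms I D μ k η
  cs : Fin N → StepForms I D μ k η
  cv : Fin (N + 1) → V →ₗ[ℝ] V →ₗ[ℝ] ℝ
  lump : V →ₗ[ℝ] V →ₗ[ℝ] ℝ
  F : Fin N → V →ₗ[ℝ] ℝ
  G : Fin N → V →ₗ[ℝ] ℝ
  β : ℝ
  κ : ℝ
  κ_nonneg : 0 ≤ κ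
  cv_self : ∀ m v, cv m v v = 0
  cv_le : ∀ m v w, |cv m v w| ≤ β * ‖D v‖ * ‖I w‖
  lump_nonneg : ∀ v, 0 ≤ lump v v
  lump_le : ∀ v w, |lump v w| ≤ κ * ‖I v‖ * ‖I w‖
  st_c : ∀ n, (st n).c = k • cv n.succ
  cs_c : ∀ n, (cs n).c = -(k • cv n.castSucc)

namespace SchemeForms

variable {I : V →ₗ[ℝ] H₁} {D : V →ₗ[ℝ] H₂} {μ k η : ℝ} {N : ℕ} (S : SchemeForms I D μ k η N)

/-- The right-hand side of the state step with control `ψ`. -/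
def stateRhs (n : Fin N) (ψ : H₁) : V →ₗ[ℝ] ℝ := k • (innerₗ H₁ ψ ∘ₗ I) + S.F n

/-- The right-hand side of the co-state step with state `y`. -/
def costateRhs (n : Fin N) (y : V) : V →ₗ[ℝ] ℝ := k • S.lump y + S.G n

/-- The state step with control `ψ`, from the old state `o` to the new state `y`. -/
def IsState (n : Fin N) (ψ : H₁) (o y : V) : Prop := (S.st n).Solves (S.stateRhs n ψ) o y

/-- The co-state step with state `y`, from the known co-state `o` to the new co-state `w`. -/
def IsCostate (n : Fin N) (y o w : V) : Prop := (S.cs n).Solves (S.costateRhs n y) o w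

/-- `Y` and `P` solve all steps for the controls `ψ`. -/
def IsSolution (y₀ p₀ : V) (ψ : Fin N → H₁) (Y P : Fin (N + 1) → V) : Prop :=
  Y 0 = y₀ ∧ P (Fin.last N) = p₀ ∧ ∀ n : Fin N,
    S.IsState n (ψ n) (Y n.castSucc) (Y n.succ) ∧
      S.IsCostate n (Y n.succ) (P n.succ) (P n.castSucc)

theorem stateRhs_sub (n : Fin N) (ψ₁ ψ₂ : H₁) (v : V) :
    S.stateRhs n ψ₁ v - S.stateRhs n ψ₂ v = k * inner ℝ (ψ₁ - ψ₂) (I v) := by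
  simp only [stateRhs, LinearMap.add_apply, LinearMap.smul_apply, LinearMap.comp_apply,
    innerₗ_apply_apply, smul_eq_mul, inner_sub_left]
  ring

theorem costateRhs_sub (n : Fin N) (y₁ y₂ v : V) :
    S.costateRhs n y₁ v - S.costateRhs n y₂ v = k * S.lump (y₁ - y₂) v := by
  simp only [costateRhs, LinearMap.add_apply, LinearMap.smul_apply, smul_eq_mul, map_sub,
    LinearMap.sub_apply]
  ring

theorem cv_swap (m : Fin (N + 1)) (v w : V) : S.cv m v w = -S.cv m w v := by
  have h := S.cv_self m (v + w)
  simp only [map_add, LinearMap.add_apply, S.cv_self] at h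
  linarith

/-- The fixed-point iteration at one time level. -/
theorem exists_iteration [FiniteDimensional ℝ V] (hI : Function.Injective I) (hμ : 0 < μ)
    (hk : 0 ≤ k) {θ : ℝ} (hθ0 : 0 ≤ θ) (hθ : 2 * θ < 1)
    (hinv : ∀ v, k * η ^ 2 * ‖D v‖ ^ 2 ≤ 4 * μ * θ * ‖I v‖ ^ 2) (hκ : k * S.κ ≤ 1)
    (n : Fin N) (ψ : H₁) (o o' : V) :
    ∃ 𝒢 : V × V → V × V,
      (∀ s s', (S.st n).Iterates (S.stateRhs n ψ) o s.1 s'.1 ∧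
        (S.cs n).Iterates (S.costateRhs n s'.1) o' s.2 s'.2 ↔ s' = 𝒢 s) ∧
      (∀ s s', ‖I ((𝒢 s).1 - (𝒢 s').1)‖ ^ 2 + ‖I ((𝒢 s).2 - (𝒢 s').2)‖ ^ 2 ≤
        2 * θ * (‖I (s.1 - s'.1)‖ ^ 2 + ‖I (s.2 - s'.2)‖ ^ 2)) ∧
      ∃ z : V × V, (∀ y w, S.IsState n ψ o y ∧ S.IsCostate n y o' w ↔ (y, w) = z) ∧
        ∀ s, Tendsto (fun j : ℕ => ‖I ((𝒢^[j] s).1 - z.1)‖ ^ 2 + ‖I ((𝒢^[j] s).2 - z.2)‖ ^ 2)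
          atTop (𝓝 0) := by
  have hμk : 0 ≤ μ * k := by positivity
  obtain ⟨g, hg⟩ := (S.st n).exists_map hI hμk (S.stateRhs n ψ) o
  choose g' hg' using fun y => (S.cs n).exists_map hI hμk (S.costateRhs n y) o'
  set 𝒢 : V × V → V × V := fun s => (g s.1, g' (g s.1) s.2)
  have hiff : ∀ s s' : V × V, (S.st n).Iterates (S.stateRhs n ψ) o s.1 s'.1 ∧
        (S.cs n).Iterates (S.costateRhs n s'.1) o' s.2 s'.2 ↔ s' = 𝒢 s := fun s s' => by
    rw [hg, hg', Prod.ext_iff]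
    constructor
    · rintro ⟨h1, h2⟩; exact ⟨h1, by rw [h2, h1]⟩
    · rintro ⟨h1, h2⟩; exact ⟨h1, by rw [h2, h1]⟩
  -- Young's inequality with weights chosen so that the gradient of the image is absorbed completely
  -- by the diffusion.
  have absorb : ∀ (v w : V), 4 * μ * (k * η * ‖D v‖ * ‖D w‖) ≤
      4 * μ * θ * ‖I v‖ ^ 2 + 4 * μ * (μ * k * ‖D w‖ ^ 2) := fun v w => by
    have := hinv v
    nlinarith [mul_nonneg hk (sq_nonneg (η * ‖D v‖ - 2 * μ * ‖D w‖))]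
  have hcon : ∀ s s', ‖I ((𝒢 s).1 - (𝒢 s').1)‖ ^ 2 + ‖I ((𝒢 s).2 - (𝒢 s').2)‖ ^ 2 ≤
        2 * θ * (‖I (s.1 - s'.1)‖ ^ 2 + ‖I (s.2 - s'.2)‖ ^ 2) := fun s s' => by
    obtain ⟨h1, h2⟩ := (hiff s _).2 rfl
    obtain ⟨h1', h2'⟩ := (hiff s' _).2 rfl
    have e₁ := (S.st n).iterates_sub h1 h1'
    have e₂ := (S.cs n).iterates_sub h2 h2'
    rw [costateRhs_sub] at e₂
    rw [sub_self, add_zero] at e₁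
    have b₁ := absorb (s.1 - s'.1) ((𝒢 s).1 - (𝒢 s').1)
    have b₂ := absorb (s.2 - s'.2) ((𝒢 s).2 - (𝒢 s').2)
    have b₃ := (abs_le.1 (S.lump_le ((𝒢 s).1 - (𝒢 s').1) ((𝒢 s).2 - (𝒢 s').2))).2
    set a := ‖I ((𝒢 s).1 - (𝒢 s').1)‖
    set b := ‖I ((𝒢 s).2 - (𝒢 s').2)‖
    have b₄ : k * (S.κ * a * b) ≤ 1 * (a * b) := by
      rw [← mul_assoc, ← mul_assoc, mul_assoc]
      gcongr
    have b₅ := mul_le_mul_of_nonneg_left b₃ hk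
    have b₆ : a * b ≤ (a ^ 2 + b ^ 2) / 2 := by nlinarith [sq_nonneg (a - b)]
    -- The co-state sweep sees the new state, so its estimate contains k · κ · a · b ≤ (a² + b²)/2.
    -- Hence b² ≤ 2θ(...) + a², and adding a² ≤ θ(...) twice gives the factor 2θ.
    have c₁ : 4 * μ * a ^ 2 ≤ 4 * μ * (θ * ‖I (s.1 - s'.1)‖ ^ 2) := by nlinarith
    have c₂ : 4 * μ * (b ^ 2 / 2) ≤ 4 * μ * (θ * ‖I (s.2 - s'.2)‖ ^ 2 + a ^ 2 / 2) := by nlinarith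
    have c₁' := le_of_mul_le_mul_left c₁ (by positivity)
    have c₂' := le_of_mul_le_mul_left c₂ (by positivity)
    linarith
  refine ⟨𝒢, hiff, hcon, ?_⟩
  obtain ⟨y, hy, hy'⟩ := (S.st n).existsUnique_solves hI hμ hk (by linarith) hinv
    (S.stateRhs n ψ) o
  obtain ⟨w, hw, hw'⟩ := (S.cs n).existsUnique_solves hI hμ hk (by linarith) hinv
    (S.costateRhs n y) o'
  have hz : 𝒢 (y, w) = (y, w) := ((hiff (y, w) (y, w)).1 ⟨hy, hw⟩).symm
  refine ⟨(y, w), fun y₁ w₁ => ?_, fun s => ?_⟩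
  · rw [Prod.mk.injEq]
    constructor
    · rintro ⟨h1, h2⟩
      obtain rfl := hy' _ h1
      exact ⟨rfl, hw' _ h2⟩
    · rintro ⟨rfl, rfl⟩
      exact ⟨hy, hw⟩
  · have hb : ∀ j : ℕ, ‖I ((𝒢^[j] s).1 - y)‖ ^ 2 + ‖I ((𝒢^[j] s).2 - w)‖ ^ 2 ≤
        (2 * θ) ^ j * (‖I (s.1 - y)‖ ^ 2 + ‖I (s.2 - w)‖ ^ 2) := fun j => by
      induction j with
      | zero => simp
      | succ j ih =>
        have := hcon (𝒢^[j] s) (y, w)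
        rw [hz] at this
        rw [Function.iterate_succ_apply', pow_succ]
        refine this.trans ?_
        calc _ ≤ 2 * θ * ((2 * θ) ^ j * (‖I (s.1 - y)‖ ^ 2 + ‖I (s.2 - w)‖ ^ 2)) := by gcongr
          _ = _ := by ring
    refine squeeze_zero (fun j => by positivity) hb ?_
    simpa using (tendsto_pow_atTop_nhds_zero_of_lt_one (by linarith) hθ).mul_const
      (‖I (s.1 - y)‖ ^ 2 + ‖I (s.2 - w)‖ ^ 2)

/-- For given controls the coupling is one-way: the states are determined forward in time, and then
serve as data for the backward co-state recursion. -/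
theorem existsUnique_solution [FiniteDimensional ℝ V] (hI : Function.Injective I) (hμ : 0 < μ)
    (hk : 0 ≤ k) {θ : ℝ} (hθ : θ < 1)
    (hinv : ∀ v, k * η ^ 2 * ‖D v‖ ^ 2 ≤ 4 * μ * θ * ‖I v‖ ^ 2) (y₀ p₀ : V) (ψ : Fin N → H₁) :
    ∃! s : (Fin (N + 1) → V) × (Fin (N + 1) → V), S.IsSolution y₀ p₀ ψ s.1 s.2 := by
  obtain ⟨Y, hY, hY'⟩ := existsUnique_forward y₀ (Q := fun n o y => S.IsState n (ψ n) o y)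
    fun n o => (S.st n).existsUnique_solves hI hμ hk hθ hinv _ o
  obtain ⟨P, hP, hP'⟩ := existsUnique_backward p₀ (Q := fun n o w => S.IsCostate n (Y n.succ) o w)
    fun n o => (S.cs n).existsUnique_solves hI hμ hk hθ hinv _ o
  refine ⟨(Y, P), ⟨hY.1, hP.1, fun n => ⟨hY.2 n, hP.2 n⟩⟩, ?_⟩
  rintro ⟨Y₁, P₁⟩ ⟨h1, h2, h3⟩
  obtain rfl : Y₁ = Y := hY' _ ⟨h1, fun n => (h3 n).1⟩
  exact Prod.ext rfl (hP' _ ⟨h2, fun n => (h3 n).2⟩)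

/-- Stability of one time level with respect to the control. -/
theorem norm_costate_sub_le (hμ : 0 ≤ μ) (hk : 0 ≤ k) (hη : 0 ≤ η) (hημ : 8 * η ≤ μ) {n : Fin N}
    {ψ₁ ψ₂ : H₁} {o o' y₁ y₂ w₁ w₂ : V} (hy₁ : S.IsState n ψ₁ o y₁) (hy₂ : S.IsState n ψ₂ o y₂)
    (hw₁ : S.IsCostate n y₁ o' w₁) (hw₂ : S.IsCostate n y₂ o' w₂) :
    ‖I (w₁ - w₂)‖ ≤ 4 * S.κ * k * k * ‖ψ₁ - ψ₂‖ := by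
  have cancel : ∀ a b : ℝ, 0 ≤ a → 0 ≤ b → a ^ 2 ≤ b * a → a ≤ b := fun a b ha hb h => by
    rcases ha.eq_or_lt with h0 | h0
    · linarith
    · exact le_of_mul_le_mul_right (by linarith [sq a]) h0
  have e₁ := (S.st n).solves_energy hk hη hημ hy₁ hy₂
  have e₂ := (S.cs n).solves_energy hk hη hημ hw₁ hw₂
  rw [stateRhs_sub] at e₁
  rw [costateRhs_sub] at e₂
  simp only [sub_self, map_zero, norm_zero] at e₁ e₂
  have hD : ∀ v, 0 ≤ μ * k * ‖D v‖ ^ 2 := fun v => by positivity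
  have b₁ := mul_le_mul_of_nonneg_left (real_inner_le_norm (ψ₁ - ψ₂) (I (y₁ - y₂))) hk
  have b₂ := mul_le_mul_of_nonneg_left (abs_le.1 (S.lump_le (y₁ - y₂) (w₁ - w₂))).2 hk
  have hκ := S.κ_nonneg
  -- The old values agree, so the energy at the known level is zero. Each of the two equations
  -- contributes one factor 2k.
  have c₁ : ‖I (y₁ - y₂)‖ ≤ 2 * k * ‖ψ₁ - ψ₂‖ := by
    refine cancel _ _ (norm_nonneg _) (by positivity) ?_
    have := hD (y₁ - y₂)
    have := sq_nonneg ‖I (y₁ - y₂) - 0‖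
    nlinarith
  have c₂ : ‖I (w₁ - w₂)‖ ≤ 2 * k * (S.κ * ‖I (y₁ - y₂)‖) := by
    refine cancel _ _ (norm_nonneg _) (by positivity) ?_
    have := hD (w₁ - w₂)
    have := sq_nonneg ‖I (w₁ - w₂) - 0‖
    nlinarith
  calc _ ≤ 2 * k * (S.κ * (2 * k * ‖ψ₁ - ψ₂‖)) := c₂.trans (by gcongr)
    _ = _ := by ring

/-! ### Stability of the coupled scheme and monotonicity of the control-to-co-state map -/

section Stability

variable {y₀ p₀ : V} {ψ₁ ψ₂ : Fin N → H₁} {Y₁ P₁ Y₂ P₂ : Fin (N + 1) → V}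

/-- Besides the bound at each level, the sum of squared time increments and gradients is recorded;
it is what controls the errors in `pairing_step`. -/
theorem state_stability (hμ : 0 ≤ μ) (hk : 0 ≤ k) (hη : 0 ≤ η) (hημ : 8 * η ≤ μ)
    (h₁ : S.IsSolution y₀ p₀ ψ₁ Y₁ P₁) (h₂ : S.IsSolution y₀ p₀ ψ₂ Y₂ P₂) :
    (∀ m, ‖I (Y₁ m - Y₂ m)‖ ≤ 2 * k * ∑ n, ‖ψ₁ n - ψ₂ n‖) ∧
      ∑ n : Fin N, (‖I (Y₁ n.succ - Y₂ n.succ) - I (Y₁ n.castSucc - Y₂ n.castSucc)‖ ^ 2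
        + μ * k * ‖D (Y₁ n.succ - Y₂ n.succ)‖ ^ 2) ≤ (2 * k * ∑ n, ‖ψ₁ n - ψ₂ n‖) ^ 2 := by
  refine energy_of_step_le hk (x := fun m => ‖I (Y₁ m - Y₂ m)‖)
    (Φ := fun m => ‖I (Y₁ m - Y₂ m)‖ ^ 2 + μ * k / 4 * ‖D (Y₁ m - Y₂ m)‖ ^ 2)
    (fun _ => norm_nonneg _) (fun _ => norm_nonneg _) (fun _ => by positivity)
    (fun _ => le_add_of_nonneg_right (by positivity)) (by simp [h₁.1, h₂.1]) fun n => ?_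
  have e := (S.st n).solves_energy hk hη hημ (h₁.2.2 n).1 (h₂.2.2 n).1
  rw [stateRhs_sub] at e
  have b := mul_le_mul_of_nonneg_left
    (real_inner_le_norm (ψ₁ n - ψ₂ n) (I (Y₁ n.succ - Y₂ n.succ))) hk
  linarith

/-- The discrete energy estimate applied in reversed time, with the state differences as forcing. -/
theorem costate_stability (hμ : 0 ≤ μ) (hk : 0 ≤ k) (hη : 0 ≤ η) (hημ : 8 * η ≤ μ)
    (h₁ : S.IsSolution y₀ p₀ ψ₁ Y₁ P₁) (h₂ : S.IsSolution y₀ p₀ ψ₂ Y₂ P₂) :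
    (∀ m, ‖I (P₁ m - P₂ m)‖ ≤ 2 * k * ∑ n : Fin N, S.κ * ‖I (Y₁ n.succ - Y₂ n.succ)‖) ∧
      ∑ n : Fin N, (‖I (P₁ n.castSucc - P₂ n.castSucc) - I (P₁ n.succ - P₂ n.succ)‖ ^ 2
        + μ * k * ‖D (P₁ n.castSucc - P₂ n.castSucc)‖ ^ 2) ≤
        (2 * k * ∑ n : Fin N, S.κ * ‖I (Y₁ n.succ - Y₂ n.succ)‖) ^ 2 := by
  have hκ := S.κ_nonneg
  have key := energy_of_step_le hk (x := fun m : Fin (N + 1) => ‖I (P₁ m.rev - P₂ m.rev)‖)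
    (Φ := fun m => ‖I (P₁ m.rev - P₂ m.rev)‖ ^ 2 + μ * k / 4 * ‖D (P₁ m.rev - P₂ m.rev)‖ ^ 2)
    (g := fun n => ‖I (P₁ n.rev.castSucc - P₂ n.rev.castSucc)
      - I (P₁ n.rev.succ - P₂ n.rev.succ)‖ ^ 2
        + μ * k * ‖D (P₁ n.rev.castSucc - P₂ n.rev.castSucc)‖ ^ 2)
    (r := fun n => S.κ * ‖I (Y₁ n.rev.succ - Y₂ n.rev.succ)‖)
    (fun _ => norm_nonneg _) (fun _ => by positivity) (fun _ => by positivity)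
    (fun _ => le_add_of_nonneg_right (by positivity)) (by simp [h₁.2.1, h₂.2.1]) fun n => by
      have e := (S.cs n.rev).solves_energy hk hη hημ (h₁.2.2 n.rev).2 (h₂.2.2 n.rev).2
      rw [costateRhs_sub] at e
      have b := mul_le_mul_of_nonneg_left (abs_le.1 (S.lump_le (Y₁ n.rev.succ - Y₂ n.rev.succ)
        (P₁ n.rev.castSucc - P₂ n.rev.castSucc))).2 hk
      simp only [Fin.rev_succ, Fin.rev_castSucc]
      linarith
  rw [show ∑ n : Fin N, S.κ * ‖I (Y₁ n.rev.succ - Y₂ n.rev.succ)‖ =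
    ∑ n : Fin N, S.κ * ‖I (Y₁ n.succ - Y₂ n.succ)‖ from
    Equiv.sum_comp Fin.revPerm fun n : Fin N => S.κ * ‖I (Y₁ n.succ - Y₂ n.succ)‖] at key
  refine ⟨fun m => by simpa using key.1 m.rev, le_of_eq_of_le ?_ key.2⟩
  exact (Equiv.sum_comp Fin.revPerm (fun n : Fin N =>
    (‖I (P₁ n.castSucc - P₂ n.castSucc) - I (P₁ n.succ - P₂ n.succ)‖ ^ 2
        + μ * k * ‖D (P₁ n.castSucc - P₂ n.castSucc)‖ ^ 2))).symm

theorem costate_bound_le (hμ : 0 ≤ μ) (hk : 0 ≤ k) (hη : 0 ≤ η) (hημ : 8 * η ≤ μ)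
    (h₁ : S.IsSolution y₀ p₀ ψ₁ Y₁ P₁) (h₂ : S.IsSolution y₀ p₀ ψ₂ Y₂ P₂) :
    2 * k * ∑ n : Fin N, S.κ * ‖I (Y₁ n.succ - Y₂ n.succ)‖
      ≤ 2 * S.κ * (k * N) * (2 * k * ∑ n, ‖ψ₁ n - ψ₂ n‖) := by
  have hκ := S.κ_nonneg
  calc _ ≤ 2 * k * ∑ n : Fin N, S.κ * (2 * k * ∑ n, ‖ψ₁ n - ψ₂ n‖) := by
        gcongr with n
        exact (S.state_stability hμ hk hη hημ h₁ h₂).1 _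
    _ = _ := by
      rw [Finset.sum_const, Finset.card_univ, Fintype.card_fin, nsmul_eq_mul]; ring

/-- Stability of the whole scheme with respect to the controls. -/
theorem norm_costate_sub_le_sum (hμ : 0 ≤ μ) (hk : 0 ≤ k) (hη : 0 ≤ η) (hημ : 8 * η ≤ μ)
    (h₁ : S.IsSolution y₀ p₀ ψ₁ Y₁ P₁) (h₂ : S.IsSolution y₀ p₀ ψ₂ Y₂ P₂) (m : Fin (N + 1)) :
    ‖I (P₁ m - P₂ m)‖ ≤ 4 * S.κ * (k * N) * k * ∑ n, ‖ψ₁ n - ψ₂ n‖ := by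
  refine ((S.costate_stability hμ hk hη hημ h₁ h₂).1 m).trans
    ((S.costate_bound_le hμ hk hη hημ h₁ h₂).trans_eq ?_)
  ring

/-- Test the state difference with f at the lower level, the co-state difference with e at the upper
level, and subtract. The diffusion cancels by symmetry and the mass terms telescope. The two
convection terms belong to different time levels and cannot be compared with each other. Instead,
moving the second argument of each to the level of its own form gives, by skewness, the telescoping
terms k · cv m (e m) (f m) and errors with one time increment. The lumped term is nonnegative and is
dropped. -/
theorem pairing_step (hkη : 0 ≤ k * η) (hk : 0 ≤ k)
    (h₁ : S.IsSolution y₀ p₀ ψ₁ Y₁ P₁) (h₂ : S.IsSolution y₀ p₀ ψ₂ Y₂ P₂) (n : Fin N)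
    {e f : Fin (N + 1) → V} (he : e = Y₁ - Y₂) (hf : f = P₁ - P₂) :
    (inner ℝ (I (e n.succ)) (I (f n.succ)) + k * S.cv n.succ (e n.succ) (f n.succ))
      - (inner ℝ (I (e n.castSucc)) (I (f n.castSucc))
        + k * S.cv n.castSucc (e n.castSucc) (f n.castSucc))
      - (k * (S.β * ‖D (e n.succ)‖ * ‖I (f n.castSucc) - I (f n.succ)‖)
        + k * (S.β * ‖D (f n.castSucc)‖ * ‖I (e n.succ) - I (e n.castSucc)‖)
        + 3 * (k * η) * (‖D (e n.succ)‖ + ‖D (e n.castSucc)‖) * ‖D (f n.castSucc)‖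
        + 3 * (k * η) * (‖D (f n.castSucc)‖ + ‖D (f n.succ)‖) * ‖D (e n.succ)‖)
      ≤ k * inner ℝ (ψ₁ n - ψ₂ n) (I (f n.castSucc)) := by
  have t₁ := (S.st n).solves_sub_test hkη (h₁.2.2 n).1 (h₂.2.2 n).1 (f n.castSucc)
  have t₂ := (S.cs n).solves_sub_test hkη (h₁.2.2 n).2 (h₂.2.2 n).2 (e n.succ)
  have he' : ∀ m, Y₁ m - Y₂ m = e m := fun m => by rw [he]; rfl
  have hf' : ∀ m, P₁ m - P₂ m = f m := fun m => by rw [hf]; rfl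
  rw [stateRhs_sub, S.st_c] at t₁
  rw [costateRhs_sub, S.cs_c] at t₂
  simp only [he', hf'] at t₁ t₂
  -- Here the second arguments are shifted by one time level: f to the upper level in the state
  -- convection, e to the lower level in the co-state convection.
  have c₁ := mul_le_mul_of_nonneg_left
    (abs_le.1 (S.cv_le n.succ (e n.succ) (f n.castSucc - f n.succ))).1 hk
  have c₂ := mul_le_mul_of_nonneg_left
    (abs_le.1 (S.cv_le n.castSucc (f n.castSucc) (e n.succ - e n.castSucc))).1 hk
  have c₃ := mul_nonneg hk (S.lump_nonneg (e n.succ))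
  have s₁ := S.cv_swap n.castSucc (f n.castSucc) (e n.castSucc)
  have s₂ := real_inner_comm (I (e n.succ)) (I (f n.castSucc))
  have s₃ := real_inner_comm (I (e n.succ)) (I (f n.succ))
  have s₄ := real_inner_comm (D (e n.succ)) (D (f n.castSucc))
  have d₁ := (abs_le.1 t₁).2
  have d₂ := (abs_le.1 t₂).1
  simp only [map_sub, inner_sub_left, LinearMap.neg_apply, LinearMap.smul_apply,
    smul_eq_mul] at *
  rw [s₁] at c₂
  rw [s₂, s₃, s₄] at d₂
  linarith

/-- The Young weight √k is balanced so that k a² and p² appear with the same small coefficient; both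
occur in the energy bounds, the first after multiplication by μ. The gradient-gradient products are
small through η alone. -/
theorem pairing_error_le (hμ : 0 < μ) (hk : 0 ≤ k) (hη : 0 ≤ η) {β a a₀ b b₁ p q : ℝ}
    (hβ : 0 ≤ β) :
    k * (β * a * p) + k * (β * b * q) + 3 * (k * η) * (a + a₀) * b + 3 * (k * η) * (b + b₁) * a
      ≤ √k * β / 2 * (1 + 1 / μ) * ((q ^ 2 + μ * k * a ^ 2) + (p ^ 2 + μ * k * b ^ 2))
        + 3 * η / μ * (3 / 2 * (μ * k * a ^ 2) + 1 / 2 * (μ * k * a₀ ^ 2)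
          + (3 / 2 * (μ * k * b ^ 2) + 1 / 2 * (μ * k * b₁ ^ 2))) := by
  set s := √k
  have hs : s ^ 2 = k := Real.sq_sqrt hk
  have hs0 : 0 ≤ s := Real.sqrt_nonneg k
  rw [← hs]
  have i₁ : s ^ 2 * (β * a * p) ≤ s * β / 2 * (s ^ 2 * a ^ 2 + p ^ 2) := by
    have := mul_nonneg (mul_nonneg hs0 hβ) (sq_nonneg (s * a - p))
    nlinarith
  have i₂ : s ^ 2 * (β * b * q) ≤ s * β / 2 * (s ^ 2 * b ^ 2 + q ^ 2) := by
    have := mul_nonneg (mul_nonneg hs0 hβ) (sq_nonneg (s * b - q))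
    nlinarith
  have i₃ : s ^ 2 * a ^ 2 + p ^ 2 + (s ^ 2 * b ^ 2 + q ^ 2) ≤
      (1 + 1 / μ) * ((q ^ 2 + μ * s ^ 2 * a ^ 2) + (p ^ 2 + μ * s ^ 2 * b ^ 2)) := by
    have : (1 + 1 / μ) * ((q ^ 2 + μ * s ^ 2 * a ^ 2) + (p ^ 2 + μ * s ^ 2 * b ^ 2)) =
      s ^ 2 * a ^ 2 + p ^ 2 + (s ^ 2 * b ^ 2 + q ^ 2)
        + (μ * s ^ 2 * a ^ 2 + μ * s ^ 2 * b ^ 2 + (p ^ 2 + q ^ 2) / μ) := by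
      field_simp; ring
    rw [this]
    exact le_add_of_nonneg_right (by positivity)
  have i₄ : 3 * (s ^ 2 * η) * (a + a₀) * b + 3 * (s ^ 2 * η) * (b + b₁) * a ≤
      3 * η / μ * (3 / 2 * (μ * s ^ 2 * a ^ 2) + 1 / 2 * (μ * s ^ 2 * a₀ ^ 2)
          + (3 / 2 * (μ * s ^ 2 * b ^ 2) + 1 / 2 * (μ * s ^ 2 * b₁ ^ 2))) := by
    have : 3 * η / μ * (3 / 2 * (μ * s ^ 2 * a ^ 2) + 1 / 2 * (μ * s ^ 2 * a₀ ^ 2)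
          + (3 / 2 * (μ * s ^ 2 * b ^ 2) + 1 / 2 * (μ * s ^ 2 * b₁ ^ 2))) =
        s ^ 2 * η * (3 * (3 / 2 * a ^ 2 + 1 / 2 * a₀ ^ 2 + (3 / 2 * b ^ 2 + 1 / 2 * b₁ ^ 2))) := by
      field_simp
    rw [this]
    have h : 3 * (a + a₀) * b + 3 * (b + b₁) * a ≤
      3 * (3 / 2 * a ^ 2 + 1 / 2 * a₀ ^ 2 + (3 / 2 * b ^ 2 + 1 / 2 * b₁ ^ 2)) := by
      nlinarith [sq_nonneg (a - b), sq_nonneg (a₀ - b), sq_nonneg (b₁ - a)]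
    have := mul_le_mul_of_nonneg_left h (mul_nonneg (sq_nonneg s) hη)
    linarith
  have i₅ := mul_le_mul_of_nonneg_left i₃ (show 0 ≤ s * β / 2 by positivity)
  linarith

/-- The constant in the lower bound for the monotonicity of the control-to-co-state map. -/
def defect : ℝ :=
  (√k * S.β / 2 * (1 + 1 / μ) + 6 * η / μ) * ((1 + (2 * S.κ * (k * N)) ^ 2) * (4 * (k * N)))

/-- The control-to-co-state map is monotone up to a defect that vanishes with the mesh size. -/
theorem neg_defect_le_sum (hμ : 0 < μ) (hk : 0 < k) (hη : 0 ≤ η) (hημ : 8 * η ≤ μ)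
    (hβ : 0 ≤ S.β)
    (h₁ : S.IsSolution y₀ p₀ ψ₁ Y₁ P₁) (h₂ : S.IsSolution y₀ p₀ ψ₂ Y₂ P₂) :
    -S.defect * ∑ n, ‖ψ₁ n - ψ₂ n‖ ^ 2 ≤
      ∑ n : Fin N, inner ℝ (ψ₁ n - ψ₂ n) (I (P₁ n.castSucc - P₂ n.castSucc)) := by
  set e := Y₁ - Y₂ with he
  set f := P₁ - P₂ with hf
  have he' : ∀ m, Y₁ m - Y₂ m = e m := fun m => by rw [he]; rfl
  have hf' : ∀ m, P₁ m - P₂ m = f m := fun m => by rw [hf]; rfl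
  have hκ := S.κ_nonneg
  -- The initial states and the final co-states agree, so both ends of the telescoping sum vanish.
  have he0 : e 0 = 0 := by rw [← he', h₁.1, h₂.1, sub_self]
  have hf0 : f (Fin.last N) = 0 := by rw [← hf', h₁.2.1, h₂.2.1, sub_self]
  have hs := (S.state_stability hμ.le hk.le hη hημ h₁ h₂).2
  have hc := (S.costate_stability hμ.le hk.le hη hημ h₁ h₂).2
  have hW := S.costate_bound_le hμ.le hk.le hη hημ h₁ h₂
  simp only [he', hf'] at hs hc hW ⊢
  set W := 2 * k * ∑ n, ‖ψ₁ n - ψ₂ n‖ with hWdef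
  set W' := 2 * k * ∑ n : Fin N, S.κ * ‖I (e n.succ)‖ with hW'def
  have hW'0 : 0 ≤ W' := by positivity
  -- Cauchy–Schwarz in time. The separate factor k is kept so that it can be cancelled at the end.
  have hW2 : W ^ 2 ≤ 4 * (k * N) * (k * ∑ n, ‖ψ₁ n - ψ₂ n‖ ^ 2) := by
    have := sq_sum_le_card_mul_sum_sq (s := Finset.univ) (f := fun n : Fin N => ‖ψ₁ n - ψ₂ n‖)
    rw [Finset.card_univ, Fintype.card_fin] at this
    rw [hWdef, mul_pow]
    calc _ ≤ (2 * k) ^ 2 * (N * ∑ n, ‖ψ₁ n - ψ₂ n‖ ^ 2) := by gcongr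
      _ = _ := by ring
  have hW'2 : W' ^ 2 ≤ (2 * S.κ * (k * N)) ^ 2 * W ^ 2 := by
    rw [← mul_pow]; gcongr
  -- summation of the tested equations
  have hpair := Finset.sum_le_sum fun n (_ : n ∈ Finset.univ) =>
    S.pairing_step (by positivity) hk.le h₁ h₂ n he hf
  rw [Finset.sum_sub_distrib, fin_sum_telescope (fun m => inner ℝ (I (e m)) (I (f m))
    + k * S.cv m (e m) (f m)), he0, hf0, ← Finset.mul_sum] at hpair
  simp only [map_zero, inner_zero_left, inner_zero_right, mul_zero, add_zero, sub_self, zero_sub,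
    LinearMap.zero_apply] at hpair
  have herr := Finset.sum_le_sum fun n (_ : n ∈ (Finset.univ : Finset (Fin N))) =>
    pairing_error_le hμ hk.le hη (a := ‖D (e n.succ)‖) (b := ‖D (f n.castSucc)‖)
      (a₀ := ‖D (e n.castSucc)‖) (b₁ := ‖D (f n.succ)‖)
      (p := ‖I (f n.castSucc) - I (f n.succ)‖) (q := ‖I (e n.succ) - I (e n.castSucc)‖) hβ
  rw [Finset.sum_add_distrib (g := fun n : Fin N => 3 * η / μ * _), ← Finset.mul_sum,
    ← Finset.mul_sum] at herr
  have herr' : ∑ n : Fin N, (3 / 2 * (μ * k * ‖D (e n.succ)‖ ^ 2)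
        + 1 / 2 * (μ * k * ‖D (e n.castSucc)‖ ^ 2) + (3 / 2 * (μ * k * ‖D (f n.castSucc)‖ ^ 2)
        + 1 / 2 * (μ * k * ‖D (f n.succ)‖ ^ 2))) =
      3 / 2 * ∑ n : Fin N, μ * k * ‖D (e n.succ)‖ ^ 2
      + 1 / 2 * ∑ n : Fin N, μ * k * ‖D (e n.castSucc)‖ ^ 2
      + (3 / 2 * ∑ n : Fin N, μ * k * ‖D (f n.castSucc)‖ ^ 2
      + 1 / 2 * ∑ n : Fin N, μ * k * ‖D (f n.succ)‖ ^ 2) := by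
    simp only [Finset.sum_add_distrib, Finset.mul_sum]
  rw [herr'] at herr
  -- A sum over old levels is at most the sum over new levels, since the zero end is added and a
  -- nonnegative one removed. The weights 3/2 and 1/2 thus combine to 2, which produces the 6η/μ in
  -- `defect`.
  have sh₁ : ∑ n : Fin N, μ * k * ‖D (e n.castSucc)‖ ^ 2 ≤
      ∑ n : Fin N, μ * k * ‖D (e n.succ)‖ ^ 2 := by
    have := fin_sum_telescope fun m => μ * k * ‖D (e m)‖ ^ 2
    rw [Finset.sum_sub_distrib, he0] at this
    have h0 : 0 ≤ μ * k * ‖D (e (Fin.last N))‖ ^ 2 := by positivity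
    simp only [map_zero, norm_zero] at this
    linarith
  have sh₂ : ∑ n : Fin N, μ * k * ‖D (f n.succ)‖ ^ 2 ≤
      ∑ n : Fin N, μ * k * ‖D (f n.castSucc)‖ ^ 2 := by
    have := fin_sum_telescope fun m => μ * k * ‖D (f m)‖ ^ 2
    rw [Finset.sum_sub_distrib, hf0] at this
    have h0 : 0 ≤ μ * k * ‖D (f 0)‖ ^ 2 := by positivity
    simp only [map_zero, norm_zero] at this
    linarith
  have sh₃ : ∑ n : Fin N, μ * k * ‖D (e n.succ)‖ ^ 2 ≤ W ^ 2 :=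
    (Finset.sum_le_sum fun n _ => le_add_of_nonneg_left (sq_nonneg _)).trans hs
  have sh₄ : ∑ n : Fin N, μ * k * ‖D (f n.castSucc)‖ ^ 2 ≤ W' ^ 2 :=
    (Finset.sum_le_sum fun n _ => le_add_of_nonneg_left (sq_nonneg _)).trans hc
  have g₁ := mul_le_mul_of_nonneg_left (add_le_add hs hc)
    (show 0 ≤ √k * S.β / 2 * (1 + 1 / μ) by positivity)
  have g₂ : 3 * η / μ * (3 / 2 * ∑ n : Fin N, μ * k * ‖D (e n.succ)‖ ^ 2
      + 1 / 2 * ∑ n : Fin N, μ * k * ‖D (e n.castSucc)‖ ^ 2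
      + (3 / 2 * ∑ n : Fin N, μ * k * ‖D (f n.castSucc)‖ ^ 2
      + 1 / 2 * ∑ n : Fin N, μ * k * ‖D (f n.succ)‖ ^ 2)) ≤ 3 * η / μ * (2 * (W ^ 2 + W' ^ 2)) := by
    gcongr; linarith
  have g₃ : W ^ 2 + W' ^ 2 ≤ (1 + (2 * S.κ * (k * N)) ^ 2)
      * (4 * (k * N) * (k * ∑ n, ‖ψ₁ n - ψ₂ n‖ ^ 2)) := by
    have := mul_le_mul_of_nonneg_left hW2 (show 0 ≤ 1 + (2 * S.κ * (k * N)) ^ 2 by positivity)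
    linarith
  have g₄ := mul_le_mul_of_nonneg_left g₃
    (show 0 ≤ √k * S.β / 2 * (1 + 1 / μ) + 6 * η / μ by positivity)
  have fin : k * (-S.defect * ∑ n, ‖ψ₁ n - ψ₂ n‖ ^ 2) ≤
      k * ∑ n : Fin N, inner ℝ (ψ₁ n - ψ₂ n) (I (f n.castSucc)) := by
    rw [defect]
    have : 3 * η / μ * (2 * (W ^ 2 + W' ^ 2)) = 6 * η / μ * (W ^ 2 + W' ^ 2) := by ring
    rw [← Finset.sum_add_distrib] at g₁
    linarith
  exact le_of_mul_le_mul_left fin hk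

end Stability

/-- The optimality system with a variational inequality for the controls has a unique solution. -/
theorem existsUnique_optimal [CompleteSpace H₁] [FiniteDimensional ℝ V]
    (hI : Function.Injective I) (hμ : 0 < μ)
    (hk : 0 < k) (hη : 0 ≤ η) (hημ : 8 * η ≤ μ) {θ : ℝ} (hθ : θ < 1)
    (hinv : ∀ v, k * η ^ 2 * ‖D v‖ ^ 2 ≤ 4 * μ * θ * ‖I v‖ ^ 2) (hβ : 0 ≤ S.β) {lam : ℝ}
    (hlam : 0 < lam) (hdef : S.defect ≤ lam / 2) (y₀ p₀ : V) {K : Set H₁} (hne : K.Nonempty)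
    (hcl : IsClosed K) (hK : Convex ℝ K) :
    ∃! s : (Fin (N + 1) → V) × (Fin (N + 1) → V) × (Fin N → H₁),
      S.IsSolution y₀ p₀ s.2.2 s.1 s.2.1 ∧ ∀ n : Fin N, s.2.2 n ∈ K ∧
        ∀ v ∈ K, 0 ≤ inner ℝ (lam • s.2.2 n + I (s.2.1 n.castSucc)) (v - s.2.2 n) := by
  -- Eliminating states and co-states leaves the controls as the only unknowns. On the ℓ² product
  -- they satisfy a variational inequality for A ψ = lam ψ + I P(ψ), strongly monotone with constant
  -- lam - defect ≥ lam/2.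
  choose sol hsol hsol' using fun ψ => S.existsUnique_solution hI hμ hk.le hθ hinv y₀ p₀ ψ
  set A : (PiLp 2 fun _ : Fin N => H₁) → PiLp 2 fun _ : Fin N => H₁ := fun ψ => WithLp.toLp 2 fun n =>
    lam • ψ n + I ((sol (WithLp.ofLp ψ)).2 n.castSucc) with hA
  set KE : Set (PiLp 2 fun _ : Fin N => H₁) := {ψ | ∀ n, ψ n ∈ K} with hKE
  have hAsub : ∀ (x y : PiLp 2 fun _ : Fin N => H₁) n, (A x - A y) n = lam • (x n - y n) + I ((sol (WithLp.ofLp x)).2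
      n.castSucc - (sol (WithLp.ofLp y)).2 n.castSucc) := fun x y n => by
    simp only [hA, PiLp.sub_apply, map_sub, smul_sub]; abel
  have hmono : ∀ x y : PiLp 2 fun _ : Fin N => H₁, lam / 2 * ‖x - y‖ ^ 2 ≤ inner ℝ (A x - A y) (x - y) := fun x y => by
    have h := S.neg_defect_le_sum hμ hk hη hημ hβ (hsol (WithLp.ofLp x)) (hsol (WithLp.ofLp y))
    rw [PiLp.inner_apply, PiLp.norm_sq_eq_of_L2]
    have h1 : ∀ n, inner ℝ ((A x - A y) n) ((x - y) n) = lam * ‖(x - y) n‖ ^ 2 +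
        inner ℝ (x n - y n) (I ((sol (WithLp.ofLp x)).2 n.castSucc -
          (sol (WithLp.ofLp y)).2 n.castSucc)) := fun n => by
      have hxy : (x - y) n = x n - y n := rfl
      rw [hAsub, hxy, inner_add_left, inner_smul_left, real_inner_self_eq_norm_sq,
        real_inner_comm (x n - y n) (I _), conj_trivial]
    have h0 : 0 ≤ ∑ n, ‖(x - y) n‖ ^ 2 := by positivity
    have h2 := mul_le_mul_of_nonneg_right hdef h0
    simp only [h1, Finset.sum_add_distrib, ← Finset.mul_sum]
    simp only [PiLp.sub_apply] at *
    linarith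
  -- The size of this constant is immaterial; the variational inequality needs only some Lipschitz
  -- bound.
  have hLip : ∀ x y : PiLp 2 fun _ : Fin N => H₁, ‖A x - A y‖ ≤
      (lam + √N * (4 * S.κ * (k * N) * k * √N)) * ‖x - y‖ := fun x y => by
    set w : PiLp 2 fun _ : Fin N => H₁ := WithLp.toLp 2 fun n => I ((sol (WithLp.ofLp x)).2
      n.castSucc - (sol (WithLp.ofLp y)).2 n.castSucc) with hw
    have h1 : A x - A y = lam • (x - y) + w := by
      ext n; rw [hAsub]; rfl
    have hκ := S.κ_nonneg
    have hsum : ∑ n, ‖x n - y n‖ ≤ √N * ‖x - y‖ := by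
      refine abs_le_of_sq_le_sq' ?_ (by positivity) |>.2
      have := sq_sum_le_card_mul_sum_sq (s := Finset.univ) (f := fun n : Fin N => ‖x n - y n‖)
      rw [mul_pow, Real.sq_sqrt (by positivity), PiLp.norm_sq_eq_of_L2]
      simpa using this
    have h2 : ‖w‖ ≤ √N * (4 * S.κ * (k * N) * k * √N) * ‖x - y‖ := by
      refine abs_le_of_sq_le_sq' ?_ (by positivity) |>.2
      rw [PiLp.norm_sq_eq_of_L2]
      have h3 : ∀ n : Fin N, ‖w n‖ ^ 2 ≤ (4 * S.κ * (k * N) * k * (√N * ‖x - y‖)) ^ 2 := fun n => by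
        refine pow_le_pow_left₀ (norm_nonneg _) ?_ 2
        refine (S.norm_costate_sub_le_sum hμ.le hk.le hη hημ (hsol (WithLp.ofLp x))
          (hsol (WithLp.ofLp y)) n.castSucc).trans ?_
        gcongr
      refine (Finset.sum_le_sum fun n _ => h3 n).trans_eq ?_
      rw [Finset.sum_const, Finset.card_univ, Fintype.card_fin, nsmul_eq_mul]
      have : (N : ℝ) = √N ^ 2 := (Real.sq_sqrt (by positivity)).symm
      generalize √(N : ℝ) = t at *
      rw [this]; ring
    rw [h1]
    refine (norm_add_le _ _).trans ?_
    rw [norm_smul, Real.norm_of_nonneg hlam.le]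
    linarith
  -- A variational inequality on a product set splits into its components: vary one component and
  -- keep the others.
  have hloc : ∀ ψ : PiLp 2 fun _ : Fin N => H₁, ψ ∈ KE → ((∀ v ∈ KE, 0 ≤ inner ℝ (A ψ) (v - ψ)) ↔
      ∀ n, ∀ v ∈ K, 0 ≤ inner ℝ (A ψ n) (v - ψ n)) := fun ψ hψ => by
    constructor
    · intro h n v hv
      have := h (WithLp.toLp 2 (Function.update (WithLp.ofLp ψ) n v)) fun m => by
        by_cases hm : m = n
        · subst hm; simpa using hv
        · simpa [hm] using hψ m
      rw [PiLp.inner_apply, Finset.sum_eq_single n] at this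
      · simpa using this
      · intro m _ hm; simp [hm]
      · simp
    · intro h v hv
      rw [PiLp.inner_apply]
      exact Finset.sum_nonneg fun n _ => h n (v n) (hv n)
  have hKEcl : IsClosed KE := by
    rw [hKE, Set.ofPred_forall]
    exact isClosed_iInter fun n => hcl.preimage (by fun_prop)
  have hKEcv : Convex ℝ KE := fun x hx y hy a b ha hb hab n => hK (hx n) (hy n) ha hb hab
  obtain ⟨v₀, hv₀⟩ := hne
  obtain ⟨U, ⟨hUK, hU⟩, hUu⟩ := existsUnique_variationalInequality
    (K := KE) ⟨WithLp.toLp 2 fun _ => v₀, fun _ => hv₀⟩ hKEcl hKEcv (half_pos hlam) hmono hLip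
  refine ⟨((sol (WithLp.ofLp U)).1, (sol (WithLp.ofLp U)).2, WithLp.ofLp U), ⟨hsol _, fun n =>
    ⟨hUK n, (hloc U hUK).1 hU n⟩⟩, ?_⟩
  rintro ⟨Y, P, u⟩ ⟨h1, h2⟩
  have hYP : (Y, P) = sol u := hsol' u (Y, P) h1
  have hu : WithLp.toLp 2 u = U := hUu (WithLp.toLp 2 u)
    ⟨fun n => (h2 n).1, (hloc _ fun n => (h2 n).1).2 fun n v hv => by
      have := (h2 n).2 v hv
      simp only [hA, ← hYP]
      exact this⟩
  rw [← hu]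
  simp [← hYP]

end SchemeForms

end AbstractScheme

end

end AFC

namespace AFC

noncomputable section

/-! ### Lipschitz continuity of limited fluxes -/

/-- For P > 0 the limited flux is (p/P) · min P Q, a ratio in [0, 1] times a 1-Lipschitz function of
(P, Q) in the ℓ¹ norm. The change of the ratio is harmless because it is multiplied by at most P.
Thus the discontinuity of Q/P at P = 0 disappears. -/
theorem mul_min_div_sub_le {p P Q p' P' Q' : ℝ} (hp : 0 ≤ p) (hpP : p ≤ P) (hQ : 0 ≤ Q)
    (hp' : 0 ≤ p') (hpP' : p' ≤ P') (hQ' : 0 ≤ Q') :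
    p * min 1 (Q / P) - p' * min 1 (Q' / P') ≤ |p - p'| + 2 * |P - P'| + |Q - Q'| := by
  have hP : 0 ≤ P := hp.trans hpP
  have hP' : 0 ≤ P' := hp'.trans hpP'
  have hm : 0 ≤ min 1 (Q / P) := le_min zero_le_one (by positivity)
  have hm' : 0 ≤ min 1 (Q' / P') := le_min zero_le_one (by positivity)
  have a₁ := abs_nonneg (P - P')
  have a₂ := abs_nonneg (Q - Q')
  have a₃ := le_abs_self (p - p')
  have a₄ := le_abs_self (P - P')
  have a₅ := le_abs_self (Q - Q')
  -- For P' = 0 the quotient has its default value 0, but p' = 0 as well, so the product is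
  -- insensitive to this convention.
  rcases hP'.eq_or_lt with h0 | h0
  · obtain rfl : p' = 0 := le_antisymm (hpP'.trans h0.ge) hp'
    have : p * min 1 (Q / P) ≤ p * 1 := mul_le_mul_of_nonneg_left (min_le_left _ _) hp
    rw [zero_mul]
    linarith
  rcases hP.eq_or_lt with h1 | h1
  · obtain rfl : p = 0 := le_antisymm (hpP.trans h1.ge) hp
    have := mul_nonneg hp' hm'
    have := abs_nonneg ((0 : ℝ) - p')
    rw [zero_mul]
    linarith
  have e : ∀ {x X Y : ℝ}, 0 < X → x * min 1 (Y / X) = x / X * min X Y := fun hX => by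
    rw [min_def, min_def]
    simp only [one_le_div hX]
    split_ifs <;> field_simp
  rw [e h1, e h0]
  have hr : p / P ≤ 1 := (div_le_one h1).2 hpP
  have hr' : p' / P' ≤ 1 := (div_le_one h0).2 hpP'
  have hr0' : 0 ≤ p' / P' := by positivity
  have b₁ : min P Q - min P' Q' ≤ |P - P'| + |Q - Q'| := by
    rcases le_total P' Q' with h | h
    · rw [min_eq_left h]; have := min_le_left P Q; linarith
    · rw [min_eq_right h]; have := min_le_right P Q; linarith
  have b₂ : p' / P' * (min P Q - min P' Q') ≤ |P - P'| + |Q - Q'| := by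
    have := mul_le_mul_of_nonneg_left b₁ hr0'
    have := mul_le_mul_of_nonneg_right hr' (add_nonneg a₁ a₂)
    linarith
  have b₃ : (p / P - p' / P') * min P Q ≤ |p - p'| + |P - P'| := by
    have h2 : (p / P - p' / P') * P ≤ |p - p'| + |P - P'| := by
      have h3 : (p / P - p' / P') * P = (p - p') + p' / P' * (P' - P) := by field_simp; ring
      have h4 : p' / P' * (P' - P) ≤ 1 * |P - P'| := by
        rw [abs_sub_comm]
        exact (mul_le_mul_of_nonneg_left (le_abs_self _) hr0').trans
          (mul_le_mul_of_nonneg_right hr' (abs_nonneg _))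
      linarith
    rcases le_total 0 (p / P - p' / P') with h | h
    · exact (mul_le_mul_of_nonneg_left (min_le_left P Q) h).trans h2
    · have := mul_nonpos_of_nonpos_of_nonneg h (le_min hP hQ)
      have := abs_nonneg (p - p')
      linarith
  linarith

theorem abs_mul_min_div_sub_le {p P Q p' P' Q' : ℝ} (hp : 0 ≤ p) (hpP : p ≤ P) (hQ : 0 ≤ Q)
    (hp' : 0 ≤ p') (hpP' : p' ≤ P') (hQ' : 0 ≤ Q') :
    |p * min 1 (Q / P) - p' * min 1 (Q' / P')| ≤ |p - p'| + 2 * |P - P'| + |Q - Q'| := by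
  refine abs_sub_le_iff.2 ⟨mul_min_div_sub_le hp hpP hQ hp' hpP' hQ', ?_⟩
  rw [abs_sub_comm p, abs_sub_comm P, abs_sub_comm Q]
  exact mul_min_div_sub_le hp' hpP' hQ' hp hpP hQ

/-! ### Limited fluxes on the edges of a triangulation -/

namespace Triangulation

variable {Ω : Set Plane} (𝒯 : Triangulation Ω)

theorem mem_nodes {Z : Plane} : Z ∈ 𝒯.nodes ↔ ∃ K ∈ 𝒯.triangles, Z ∈ K := by
  simp [nodes]

theorem mem_adj {Z Z' : Plane} :
    Z' ∈ 𝒯.adj Z ↔ Z' ≠ Z ∧ ∃ K ∈ 𝒯.triangles, Z ∈ K ∧ Z' ∈ K := by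
  simp only [adj, Finset.mem_filter, mem_nodes]
  constructor
  · exact fun h => h.2
  · exact fun h => ⟨h.2.imp fun K hK => ⟨hK.1, hK.2.2⟩, h⟩

theorem mem_adj_comm {Z Z' : Plane} : Z' ∈ 𝒯.adj Z ↔ Z ∈ 𝒯.adj Z' := by
  simp only [mem_adj]
  constructor <;> exact fun h => ⟨h.1.symm, h.2.imp fun K hK => ⟨hK.1, hK.2.2, hK.2.1⟩⟩

theorem mem_nodes_of_mem_adj {Z Z' : Plane} (h : Z' ∈ 𝒯.adj Z) : Z' ∈ 𝒯.nodes := by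
  obtain ⟨K, hK, -, hZ⟩ := (𝒯.mem_adj.1 h).2
  exact 𝒯.mem_nodes.2 ⟨K, hK, hZ⟩

theorem sum_adj_comm (f : Plane → Plane → ℝ) :
    ∑ Z ∈ 𝒯.nodes, ∑ Z' ∈ 𝒯.adj Z, f Z Z' = ∑ Z ∈ 𝒯.nodes, ∑ Z' ∈ 𝒯.adj Z, f Z' Z :=
  Finset.sum_comm' fun _ _ => ⟨fun h => ⟨𝒯.mem_adj_comm.1 h.2, 𝒯.mem_nodes_of_mem_adj h.2⟩,
    fun h => ⟨𝒯.mem_nodes_of_mem_adj h.1, 𝒯.mem_adj_comm.1 h.1⟩⟩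

theorem locMin_neg (δ : Plane → ℝ) (Z : Plane) : 𝒯.locMax (fun x => -δ x) Z = -𝒯.locMin δ Z := by
  classical
  refine le_antisymm ?_ ?_
  · refine Finset.sup'_le _ _ fun x hx => ?_
    exact neg_le_neg (Finset.inf'_le _ hx)
  · obtain ⟨x, hx, hx'⟩ := Finset.exists_mem_eq_inf' (Finset.insert_nonempty Z (𝒯.adj Z)) δ
    rw [locMin, hx']
    exact Finset.le_sup' (fun x => -δ x) hx

theorem le_locMax (δ : Plane → ℝ) (Z : Plane) : δ Z ≤ 𝒯.locMax δ Z := by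
  classical exact Finset.le_sup' δ (Finset.mem_insert_self _ _)

/-- Compare at a maximizer of δ. Only edge differences of δ - δ' enter, never values, which is why
the gradient can control the bounds of the limiter. -/
theorem locMax_sub_le (δ δ' : Plane → ℝ) (Z : Plane) :
    𝒯.locMax δ Z - δ Z - (𝒯.locMax δ' Z - δ' Z) ≤
      ∑ Z' ∈ 𝒯.adj Z, |(δ Z - δ' Z) - (δ Z' - δ' Z')| := by
  classical
  obtain ⟨x, hx, hx'⟩ := Finset.exists_mem_eq_sup' (Finset.insert_nonempty Z (𝒯.adj Z)) δ
  have h1 : 𝒯.locMax δ Z = δ x := hx'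
  have h2 : δ' x ≤ 𝒯.locMax δ' Z := Finset.le_sup' δ' hx
  rcases Finset.mem_insert.1 hx with rfl | hx
  · have : 0 ≤ ∑ Z' ∈ 𝒯.adj x, |(δ x - δ' x) - (δ Z' - δ' Z')| := by positivity
    linarith
  · have := Finset.single_le_sum (f := fun Z' => |(δ Z - δ' Z) - (δ Z' - δ' Z')|)
      (fun _ _ => abs_nonneg _) hx
    have := neg_abs_le ((δ Z - δ' Z) - (δ x - δ' x))
    linarith

theorem abs_locMax_sub_le (δ δ' : Plane → ℝ) (Z : Plane) :
    |𝒯.locMax δ Z - δ Z - (𝒯.locMax δ' Z - δ' Z)| ≤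
      ∑ Z' ∈ 𝒯.adj Z, |(δ Z - δ' Z) - (δ Z' - δ' Z')| := by
  refine abs_sub_le_iff.2 ⟨𝒯.locMax_sub_le δ δ' Z, (𝒯.locMax_sub_le δ' δ Z).trans_eq ?_⟩
  refine Finset.sum_congr rfl fun Z' _ => ?_
  rw [← abs_neg]; congr 1; ring

/-- The positive part of a flux limited at its first node. -/
def limPos (flux : Plane → Plane → ℝ) (q δ : Plane → ℝ) (Z Z' : Plane) : ℝ := by
  classical exact max 0 (flux Z Z') * if Z ∈ Ω then 𝒯.ratioPos flux q δ Z else 1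

/-- Changing the signs of flux and nodal values exchanges the two one-sided ratios, so one of them
suffices. -/
theorem ratioNeg_eq (flux : Plane → Plane → ℝ) (q δ : Plane → ℝ) (Z : Plane) :
    𝒯.ratioNeg flux q δ Z = 𝒯.ratioPos (fun a b => -flux a b) q (fun x => -δ x) Z := by
  rw [ratioNeg, ratioPos, locMin_neg]
  congr 1
  rw [← neg_div_neg_eq, ← Finset.sum_neg_distrib]
  congr 1
  · ring
  · refine Finset.sum_congr rfl fun Z' _ => ?_
    rw [← max_neg_neg, neg_zero]

/-- The factors jump where the flux changes sign, but the limited flux does not. By antisymmetry, a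
positive flux at one end of the edge is a negative one at the other, so for either sign one of the
two minima is zero and the other is the modulus of the limited flux. -/
theorem factor_mul_flux (flux : Plane → Plane → ℝ) (hflux : ∀ Z Z', flux Z' Z = -flux Z Z')
    (q δ : Plane → ℝ) (Z Z' : Plane) :
    𝒯.factor flux q δ Z Z' * flux Z Z' =
      min (𝒯.limPos flux q δ Z Z') (𝒯.limPos (fun a b => -flux a b) q (fun x => -δ x) Z' Z)
      - min (𝒯.limPos (fun a b => -flux a b) q (fun x => -δ x) Z Z')
          (𝒯.limPos flux q δ Z' Z) := by
  simp only [factor, limPos, preFactor, ← ratioNeg_eq, hflux Z Z', neg_neg]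
  rcases lt_trichotomy (flux Z Z') 0 with h | h | h
  · rw [max_eq_left h.le, max_eq_right (neg_pos.2 h).le, if_neg h.not_gt, if_pos h,
      if_pos (neg_pos.2 h), zero_mul, zero_mul, min_self, zero_sub,
      ← mul_min_of_nonneg _ _ (neg_pos.2 h).le]
    ring
  · simp [h]
  · rw [max_eq_right h.le, max_eq_left (neg_neg_of_pos h).le, if_pos h,
      if_neg (neg_neg_of_pos h).not_gt, if_pos (neg_neg_of_pos h), zero_mul, zero_mul, min_self,
      sub_zero, ← mul_min_of_nonneg _ _ h.le]
    ring

/-- The 3 is 1 for the flux itself plus 2 for the sum P in `abs_mul_min_div_sub_le`. At boundary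
nodes the factor is 1, hence no assumption on q is needed there. -/
theorem abs_limPos_sub_le {p p' : Plane → Plane → ℝ} {q δ δ' : Plane → ℝ} {Z Z' : Plane}
    (hq : Z ∈ Ω → 0 ≤ q Z) {Q : ℝ} (hQ0 : 0 ≤ Q) (hQ : Z ∈ Ω → q Z ≤ Q) (hZ' : Z' ∈ 𝒯.adj Z) :
    |𝒯.limPos p q δ Z Z' - 𝒯.limPos p' q δ' Z Z'| ≤
      3 * ∑ Y ∈ 𝒯.adj Z, |p Z Y - p' Z Y|
        + Q * ∑ Y ∈ 𝒯.adj Z, |(δ Z - δ' Z) - (δ Y - δ' Y)| := by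
  have h1 : ∀ Y, |max 0 (p Z Y) - max 0 (p' Z Y)| ≤ |p Z Y - p' Z Y| := fun Y => by
    simpa using abs_max_sub_max_le_max 0 (p Z Y) 0 (p' Z Y)
  have h2 : |max 0 (p Z Z') - max 0 (p' Z Z')| ≤ ∑ Y ∈ 𝒯.adj Z, |p Z Y - p' Z Y| :=
    (h1 Z').trans (Finset.single_le_sum (f := fun Y => |p Z Y - p' Z Y|)
      (fun _ _ => abs_nonneg _) hZ')
  have h0 : 0 ≤ ∑ Y ∈ 𝒯.adj Z, |(δ Z - δ' Z) - (δ Y - δ' Y)| := by positivity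
  have h0' : 0 ≤ ∑ Y ∈ 𝒯.adj Z, |p Z Y - p' Z Y| := by positivity
  unfold limPos
  by_cases hZ : Z ∈ Ω
  · simp only [hZ, if_true, ratioPos]
    refine (abs_mul_min_div_sub_le (le_max_left _ _) ?_
      (mul_nonneg (hq hZ) (sub_nonneg.2 (𝒯.le_locMax _ _))) (le_max_left _ _) ?_
      (mul_nonneg (hq hZ) (sub_nonneg.2 (𝒯.le_locMax _ _)))).trans ?_
    · exact Finset.single_le_sum (f := fun Y => max 0 (p Z Y)) (fun _ _ => le_max_left _ _) hZ'
    · exact Finset.single_le_sum (f := fun Y => max 0 (p' Z Y)) (fun _ _ => le_max_left _ _) hZ'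
    · have h3 : |∑ Y ∈ 𝒯.adj Z, max 0 (p Z Y) - ∑ Y ∈ 𝒯.adj Z, max 0 (p' Z Y)| ≤
          ∑ Y ∈ 𝒯.adj Z, |p Z Y - p' Z Y| := by
        rw [← Finset.sum_sub_distrib]
        exact (Finset.abs_sum_le_sum_abs _ _).trans (Finset.sum_le_sum fun Y _ => h1 Y)
      have h4 : |q Z * (𝒯.locMax δ Z - δ Z) - q Z * (𝒯.locMax δ' Z - δ' Z)| ≤
          Q * ∑ Y ∈ 𝒯.adj Z, |(δ Z - δ' Z) - (δ Y - δ' Y)| := by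
        rw [← mul_sub, abs_mul, abs_of_nonneg (hq hZ)]
        exact mul_le_mul (hQ hZ) (𝒯.abs_locMax_sub_le _ _ _) (abs_nonneg _) hQ0
      linarith
  · simp only [hZ, if_false, mul_one]
    have := mul_nonneg hQ0 h0
    linarith

theorem abs_factor_mul_flux_sub_le {p p' : Plane → Plane → ℝ} (hp : ∀ Z Z', p Z' Z = -p Z Z')
    (hp' : ∀ Z Z', p' Z' Z = -p' Z Z') {q δ δ' : Plane → ℝ}
    (hq : ∀ Z ∈ 𝒯.nodes, Z ∈ Ω → 0 ≤ q Z) {Q : ℝ} (hQ0 : 0 ≤ Q)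
    (hQ : ∀ Z ∈ 𝒯.nodes, Z ∈ Ω → q Z ≤ Q) {Z Z' : Plane} (hZ : Z' ∈ 𝒯.adj Z) :
    |𝒯.factor p q δ Z Z' * p Z Z' - 𝒯.factor p' q δ' Z Z' * p' Z Z'| ≤
      2 * ((3 * ∑ Y ∈ 𝒯.adj Z, |p Z Y - p' Z Y|
        + Q * ∑ Y ∈ 𝒯.adj Z, |(δ Z - δ' Z) - (δ Y - δ' Y)|) +
      (3 * ∑ Y ∈ 𝒯.adj Z', |p Z' Y - p' Z' Y|
        + Q * ∑ Y ∈ 𝒯.adj Z', |(δ Z' - δ' Z') - (δ Y - δ' Y)|)) := by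
  have hZ' := 𝒯.mem_adj_comm.1 hZ
  have n := 𝒯.mem_nodes_of_mem_adj hZ'
  have n' := 𝒯.mem_nodes_of_mem_adj hZ
  have neg1 : ∀ a b : ℝ, |-a - -b| = |a - b| := fun a b => by rw [← abs_neg]; congr 1; ring
  have neg2 : ∀ a b c d : ℝ, |-a - -b - (-c - -d)| = |a - b - (c - d)| := fun a b c d => by
    rw [← abs_neg]; congr 1; ring
  have b₁ := 𝒯.abs_limPos_sub_le (p := p) (p' := p') (δ := δ) (δ' := δ') (hq Z n) hQ0 (hQ Z n) hZ
  have b₂ := 𝒯.abs_limPos_sub_le (p := p) (p' := p') (δ := δ) (δ' := δ') (hq Z' n') hQ0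
    (hQ Z' n') hZ'
  have b₃ := 𝒯.abs_limPos_sub_le (p := fun a b => -p a b) (p' := fun a b => -p' a b)
    (δ := fun x => -δ x) (δ' := fun x => -δ' x) (hq Z n) hQ0 (hQ Z n) hZ
  have b₄ := 𝒯.abs_limPos_sub_le (p := fun a b => -p a b) (p' := fun a b => -p' a b)
    (δ := fun x => -δ x) (δ' := fun x => -δ' x) (hq Z' n') hQ0 (hQ Z' n') hZ'
  simp only [neg1, neg2] at b₃ b₄
  rw [𝒯.factor_mul_flux p hp, 𝒯.factor_mul_flux p' hp']
  have m₁ := abs_min_sub_min_le_max (𝒯.limPos p q δ Z Z')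
    (𝒯.limPos (fun a b => -p a b) q (fun x => -δ x) Z' Z) (𝒯.limPos p' q δ' Z Z')
    (𝒯.limPos (fun a b => -p' a b) q (fun x => -δ' x) Z' Z)
  have m₂ := abs_min_sub_min_le_max (𝒯.limPos (fun a b => -p a b) q (fun x => -δ x) Z Z')
    (𝒯.limPos p q δ Z' Z) (𝒯.limPos (fun a b => -p' a b) q (fun x => -δ' x) Z Z')
    (𝒯.limPos p' q δ' Z' Z)
  set B := 3 * ∑ Y ∈ 𝒯.adj Z, |p Z Y - p' Z Y|
        + Q * ∑ Y ∈ 𝒯.adj Z, |(δ Z - δ' Z) - (δ Y - δ' Y)|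
  set B' := 3 * ∑ Y ∈ 𝒯.adj Z', |p Z' Y - p' Z' Y|
        + Q * ∑ Y ∈ 𝒯.adj Z', |(δ Z' - δ' Z') - (δ Y - δ' Y)|
  have hB : 0 ≤ B := by positivity
  have hB' : 0 ≤ B' := by positivity
  replace m₁ := m₁.trans (max_le (b₁.trans (le_add_of_nonneg_right hB'))
    (b₄.trans (le_add_of_nonneg_left hB)))
  replace m₂ := m₂.trans (max_le (b₃.trans (le_add_of_nonneg_right hB'))
    (b₂.trans (le_add_of_nonneg_left hB)))
  rw [sub_sub_sub_comm]
  exact (abs_sub _ _).trans (by linarith)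

/-! ### Stabilization forms -/

/-- The sum of the squared jumps of the nodal values along the edges (each counted twice). -/
def jumpSq (v : Plane → ℝ) : ℝ := ∑ Z ∈ 𝒯.nodes, ∑ Z' ∈ 𝒯.adj Z, (v Z - v Z') ^ 2

theorem jumpSq_nonneg (v : Plane → ℝ) : 0 ≤ 𝒯.jumpSq v := by unfold jumpSq; positivity

/-- Coefficients that are symmetric and couple only adjacent nodes. -/
structure IsEdgeCoef (c : Plane → Plane → ℝ) : Prop where
  symm : ∀ Z Z', c Z' Z = c Z Z'
  eq_zero : ∀ Z ∈ 𝒯.nodes, ∀ Z' ∈ 𝒯.nodes, Z' ≠ Z → Z' ∉ 𝒯.adj Z → c Z Z' = 0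

variable {𝒯} in
theorem IsEdgeCoef.mul {c a : Plane → Plane → ℝ} (hc : 𝒯.IsEdgeCoef c)
    (ha : ∀ Z Z', a Z' Z = a Z Z') : 𝒯.IsEdgeCoef fun Z Z' => c Z Z' * a Z Z' :=
  ⟨fun Z Z' => by rw [hc.symm, ha], fun Z hZ Z' hZ' h h' => by rw [hc.eq_zero Z hZ Z' hZ' h h',
    zero_mul]⟩

variable {𝒯} in
-- Averaging the sum with the one where Z and Z' are exchanged moves a difference onto the test
-- function as well. This yields nonnegativity and bounds by edge jumps on both sides.
theorem IsEdgeCoef.stab_eq {c : Plane → Plane → ℝ} (hc : 𝒯.IsEdgeCoef c) (v z : Plane → ℝ) :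
    𝒯.stab c v z = 1 / 2 * ∑ Z ∈ 𝒯.nodes, ∑ Z' ∈ 𝒯.adj Z,
      c Z Z' * (v Z - v Z') * (z Z - z Z') := by
  have h1 : 𝒯.stab c v z = ∑ Z ∈ 𝒯.nodes, ∑ Z' ∈ 𝒯.adj Z, c Z Z' * (v Z - v Z') * z Z := by
    refine Finset.sum_congr rfl fun Z hZ => ?_
    symm
    refine Finset.sum_subset (fun Z' h => 𝒯.mem_nodes_of_mem_adj h) fun Z' hZ' h => ?_
    by_cases hne : Z' = Z
    · simp [hne]
    · simp [hc.eq_zero Z hZ Z' hZ' hne h]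
  have h2 := h1
  rw [𝒯.sum_adj_comm] at h2
  have h3 : ∑ Z ∈ 𝒯.nodes, ∑ Z' ∈ 𝒯.adj Z, c Z' Z * (v Z' - v Z) * z Z' =
      -∑ Z ∈ 𝒯.nodes, ∑ Z' ∈ 𝒯.adj Z, c Z Z' * (v Z - v Z') * z Z' := by
    simp only [← Finset.sum_neg_distrib]
    refine Finset.sum_congr rfl fun Z _ => Finset.sum_congr rfl fun Z' _ => ?_
    rw [hc.symm Z Z']; ring
  rw [h3] at h2
  simp only [mul_sub, Finset.sum_sub_distrib] at h1 h2 ⊢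
  linarith

theorem abs_sum_adj_mul_le (s : Plane → Plane → ℝ) (z : Plane → ℝ) {A : ℝ} (hA0 : 0 ≤ A)
    (hA : ∑ Z ∈ 𝒯.nodes, ∑ Z' ∈ 𝒯.adj Z, s Z Z' ^ 2 ≤ A ^ 2) :
    |∑ Z ∈ 𝒯.nodes, ∑ Z' ∈ 𝒯.adj Z, s Z Z' * (z Z - z Z')| ≤ A * √(𝒯.jumpSq z) := by
  refine Real.abs_le_sqrt ?_ |>.trans_eq (b := √(A ^ 2 * 𝒯.jumpSq z)) ?_
  · have h := Finset.sum_mul_sq_le_sq_mul_sq (𝒯.nodes.sigma fun Z => 𝒯.adj Z)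
      (fun x => s x.1 x.2) (fun x => z x.1 - z x.2)
    simp only [Finset.sum_sigma] at h
    refine h.trans ?_
    exact mul_le_mul_of_nonneg_right hA (𝒯.jumpSq_nonneg z)
  · rw [Real.sqrt_mul (sq_nonneg A), Real.sqrt_sq hA0]

theorem abs_stab_le {c : Plane → Plane → ℝ} (hc : 𝒯.IsEdgeCoef c) {M : ℝ} (hM0 : 0 ≤ M)
    (hM : ∀ Z Z', |c Z Z'| ≤ M) (v z : Plane → ℝ) :
    |𝒯.stab c v z| ≤ M * √(𝒯.jumpSq v) * √(𝒯.jumpSq z) := by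
  rw [hc.stab_eq, abs_mul, abs_of_nonneg (by norm_num : (0 : ℝ) ≤ 1 / 2)]
  have := 𝒯.abs_sum_adj_mul_le (fun Z Z' => c Z Z' * (v Z - v Z')) z
    (A := M * √(𝒯.jumpSq v)) (by positivity) (by
      rw [mul_pow, Real.sq_sqrt (𝒯.jumpSq_nonneg v), jumpSq, Finset.mul_sum]
      refine Finset.sum_le_sum fun Z _ => ?_
      rw [Finset.mul_sum]
      refine Finset.sum_le_sum fun Z' _ => ?_
      rw [mul_pow]
      exact mul_le_mul_of_nonneg_right
        (sq_le_sq' (neg_le_of_abs_le (hM Z Z')) (le_of_abs_le (hM Z Z'))) (sq_nonneg _))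
  have h0 : 0 ≤ M * √(𝒯.jumpSq v) * √(𝒯.jumpSq z) := by positivity
  linarith

theorem stab_self_nonneg {c : Plane → Plane → ℝ} (hc : 𝒯.IsEdgeCoef c) (h0 : ∀ Z Z', 0 ≤ c Z Z')
    (v : Plane → ℝ) : 0 ≤ 𝒯.stab c v v := by
  rw [hc.stab_eq]
  refine mul_nonneg (by norm_num) (Finset.sum_nonneg fun Z _ => Finset.sum_nonneg fun Z' _ => ?_)
  rw [mul_assoc]
  exact mul_nonneg (h0 _ _) (mul_self_nonneg _)

theorem factor_comm (p : Plane → Plane → ℝ) (q δ : Plane → ℝ) (Z Z' : Plane) :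
    𝒯.factor p q δ Z' Z = 𝒯.factor p q δ Z Z' := min_comm _ _

/-- Lipschitz continuity of the antidiffusive part of a stabilization. -/
theorem abs_stab_limited_sub_le {c : Plane → Plane → ℝ} (hc : 𝒯.IsEdgeCoef c) {M : ℝ}
    (hM0 : 0 ≤ M) (hM : ∀ Z Z', |c Z Z'| ≤ M) {n : ℕ} (hn : ∀ Z, (𝒯.adj Z).card ≤ n) {s Γ : ℝ}
    (hs : s ^ 2 = 1) (hΓ0 : 0 ≤ Γ) {γ : Plane → ℝ} (hγ0 : ∀ Z ∈ 𝒯.nodes, Z ∈ Ω → 0 ≤ γ Z)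
    (hγ : ∀ Z ∈ 𝒯.nodes, Z ∈ Ω → γ Z ≤ Γ) (δ δ' v v' z : Plane → ℝ)
    {p p' : Plane → Plane → ℝ} (hp : ∀ Z Z', p Z Z' = s * (c Z Z' * (v Z - v Z')))
    (hp' : ∀ Z Z', p' Z Z' = s * (c Z Z' * (v' Z - v' Z'))) :
    |𝒯.stab (fun Z Z' => c Z Z' * 𝒯.factor p (𝒯.qCoef γ c) δ Z Z') v z -
      𝒯.stab (fun Z Z' => c Z Z' * 𝒯.factor p' (𝒯.qCoef γ c) δ' Z Z') v' z| ≤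
      3 * n * (3 + Γ * n) * M * (√(𝒯.jumpSq fun x => v x - v' x) + √(𝒯.jumpSq fun x => δ x - δ' x))
        * √(𝒯.jumpSq z) := by
  have hs1 : |s| = 1 := by
    rw [← abs_one, ← sq_eq_sq_iff_abs_eq_abs, hs, one_pow]
  have anti : ∀ Z Z', p Z' Z = -p Z Z' := fun Z Z' => by rw [hp, hp, hc.symm Z Z']; ring
  have anti' : ∀ Z Z', p' Z' Z = -p' Z Z' := fun Z Z' => by rw [hp', hp', hc.symm Z Z']; ring
  have hsum0 : ∀ Z, 0 ≤ ∑ Z' ∈ 𝒯.adj Z, |c Z Z'| := fun Z => by positivity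
  have hq : ∀ Z ∈ 𝒯.nodes, Z ∈ Ω → 0 ≤ 𝒯.qCoef γ c Z := fun Z hZ hZ' =>
    mul_nonneg (hγ0 Z hZ hZ') (hsum0 Z)
  have hQ : ∀ Z ∈ 𝒯.nodes, Z ∈ Ω → 𝒯.qCoef γ c Z ≤ Γ * n * M := fun Z hZ hZ' => by
    have : ∑ Z' ∈ 𝒯.adj Z, |c Z Z'| ≤ n * M := by
      refine (Finset.sum_le_card_nsmul _ _ M fun Z' _ => hM Z Z').trans ?_
      rw [nsmul_eq_mul]
      gcongr
      exact hn Z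
    rw [mul_assoc]
    exact mul_le_mul (hγ Z hZ hZ') this (hsum0 Z) hΓ0
  rw [(hc.mul (𝒯.factor_comm _ _ _)).stab_eq, (hc.mul (𝒯.factor_comm _ _ _)).stab_eq, ← mul_sub,
    ← Finset.sum_sub_distrib]
  simp only [← Finset.sum_sub_distrib, ← sub_mul]
  set w := fun x => v x - v' x
  set e := fun x => δ x - δ' x
  set g : Plane → ℝ := fun Z => ∑ Y ∈ 𝒯.adj Z, (|w Z - w Y| + |e Z - e Y|) with hg
  have hg0 : ∀ Z, 0 ≤ g Z := fun Z => by positivity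
  set L := (3 + Γ * n) * M with hL
  have hL0 : 0 ≤ L := by positivity
  -- The sign s disappears in the modulus, so the terms to be compared are limited fluxes.
  have hpw : ∀ Z Z', |c Z Z' * 𝒯.factor p (𝒯.qCoef γ c) δ Z Z' * (v Z - v Z')
      - c Z Z' * 𝒯.factor p' (𝒯.qCoef γ c) δ' Z Z' * (v' Z - v' Z')| =
      |𝒯.factor p (𝒯.qCoef γ c) δ Z Z' * p Z Z' - 𝒯.factor p' (𝒯.qCoef γ c) δ' Z Z' * p' Z Z'| :=
    fun Z Z' => by
      rw [hp, hp', ← one_mul |_ - _|, ← hs1, ← abs_mul]; congr 1; ring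
  have hB : ∀ Z, 3 * ∑ Y ∈ 𝒯.adj Z, |p Z Y - p' Z Y|
        + Γ * n * M * ∑ Y ∈ 𝒯.adj Z, |(δ Z - δ' Z) - (δ Y - δ' Y)| ≤ L * g Z := fun Z => by
    rw [hg, Finset.mul_sum, Finset.mul_sum, Finset.mul_sum, ← Finset.sum_add_distrib]
    refine Finset.sum_le_sum fun Y _ => ?_
    have h1 : |p Z Y - p' Z Y| ≤ M * |w Z - w Y| := by
      rw [hp, hp', ← mul_sub, abs_mul, hs1, one_mul, ← mul_sub, abs_mul,
        sub_sub_sub_comm (v Z) (v Y)]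
      gcongr
      exact hM Z Y
    have h2 : 0 ≤ M * |e Z - e Y| := by positivity
    have h3 : 0 ≤ Γ * n * M * |w Z - w Y| := by positivity
    simp only [hL, w, e] at *
    linarith
  have hterm : ∀ Z ∈ 𝒯.nodes, ∀ Z' ∈ 𝒯.adj Z,
      (c Z Z' * 𝒯.factor p (𝒯.qCoef γ c) δ Z Z' * (v Z - v Z')
      - c Z Z' * 𝒯.factor p' (𝒯.qCoef γ c) δ' Z Z' * (v' Z - v' Z')) ^ 2 ≤
      8 * L ^ 2 * (g Z ^ 2 + g Z' ^ 2) := fun Z _ Z' hZ' => by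
    rw [← sq_abs, hpw]
    have h1 : |𝒯.factor p (𝒯.qCoef γ c) δ Z Z' * p Z Z'
        - 𝒯.factor p' (𝒯.qCoef γ c) δ' Z Z' * p' Z Z'| ≤ 2 * (L * g Z + L * g Z') :=
      (𝒯.abs_factor_mul_flux_sub_le anti anti' hq (by positivity) hQ hZ').trans (by
        gcongr <;> exact hB _)
    refine (pow_le_pow_left₀ (abs_nonneg _) h1 2).trans ?_
    nlinarith [sq_nonneg (g Z - g Z'), mul_nonneg (sq_nonneg L) (sq_nonneg (g Z - g Z'))]
  -- Cauchy–Schwarz over at most n neighbours: bounded valence is what makes the local stencils sum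
  -- up.
  have hgsum : ∑ Z ∈ 𝒯.nodes, g Z ^ 2 ≤ 2 * n * (𝒯.jumpSq w + 𝒯.jumpSq e) := by
    rw [jumpSq, jumpSq, ← Finset.sum_add_distrib, Finset.mul_sum]
    refine Finset.sum_le_sum fun Z _ => ?_
    refine (sq_sum_le_card_mul_sum_sq).trans ?_
    rw [← Finset.sum_add_distrib, mul_comm (2 : ℝ), mul_assoc]
    refine mul_le_mul (by exact_mod_cast hn Z) ?_ (by positivity) (by positivity)
    rw [Finset.mul_sum]
    refine Finset.sum_le_sum fun Y _ => ?_
    rw [← sq_abs (w Z - w Y), ← sq_abs (e Z - e Y)]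
    nlinarith [sq_nonneg (|w Z - w Y| - |e Z - e Y|)]
  have hcount : ∑ Z ∈ 𝒯.nodes, ∑ _Z' ∈ 𝒯.adj Z, g Z ^ 2 ≤ n * ∑ Z ∈ 𝒯.nodes, g Z ^ 2 := by
    rw [Finset.mul_sum]
    refine Finset.sum_le_sum fun Z _ => ?_
    rw [Finset.sum_const, nsmul_eq_mul]
    gcongr
    exact hn Z
  have hfin := 𝒯.abs_sum_adj_mul_le (fun Z Z' => c Z Z' * 𝒯.factor p (𝒯.qCoef γ c) δ Z Z'
    * (v Z - v Z') - c Z Z' * 𝒯.factor p' (𝒯.qCoef γ c) δ' Z Z' * (v' Z - v' Z')) z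
    (A := 6 * n * L * (√(𝒯.jumpSq w) + √(𝒯.jumpSq e))) (by positivity) (by
      refine (Finset.sum_le_sum fun Z hZ => Finset.sum_le_sum fun Z' hZ' =>
        hterm Z hZ Z' hZ').trans ?_
      simp only [← Finset.mul_sum, Finset.sum_add_distrib]
      rw [𝒯.sum_adj_comm fun _ Z' => g Z' ^ 2]
      have r1 := Real.sq_sqrt (𝒯.jumpSq_nonneg w)
      have r2 := Real.sq_sqrt (𝒯.jumpSq_nonneg e)
      have r3 : 𝒯.jumpSq w + 𝒯.jumpSq e ≤ (√(𝒯.jumpSq w) + √(𝒯.jumpSq e)) ^ 2 := by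
        have := mul_nonneg (Real.sqrt_nonneg (𝒯.jumpSq w)) (Real.sqrt_nonneg (𝒯.jumpSq e))
        nlinarith
      calc _ ≤ 8 * L ^ 2 * (n * (2 * n * (𝒯.jumpSq w + 𝒯.jumpSq e))
            + n * (2 * n * (𝒯.jumpSq w + 𝒯.jumpSq e))) := by
            have := hcount.trans (mul_le_mul_of_nonneg_left hgsum (by positivity))
            gcongr
        _ = 32 * (n * L) ^ 2 * (𝒯.jumpSq w + 𝒯.jumpSq e) := by ring
        -- 32 is rounded up to the perfect square 36; the factor 6 is halved by the 1/2 of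
        -- `stab_eq`.
        _ ≤ 36 * (n * L) ^ 2 * (√(𝒯.jumpSq w) + √(𝒯.jumpSq e)) ^ 2 := by
            refine mul_le_mul (by gcongr; norm_num) r3 ?_ (by positivity)
            exact add_nonneg (𝒯.jumpSq_nonneg w) (𝒯.jumpSq_nonneg e)
        _ = _ := by ring)
  rw [abs_mul, abs_of_nonneg (by norm_num : (0 : ℝ) ≤ 1 / 2)]
  linarith

end Triangulation

end

end AFC

namespace AFC

noncomputable section

/-! ### Affine functions on triangles -/

theorem exists_inner_add_const (A : Plane →ᵃ[ℝ] ℝ) :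
    ∃ (g : Plane) (a : ℝ), ∀ x, A x = inner ℝ g x + a := by
  refine ⟨(InnerProductSpace.toDual ℝ Plane).symm (LinearMap.toContinuousLinearMap A.linear), A 0,
    fun x => ?_⟩
  rw [InnerProductSpace.toDual_symm_apply, LinearMap.coe_toContinuousLinearMap',
    AffineMap.decomp' A]
  simp

theorem inner_add_const_sum {K : Finset Plane} {w : Plane → ℝ} {x : Plane}
    (h1 : ∑ y ∈ K, w y = 1) (hx : ∑ y ∈ K, w y • y = x) (g : Plane) (a : ℝ) :
    inner ℝ g x + a = ∑ y ∈ K, w y * (inner ℝ g y + a) := by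
  simp only [mul_add, Finset.sum_add_distrib, ← Finset.sum_mul, h1, one_mul, ← hx, inner_sum,
    inner_smul_right]

theorem exists_coordinate {K : Finset Plane} (hK : K.card = 3)
    (hA : AffineIndependent ℝ (fun z : K => (z : Plane))) {Z : Plane} (hZ : Z ∈ K) :
    ∃ (g : Plane) (a : ℝ), inner ℝ g Z + a = 1 ∧ ∀ y ∈ K, y ≠ Z → inner ℝ g y + a = 0 := by
  have hspan : affineSpan ℝ (range fun z : K => (z : Plane)) = ⊤ :=
    hA.affineSpan_eq_top_iff_card_eq_finrank_add_one.2 (by simp [hK])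
  let b : AffineBasis K ℝ Plane := ⟨fun z => z, hA, hspan⟩
  obtain ⟨g, a, hg⟩ := exists_inner_add_const (b.coord ⟨Z, hZ⟩)
  refine ⟨g, a, ?_, fun y hy hne => ?_⟩
  · rw [← hg]
    exact b.coord_apply_eq ⟨Z, hZ⟩
  · rw [← hg]
    exact b.coord_apply_ne (i := ⟨Z, hZ⟩) (j := ⟨y, hy⟩) fun h => hne (congrArg Subtype.val h).symm

/-- The unit vector in direction `g` (zero if `g = 0`). -/
def dir (g : Plane) : Plane := ‖g‖⁻¹ • g

theorem norm_dir_le (g : Plane) : ‖dir g‖ ≤ 1 := by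
  rw [dir, norm_smul, norm_inv, norm_norm]
  exact inv_mul_le_one

theorem inner_dir (g : Plane) : inner ℝ g (dir g) = ‖g‖ := by
  rw [dir, inner_smul_right, real_inner_self_eq_norm_sq]
  rcases eq_or_ne ‖g‖ 0 with h | h
  · simp [h]
  · field_simp

theorem measureReal_ball_plane (x : Plane) {r : ℝ} (hr : 0 ≤ r) :
    volume.real (Metric.ball x r) = Real.pi * r ^ 2 := by
  rw [measureReal_def, EuclideanSpace.volume_ball_fin_two, ENNReal.toReal_mul, ENNReal.toReal_pow,
    ENNReal.toReal_ofReal hr, ENNReal.toReal_ofReal Real.pi_pos.le, mul_comm]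

theorem measureReal_closedBall_plane (x : Plane) {r : ℝ} (hr : 0 ≤ r) :
    volume.real (Metric.closedBall x r) = Real.pi * r ^ 2 := by
  rw [measureReal_def, EuclideanSpace.volume_closedBall_fin_two, ENNReal.toReal_mul,
    ENNReal.toReal_pow, ENNReal.toReal_ofReal hr, ENNReal.toReal_ofReal Real.pi_pos.le, mul_comm]

/-- The interior of the triangle with vertex set `K`. -/
def cell (K : Finset Plane) : Set Plane := interior (convexHull ℝ (K : Set Plane))

theorem isOpen_cell (K : Finset Plane) : IsOpen (cell K) := isOpen_interior

theorem cell_subset_convexHull (K : Finset Plane) : cell K ⊆ convexHull ℝ (K : Set Plane) :=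
  interior_subset

theorem isCompact_convexHull (K : Finset Plane) : IsCompact (convexHull ℝ (K : Set Plane)) :=
  K.finite_toSet.isCompact_convexHull ℝ

theorem volume_cell (K : Finset Plane) :
    volume (cell K) = volume (convexHull ℝ (K : Set Plane)) :=
  measure_congr (interior_ae_eq_of_null_frontier ((convex_convexHull ℝ _).addHaar_frontier volume))

/-! ### Open cells: disjointness and covering of Ω up to a null set -/

namespace Triangulation

variable {Ω : Set Plane} (𝒯 : Triangulation Ω)

theorem dist_le_meshSize {K : Finset Plane} (hK : K ∈ 𝒯.triangles) {x y : Plane}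
    (hx : x ∈ convexHull ℝ (K : Set Plane)) (hy : y ∈ convexHull ℝ (K : Set Plane)) :
    dist x y ≤ 𝒯.meshSize :=
  (Metric.dist_le_diam_of_mem (isCompact_convexHull K).isBounded hx hy).trans
    (le_ciSup (f := fun K : 𝒯.triangles =>
      Metric.diam (convexHull ℝ ((K : Finset Plane) : Set Plane)))
      (Set.finite_range _).bddAbove ⟨K, hK⟩)

/-- If a vertex z of K were missing in K', its barycentric coordinate in K would vanish on the
common face, hence at x. It is nonnegative on a neighbourhood of x, so its gradient is zero,
contradicting the value 1 at z. -/
theorem eq_of_mem_cell {K K' : Finset Plane} (hK : K ∈ 𝒯.triangles) (hK' : K' ∈ 𝒯.triangles)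
    {x : Plane} (hx : x ∈ cell K) (hx' : x ∈ convexHull ℝ (K' : Set Plane)) : K = K' := by
  refine Finset.eq_of_subset_of_card_le (fun z hz => ?_)
    (by rw [𝒯.card_eq_three K hK, 𝒯.card_eq_three K' hK'])
  by_contra hz'
  obtain ⟨g, a, h1, h0⟩ := exists_coordinate (𝒯.card_eq_three K hK) (𝒯.affineIndependent K hK) hz
  have hnonneg : ∀ y ∈ convexHull ℝ (K : Set Plane), 0 ≤ inner ℝ g y + a := fun y hy => by
    obtain ⟨w, hw, hw1, hwy⟩ := Finset.mem_convexHull'.1 hy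
    rw [inner_add_const_sum hw1 hwy]
    refine Finset.sum_nonneg fun u hu => mul_nonneg (hw u hu) ?_
    by_cases h : u = z
    · rw [h, h1]; exact zero_le_one
    · rw [h0 u hu h]
  have hzero : inner ℝ g x + a = 0 := by
    classical
    have hmem : x ∈ convexHull ℝ ((K ∩ K' : Finset Plane) : Set Plane) := by
      rw [Finset.coe_inter, ← 𝒯.conforming K hK K' hK']
      exact ⟨cell_subset_convexHull K hx, hx'⟩
    obtain ⟨w, -, hw1, hwy⟩ := Finset.mem_convexHull'.1 hmem
    rw [inner_add_const_sum hw1 hwy]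
    refine Finset.sum_eq_zero fun u hu => ?_
    rw [Finset.mem_inter] at hu
    rw [h0 u hu.1 fun h => hz' (h ▸ hu.2), mul_zero]
  obtain ⟨ε, hε, hball⟩ := Metric.isOpen_iff.1 (isOpen_cell K) x hx
  have hy : x - (ε / 2) • dir g ∈ Metric.ball x ε := by
    rw [Metric.mem_ball, dist_eq_norm, sub_sub_cancel_left, norm_neg, norm_smul,
      Real.norm_of_nonneg (half_pos hε).le]
    have := norm_dir_le g
    nlinarith
  have h2 := hnonneg _ (cell_subset_convexHull K (hball hy))
  rw [inner_sub_right, inner_smul_right, inner_dir] at h2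
  have hg : ‖g‖ = 0 := le_antisymm (by nlinarith) (norm_nonneg g)
  rw [norm_eq_zero] at hg
  simp only [hg, inner_zero_left] at h1 hzero
  linarith

theorem disjoint_cell {K K' : Finset Plane} (hK : K ∈ 𝒯.triangles) (hK' : K' ∈ 𝒯.triangles)
    (h : K ≠ K') : Disjoint (cell K) (cell K') :=
  Set.disjoint_left.2 fun _ hx hx' => h (𝒯.eq_of_mem_cell hK hK' hx (cell_subset_convexHull _ hx'))

theorem convexHull_subset_closure {K : Finset Plane} (hK : K ∈ 𝒯.triangles) :
    convexHull ℝ (K : Set Plane) ⊆ closure Ω := by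
  rw [← 𝒯.cover]
  exact subset_biUnion_of_mem (u := fun K : Finset Plane => convexHull ℝ (K : Set Plane)) hK

theorem exists_mem_convexHull {x : Plane} (hx : x ∈ closure Ω) :
    ∃ K ∈ 𝒯.triangles, x ∈ convexHull ℝ (K : Set Plane) := by
  rw [← 𝒯.cover] at hx
  simpa using hx

/-- An open convex set is the interior of its closure. -/
theorem cell_subset (hΩ : IsConvexPolygon Ω) {K : Finset Plane} (hK : K ∈ 𝒯.triangles) :
    cell K ⊆ Ω := by
  have h := hΩ.2.2.1.interior_closure_eq_interior_of_nonempty_interior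
    (by rw [hΩ.1.interior_eq]; exact hΩ.2.1)
  rw [hΩ.1.interior_eq] at h
  rw [← h]
  exact interior_mono (𝒯.convexHull_subset_closure hK)

theorem biUnion_cell_ae_eq (hΩ : IsConvexPolygon Ω) : ⋃ K ∈ 𝒯.triangles, cell K =ᵐ[volume] Ω := by
  have hnull : volume (⋃ K ∈ 𝒯.triangles, frontier (convexHull ℝ (K : Set Plane))) = 0 :=
    (measure_biUnion_null_iff 𝒯.triangles.countable_toSet).2 fun K _ =>
      (convex_convexHull ℝ _).addHaar_frontier volume
  refine (ae_le_set.2 ?_).antisymm (ae_le_set.2 (measure_mono_null ?_ hnull))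
  · refine measure_mono_null (fun x hx => hx.2 ?_) (measure_empty (μ := volume))
    obtain ⟨K, hK, hxK⟩ := mem_iUnion₂.1 hx.1
    exact 𝒯.cell_subset hΩ hK hxK
  · rintro x ⟨hx, hx'⟩
    obtain ⟨K, hK, hxK⟩ := 𝒯.exists_mem_convexHull (subset_closure hx)
    refine mem_biUnion hK ⟨subset_closure hxK, fun h => hx' (mem_biUnion hK h)⟩

theorem ae_mem_cell (hΩ : IsConvexPolygon Ω) :
    ∀ᵐ x ∂volume.restrict Ω, ∃ K ∈ 𝒯.triangles, x ∈ cell K := by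
  have h := 𝒯.biUnion_cell_ae_eq hΩ
  rw [ae_restrict_iff' hΩ.1.measurableSet]
  filter_upwards [h.mem_iff] with x hx hxΩ
  simpa using hx.2 hxΩ

theorem sum_setIntegral_cell (hΩ : IsConvexPolygon Ω) {F : Plane → ℝ} (hF : IntegrableOn F Ω) :
    ∑ K ∈ 𝒯.triangles, ∫ x in cell K, F x = ∫ x in Ω, F x := by
  rw [← setIntegral_congr_set (𝒯.biUnion_cell_ae_eq hΩ), integral_biUnion_finset]
  · exact fun K _ => (isOpen_cell K).measurableSet
  · exact fun K hK K' hK' h => 𝒯.disjoint_cell hK hK' h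
  · exact fun K hK => hF.mono_set (𝒯.cell_subset hΩ hK)

/-- Every triangle contains a disc whose radius is `ϑ` times the mesh size. -/
structure IsRegular (ϑ : ℝ) : Prop where
  pos : 0 < ϑ
  le_one : ϑ ≤ 1
  meshSize_pos : 0 < 𝒯.meshSize
  exists_ball : ∀ K ∈ 𝒯.triangles, ∃ c, Metric.ball c (ϑ * 𝒯.meshSize) ⊆ cell K

theorem exists_isRegular (hΩ : IsConvexPolygon Ω) (σ ρ : ℝ) : ∃ ϑ : ℝ, ∀ 𝒯 : Triangulation Ω,
    𝒯.ShapeRegular σ → 𝒯.QuasiUniform ρ → 𝒯.IsRegular ϑ := by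
  -- In the 4, one factor 2 passes from diameter to radius and the other is slack. Using |σ| + 1 and
  -- |ρ| + 1 covers arbitrary real σ, ρ and gives the strict inequality needed to find a radius
  -- below the supremum.
  refine ⟨1 / (4 * (|σ| + 1) * (|ρ| + 1)), fun 𝒯 hσ hρ => ?_⟩
  have hdiam : ∀ K ∈ 𝒯.triangles, 0 < Metric.diam (convexHull ℝ (K : Set Plane)) := fun K hK => by
    obtain ⟨x, hx, y, hy, hxy⟩ := Finset.one_lt_card.1 (by rw [𝒯.card_eq_three K hK]; norm_num)
    exact (dist_pos.2 hxy).trans_le (Metric.dist_le_diam_of_mem (isCompact_convexHull K).isBounded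
      (subset_convexHull ℝ _ hx) (subset_convexHull ℝ _ hy))
  obtain ⟨x₀, hx₀⟩ := hΩ.2.1
  obtain ⟨K₀, hK₀, -⟩ := 𝒯.exists_mem_convexHull (subset_closure hx₀)
  have hle : ∀ K ∈ 𝒯.triangles, 𝒯.meshSize ≤ |ρ| * Metric.diam (convexHull ℝ (K : Set Plane)) :=
    fun K hK => by
      have : Nonempty 𝒯.triangles := ⟨⟨K, hK⟩⟩
      refine ciSup_le fun K' => (hρ K' K'.2 K hK).trans ?_
      exact mul_le_mul_of_nonneg_right (le_abs_self ρ) Metric.diam_nonneg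
  have hpos : 0 < 𝒯.meshSize := by
    refine (hdiam K₀ hK₀).trans_le ?_
    exact le_ciSup (f := fun K : 𝒯.triangles =>
      Metric.diam (convexHull ℝ ((K : Finset Plane) : Set Plane)))
      (Set.finite_range _).bddAbove ⟨K₀, hK₀⟩
  have h4 : 1 ≤ 4 * (|σ| + 1) * (|ρ| + 1) := by
    nlinarith [abs_nonneg σ, abs_nonneg ρ, mul_nonneg (abs_nonneg σ) (abs_nonneg ρ)]
  refine ⟨by positivity, (div_le_one (by positivity)).2 h4, hpos, fun K hK => ?_⟩
  set S := {r : ℝ | 0 ≤ r ∧ ∃ c, Metric.closedBall c r ⊆ convexHull ℝ (K : Set Plane)} with hS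
  have hne : S.Nonempty := by
    obtain ⟨x, hx⟩ := Finset.card_pos.1 (by rw [𝒯.card_eq_three K hK]; norm_num : 0 < K.card)
    refine ⟨0, le_rfl, x, ?_⟩
    rw [Metric.closedBall_zero, singleton_subset_iff]
    exact subset_convexHull ℝ _ hx
  have hd := hdiam K hK
  have h1 : Metric.diam (convexHull ℝ (K : Set Plane)) ≤ (|σ| + 1) * (2 * sSup S) := by
    refine (hσ K hK).trans ?_
    have : 0 ≤ sSup S := Real.sSup_nonneg fun r hr => hr.1
    rw [inscribedDiam, ← hS]
    exact mul_le_mul_of_nonneg_right (by linarith [le_abs_self σ]) (by positivity)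
  have h2 : 𝒯.meshSize < (4 * (|σ| + 1) * (|ρ| + 1)) * sSup S := by
    have h3 := hle K hK
    have h5 : |ρ| * Metric.diam (convexHull ℝ (K : Set Plane)) <
        (|ρ| + 1) * Metric.diam (convexHull ℝ (K : Set Plane)) := by linarith
    have h6 := mul_le_mul_of_nonneg_left h1 (show 0 ≤ |ρ| + 1 by positivity)
    have h7 : 0 ≤ (|ρ| + 1) * ((|σ| + 1) * (2 * sSup S)) := by
      have : 0 ≤ sSup S := Real.sSup_nonneg fun r hr => hr.1
      positivity
    linarith
  have h3 : 1 / (4 * (|σ| + 1) * (|ρ| + 1)) * 𝒯.meshSize < sSup S := by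
    rw [one_div, inv_mul_lt_iff₀ (by positivity)]
    exact h2
  obtain ⟨r, ⟨-, c, hc⟩, hr⟩ := exists_lt_of_lt_csSup hne h3
  exact ⟨c, Metric.isOpen_ball.subset_interior_iff.2
    ((Metric.ball_subset_closedBall.trans (Metric.closedBall_subset_closedBall hr.le)).trans hc)⟩

/-! ### Areas, valences and affine functions on regular meshes -/

section Regular

variable {𝒯} {ϑ : ℝ}

theorem IsRegular.radius_pos (hreg : 𝒯.IsRegular ϑ) : 0 < ϑ * 𝒯.meshSize := mul_pos hreg.pos hreg.meshSize_pos

theorem IsRegular.le_measureReal_cell (hreg : 𝒯.IsRegular ϑ) {K : Finset Plane} (hK : K ∈ 𝒯.triangles) :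
    Real.pi * (ϑ * 𝒯.meshSize) ^ 2 ≤ volume.real (cell K) := by
  obtain ⟨c, hc⟩ := hreg.exists_ball K hK
  rw [← measureReal_ball_plane c hreg.radius_pos.le]
  exact measureReal_mono hc (((isCompact_convexHull K).measure_lt_top.trans_le' (by
    rw [volume_cell])).ne)

theorem IsRegular.measureReal_convexHull_le (hreg : 𝒯.IsRegular ϑ) {K : Finset Plane} (hK : K ∈ 𝒯.triangles) :
    volume.real (convexHull ℝ (K : Set Plane)) ≤ Real.pi * 𝒯.meshSize ^ 2 := by
  obtain ⟨x, hx⟩ := Finset.card_pos.1 (by rw [𝒯.card_eq_three K hK]; norm_num : 0 < K.card)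
  rw [← measureReal_closedBall_plane x hreg.meshSize_pos.le]
  refine measureReal_mono (fun y hy => ?_) measure_closedBall_lt_top.ne
  exact 𝒯.dist_le_meshSize hK hy (subset_convexHull ℝ _ hx)

/-- Area packing: the cells at Z are disjoint, lie in the disc of radius h about Z and have area at
least π(ϑh)². So at most 1/ϑ² triangles meet at Z, each with three vertices. -/
theorem IsRegular.card_adj_le (hreg : 𝒯.IsRegular ϑ) (Z : Plane) : (𝒯.adj Z).card ≤ ⌈3 / ϑ ^ 2⌉₊ := by
  classical
  set T := 𝒯.triangles.filter fun K => Z ∈ K with hT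
  have hsub : 𝒯.adj Z ⊆ T.biUnion id := fun Z' hZ' => by
    obtain ⟨-, K, hK, hZ, hZK⟩ := 𝒯.mem_adj.1 hZ'
    exact Finset.mem_biUnion.2 ⟨K, Finset.mem_filter.2 ⟨hK, hZ⟩, hZK⟩
  have hcard : (𝒯.adj Z).card ≤ T.card * 3 :=
    (Finset.card_le_card hsub).trans (Finset.card_biUnion_le_card_mul _ _ _ fun K hK =>
      (𝒯.card_eq_three K (Finset.mem_filter.1 hK).1).le)
  have hvol : (T.card : ℝ) * (Real.pi * (ϑ * 𝒯.meshSize) ^ 2) ≤ Real.pi * 𝒯.meshSize ^ 2 := by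
    rw [← measureReal_closedBall_plane Z hreg.meshSize_pos.le, ← nsmul_eq_mul]
    have h1 : T.card • (Real.pi * (ϑ * 𝒯.meshSize) ^ 2) ≤ ∑ K ∈ T, volume.real (cell K) :=
      Finset.card_nsmul_le_sum _ _ _ fun K hK =>
        hreg.le_measureReal_cell (Finset.mem_filter.1 hK).1
    have hfin : ∀ K : Finset Plane, volume (cell K) ≠ ⊤ := fun K => by
      rw [volume_cell]; exact (isCompact_convexHull K).measure_lt_top.ne
    rw [← measureReal_biUnion_finset (fun K hK K' hK' h => 𝒯.disjoint_cell
      (Finset.mem_filter.1 hK).1 (Finset.mem_filter.1 hK').1 h)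
      (fun K _ => (isOpen_cell K).measurableSet) (fun K _ => hfin K)] at h1
    refine h1.trans (measureReal_mono ?_ measure_closedBall_lt_top.ne)
    refine iUnion₂_subset fun K hK y hy => ?_
    exact 𝒯.dist_le_meshSize (Finset.mem_filter.1 hK).1 (cell_subset_convexHull K hy)
      (subset_convexHull ℝ _ (Finset.mem_filter.1 hK).2)
  have h3 : (T.card : ℝ) * ϑ ^ 2 ≤ 1 := by
    have h0 : 0 < Real.pi * 𝒯.meshSize ^ 2 := mul_pos Real.pi_pos (pow_pos hreg.meshSize_pos 2)
    refine le_of_mul_le_mul_right ?_ h0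
    linarith
  have h4 : ((𝒯.adj Z).card : ℝ) ≤ 3 / ϑ ^ 2 := by
    rw [le_div_iff₀ (pow_pos hreg.pos 2)]
    have : ((𝒯.adj Z).card : ℝ) ≤ T.card * 3 := by exact_mod_cast hcard
    have := mul_le_mul_of_nonneg_right this (sq_nonneg ϑ)
    linarith
  exact_mod_cast h4.trans (Nat.le_ceil _)

/-- Nodal values and the gradient of an affine function are controlled by its `L²` norm. -/
theorem IsRegular.affine_le_setIntegral (hreg : 𝒯.IsRegular ϑ) {K : Finset Plane} (hK : K ∈ 𝒯.triangles) (g : Plane)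
    (a : ℝ) : ∃ m : ℝ, 0 ≤ m ∧
      Real.pi * (ϑ * 𝒯.meshSize / 4) ^ 2 * m ^ 2 ≤ ∫ x in cell K, (inner ℝ g x + a) ^ 2 ∧
      ‖g‖ * 𝒯.meshSize ≤ 4 / ϑ * m ∧ ∀ Z ∈ K, |inner ℝ g Z + a| ≤ 4 / ϑ * m := by
  obtain ⟨c, hc⟩ := hreg.exists_ball K hK
  have hϑ := hreg.pos
  have hϑ1 := hreg.le_one
  have hh := hreg.meshSize_pos
  set r := ϑ * 𝒯.meshSize with hr
  have hr0 : 0 < r := hreg.radius_pos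
  -- From the centre of the inscribed disc, move by r/2 in the direction in which the modulus of the
  -- affine function grows. On the disc of radius r/4 there, the modulus is at least its value at c
  -- plus ‖g‖(r/2 - r/4).
  refine ⟨|inner ℝ g c + a| + ‖g‖ * (r / 4), by positivity, ?_, ?_, fun Z hZ => ?_⟩
  · obtain ⟨s, hs, hs'⟩ : ∃ s : ℝ, |s| = 1 ∧ s * (inner ℝ g c + a) = |inner ℝ g c + a| := by
      rcases le_total 0 (inner ℝ g c + a) with h | h
      · exact ⟨1, by simp, by rw [abs_of_nonneg h, one_mul]⟩
      · exact ⟨-1, by simp, by rw [abs_of_nonpos h]; ring⟩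
    have hs2 : s * s = 1 := by rw [← abs_mul_abs_self, hs, one_mul]
    set c' := c + (s * (r / 2)) • dir g with hc'
    have hsub : Metric.ball c' (r / 4) ⊆ cell K := by
      refine (Metric.ball_subset_ball' ?_).trans hc
      rw [hc', dist_eq_norm, add_sub_cancel_left, norm_smul, norm_mul, Real.norm_eq_abs s, hs,
        Real.norm_of_nonneg (half_pos hr0).le]
      have := norm_dir_le g
      nlinarith
    have hlow : ∀ x ∈ Metric.ball c' (r / 4),
        (|inner ℝ g c + a| + ‖g‖ * (r / 4)) ^ 2 ≤ (inner ℝ g x + a) ^ 2 := fun x hx => by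
      have h1 : (inner ℝ g x + a) ^ 2 = (s * (inner ℝ g x + a)) ^ 2 := by
        rw [mul_pow, sq s, hs2, one_mul]
      rw [h1]
      refine pow_le_pow_left₀ (by positivity) ?_ 2
      have h2 : s * (inner ℝ g x + a) = s * (inner ℝ g c + a) + s * s * (r / 2) * ‖g‖
          + s * inner ℝ g (x - c') := by
        rw [hc', inner_sub_right, inner_add_right, inner_smul_right, inner_dir]; ring
      have h3 : |s * inner ℝ g (x - c')| ≤ ‖g‖ * (r / 4) := by
        rw [abs_mul, hs, one_mul]
        refine (abs_real_inner_le_norm _ _).trans ?_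
        gcongr
        exact (mem_ball_iff_norm.1 hx).le
      rw [h2, hs', hs2]
      have := neg_le_of_abs_le h3
      linarith
    have hint : IntegrableOn (fun x => (inner ℝ g x + a) ^ 2) (cell K) := by
      have : Continuous fun x : Plane => (inner ℝ g x + a) ^ 2 := by fun_prop
      exact (this.continuousOn.integrableOn_compact (isCompact_convexHull K)).mono_set
        (cell_subset_convexHull K)
    calc _ = ∫ _ in Metric.ball c' (r / 4), (|inner ℝ g c + a| + ‖g‖ * (r / 4)) ^ 2 := by
          rw [setIntegral_const, measureReal_ball_plane _ (by positivity), smul_eq_mul]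
      _ ≤ ∫ x in Metric.ball c' (r / 4), (inner ℝ g x + a) ^ 2 :=
          setIntegral_mono_on (integrableOn_const measure_ball_lt_top.ne) (hint.mono_set hsub)
            measurableSet_ball hlow
      _ ≤ _ := setIntegral_mono_set hint (ae_of_all _ fun x => sq_nonneg _)
          (LE.le.eventuallyLE hsub)
  · have : 4 / ϑ * (|inner ℝ g c + a| + ‖g‖ * (r / 4)) =
        4 / ϑ * |inner ℝ g c + a| + ‖g‖ * 𝒯.meshSize := by rw [hr]; field_simp
    rw [this]
    exact le_add_of_nonneg_left (by positivity)
  · have h1 : inner ℝ g Z + a = (inner ℝ g c + a) + inner ℝ g (Z - c) := by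
      rw [inner_sub_right]; ring
    have h2 : |inner ℝ g (Z - c)| ≤ ‖g‖ * 𝒯.meshSize := by
      refine (abs_real_inner_le_norm _ _).trans ?_
      gcongr
      rw [← dist_eq_norm]
      exact 𝒯.dist_le_meshSize hK (subset_convexHull ℝ _ hZ)
        (cell_subset_convexHull K (hc (Metric.mem_ball_self hr0)))
    have h3 : |inner ℝ g c + a| ≤ 4 / ϑ * |inner ℝ g c + a| := by
      refine le_mul_of_one_le_left (abs_nonneg _) ?_
      rw [le_div_iff₀ hϑ]; linarith
    have : 4 / ϑ * (|inner ℝ g c + a| + ‖g‖ * (r / 4)) =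
        4 / ϑ * |inner ℝ g c + a| + ‖g‖ * 𝒯.meshSize := by rw [hr]; field_simp
    rw [this, h1]
    exact (abs_add_le _ _).trans (add_le_add h3 h2)

end Regular

/-! ### Hat functions -/

theorem hat_cases (Z x : Plane) : 𝒯.hat Z x = 0 ∨
    ∃ K ∈ 𝒯.triangles, Z ∈ K ∧ ∃ w, IsBarycentric K w x ∧ w Z = 𝒯.hat Z x := by
  unfold hat
  split_ifs with H
  · exact Or.inr H.choose_spec
  · exact Or.inl rfl

theorem hat_nonneg (Z x : Plane) : 0 ≤ 𝒯.hat Z x := by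
  rcases 𝒯.hat_cases Z x with h | ⟨K, -, hZ, w, hw, hwZ⟩
  · exact h.ge
  · rw [← hwZ]; exact hw.1 Z hZ

theorem hat_le_one (Z x : Plane) : 𝒯.hat Z x ≤ 1 := by
  rcases 𝒯.hat_cases Z x with h | ⟨K, -, hZ, w, hw, hwZ⟩
  · rw [h]; exact zero_le_one
  · rw [← hwZ, ← hw.2.1]
    exact Finset.single_le_sum (fun y hy => hw.1 y hy) hZ

theorem exists_of_hat_ne_zero {Z x : Plane} (h : 𝒯.hat Z x ≠ 0) :
    ∃ K ∈ 𝒯.triangles, Z ∈ K ∧ x ∈ convexHull ℝ (K : Set Plane) := by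
  obtain ⟨K, hK, hZ, w, hw, -⟩ := (𝒯.hat_cases Z x).resolve_left h
  exact ⟨K, hK, hZ, Finset.mem_convexHull'.2 ⟨w, hw⟩⟩

theorem hat_eq_zero_of_notMem {K : Finset Plane} (hK : K ∈ 𝒯.triangles) {Z x : Plane}
    (hx : x ∈ cell K) (hZ : Z ∉ K) : 𝒯.hat Z x = 0 := by
  by_contra h
  obtain ⟨K', hK', hZ', hx'⟩ := 𝒯.exists_of_hat_ne_zero h
  exact hZ (𝒯.eq_of_mem_cell hK hK' hx hx' ▸ hZ')

theorem hat_eq_zero_of_notMem_closedBall {Z x : Plane}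
    (hx : x ∉ Metric.closedBall Z 𝒯.meshSize) : 𝒯.hat Z x = 0 := by
  by_contra h
  obtain ⟨K, hK, hZ, hx'⟩ := 𝒯.exists_of_hat_ne_zero h
  exact hx (𝒯.dist_le_meshSize hK hx' (subset_convexHull ℝ _ hZ))

/-- A point of a cell lies in no other triangle, so the choice in the definition of the hat function
is forced. Its behaviour on edges, a null set, never matters. -/
theorem exists_hat_eqOn {K : Finset Plane} (hK : K ∈ 𝒯.triangles) (Z : Plane) :
    ∃ (g : Plane) (a : ℝ), ∀ x ∈ cell K, 𝒯.hat Z x = inner ℝ g x + a := by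
  by_cases hZ : Z ∈ K
  · obtain ⟨g, a, h1, h0⟩ := exists_coordinate (𝒯.card_eq_three K hK) (𝒯.affineIndependent K hK) hZ
    have key : ∀ {w : Plane → ℝ} {x : Plane}, IsBarycentric K w x → inner ℝ g x + a = w Z :=
      fun {w x} hw => by
        rw [inner_add_const_sum hw.2.1 hw.2.2, Finset.sum_eq_single_of_mem Z hZ, h1, mul_one]
        exact fun y hy hne => by rw [h0 y hy hne, mul_zero]
    refine ⟨g, a, fun x hx => ?_⟩
    have H : ∃ t : ℝ, ∃ K ∈ 𝒯.triangles, Z ∈ K ∧ ∃ w, IsBarycentric K w x ∧ w Z = t := by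
      obtain ⟨w, hw⟩ := Finset.mem_convexHull'.1 (cell_subset_convexHull K hx)
      exact ⟨_, K, hK, hZ, w, hw, rfl⟩
    obtain ⟨K', hK', hZ', w, hw, hwZ⟩ := H.choose_spec
    have : 𝒯.hat Z x = H.choose := dif_pos H
    rw [this, ← hwZ]
    obtain rfl := 𝒯.eq_of_mem_cell hK hK' hx (Finset.mem_convexHull'.2 ⟨w, hw⟩)
    exact (key hw).symm
  · exact ⟨0, 0, fun x hx => by simp [𝒯.hat_eq_zero_of_notMem hK hx hZ]⟩

end Triangulation

theorem hasGradientAt_inner_add_const {f : Plane → ℝ} {U : Set Plane} (hU : IsOpen U) {g : Plane}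
    {a : ℝ} (hf : ∀ x ∈ U, f x = inner ℝ g x + a) {x : Plane} (hx : x ∈ U) :
    HasGradientAt f g x := by
  have h : HasFDerivAt (fun x : Plane => inner ℝ g x + a) (innerSL ℝ g) x :=
    ((innerSL ℝ g).hasFDerivAt (x := x)).add_const a
  refine hasGradientAt_iff_hasFDerivAt.2 (h.congr_of_eventuallyEq ?_)
  filter_upwards [hU.mem_nhds hx] with y hy using hf y hy

namespace Triangulation

variable {Ω : Set Plane} {𝒯 : Triangulation Ω} {ϑ : ℝ}

/-- The values lie in [0, 1]. Two points at distance r in the inscribed disc, along the gradient,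
have values differing by r‖g‖. -/
theorem IsRegular.norm_gradient_hat_le (hreg : 𝒯.IsRegular ϑ) {K : Finset Plane}
    (hK : K ∈ 𝒯.triangles) (Z : Plane) {x : Plane} (hx : x ∈ cell K) :
    ‖gradient (𝒯.hat Z) x‖ ≤ 1 / (ϑ * 𝒯.meshSize) := by
  obtain ⟨g, a, hg⟩ := 𝒯.exists_hat_eqOn hK Z
  rw [(hasGradientAt_inner_add_const (isOpen_cell K) hg hx).gradient]
  obtain ⟨c, hc⟩ := hreg.exists_ball K hK
  have hr := hreg.radius_pos
  set r := ϑ * 𝒯.meshSize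
  have hmem : ∀ s : ℝ, |s| = 1 → c + (s * (r / 2)) • dir g ∈ cell K := fun s hs => hc <| by
    rw [Metric.mem_ball, dist_eq_norm, add_sub_cancel_left, norm_smul, norm_mul,
      Real.norm_eq_abs s, hs, Real.norm_of_nonneg (half_pos hr).le]
    have := norm_dir_le g
    nlinarith
  have h1 := 𝒯.hat_le_one Z (c + (1 * (r / 2)) • dir g)
  have h2 := 𝒯.hat_nonneg Z (c + (-1 * (r / 2)) • dir g)
  rw [hg _ (hmem 1 (by simp)), inner_add_right, inner_smul_right, inner_dir] at h1
  rw [hg _ (hmem (-1) (by simp)), inner_add_right, inner_smul_right, inner_dir] at h2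
  rw [le_div_iff₀ hr]
  linarith

theorem IsRegular.gradient_hat_eq_zero {K : Finset Plane}
    (hK : K ∈ 𝒯.triangles) {Z x : Plane} (hx : x ∈ cell K) (hZ : Z ∉ K) :
    gradient (𝒯.hat Z) x = 0 :=
  (hasGradientAt_inner_add_const (isOpen_cell K) (g := 0) (a := 0) (fun y hy => by
    simp [𝒯.hat_eq_zero_of_notMem hK hy hZ]) hx).gradient

/-! ### Entries of the mass and convection matrices -/

theorem mass_comm (Z Z' : Plane) : 𝒯.mass Z' Z = 𝒯.mass Z Z' := by
  simp only [mass, ip, mul_comm]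

theorem mass_nonneg (Z Z' : Plane) : 0 ≤ 𝒯.mass Z Z' :=
  integral_nonneg fun x => mul_nonneg (𝒯.hat_nonneg Z x) (𝒯.hat_nonneg Z' x)

/-- Measurability of f is not needed, since the integral of a non-integrable function is 0. -/
theorem abs_setIntegral_le_of_ball {f : Plane → ℝ} {c : Plane} {r M : ℝ} (hr : 0 ≤ r)
    (hM : 0 ≤ M) (hf : ∀ᵐ x ∂volume.restrict Ω, |f x| ≤ M)
    (h0 : ∀ x ∉ Metric.closedBall c r, f x = 0) : |∫ x in Ω, f x| ≤ M * (Real.pi * r ^ 2) := by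
  have hint : Integrable ((Metric.closedBall c r).indicator fun _ => M) (volume.restrict Ω) :=
    (((integrable_indicator_iff measurableSet_closedBall).2
      (integrableOn_const measure_closedBall_lt_top.ne))).restrict
  rw [← Real.norm_eq_abs]
  refine (norm_integral_le_of_norm_le hint ?_).trans ?_
  · filter_upwards [hf] with x hx
    by_cases h : x ∈ Metric.closedBall c r
    · rw [indicator_of_mem h]; exact hx
    · rw [indicator_of_notMem h, h0 x h, norm_zero]
  · rw [integral_indicator measurableSet_closedBall, setIntegral_const, smul_eq_mul, mul_comm,
      ← measureReal_closedBall_plane c hr]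
    refine mul_le_mul_of_nonneg_left ?_ hM
    rw [measureReal_def, measureReal_def]
    exact ENNReal.toReal_mono measure_closedBall_lt_top.ne (Measure.restrict_apply_le _ _)

theorem IsRegular.mass_le (hreg : 𝒯.IsRegular ϑ) (Z Z' : Plane) :
    |𝒯.mass Z Z'| ≤ Real.pi * 𝒯.meshSize ^ 2 := by
  rw [← one_mul (Real.pi * _)]
  refine abs_setIntegral_le_of_ball (c := Z) hreg.meshSize_pos.le zero_le_one
    (ae_of_all _ fun x => ?_) fun x hx => by rw [𝒯.hat_eq_zero_of_notMem_closedBall hx, zero_mul]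
  rw [abs_mul, abs_of_nonneg (𝒯.hat_nonneg _ _), abs_of_nonneg (𝒯.hat_nonneg _ _)]
  exact mul_le_one₀ (𝒯.hat_le_one _ _) (𝒯.hat_nonneg _ _) (𝒯.hat_le_one _ _)

/-- Support of area O(h²) times a gradient of size O(1/h): one order less than the mass entries. The
time step k, which multiplies these terms, makes up for it. -/
theorem IsRegular.abs_conv_le (hreg : 𝒯.IsRegular ϑ) (hΩ : IsConvexPolygon Ω) {b : Plane → Plane}
    {B : ℝ} (hB : 0 ≤ B) (hb : ∀ᵐ x ∂volume.restrict Ω, ‖b x‖ ≤ B) (Z Z' : Plane) :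
    |𝒯.conv b Z Z'| ≤ B * Real.pi / ϑ * 𝒯.meshSize := by
  have hr := hreg.radius_pos
  have h := abs_setIntegral_le_of_ball (Ω := Ω)
    (f := fun x => inner ℝ (b x) (gradient (𝒯.hat Z') x) * 𝒯.hat Z x) (c := Z)
    (M := B * (1 / (ϑ * 𝒯.meshSize))) hreg.meshSize_pos.le (by positivity) (by
      filter_upwards [hb, 𝒯.ae_mem_cell hΩ] with x hx ⟨K, hK, hxK⟩
      rw [abs_mul, abs_of_nonneg (𝒯.hat_nonneg _ _)]
      refine (mul_le_of_le_one_right (abs_nonneg _) (𝒯.hat_le_one _ _)).trans ?_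
      refine (abs_real_inner_le_norm _ _).trans ?_
      exact mul_le_mul hx (hreg.norm_gradient_hat_le hK Z' hxK) (norm_nonneg _) hB)
    fun x hx => by rw [𝒯.hat_eq_zero_of_notMem_closedBall hx, mul_zero]
  refine h.trans_eq ?_
  have := hreg.pos.ne'
  have := hreg.meshSize_pos.ne'
  field_simp

theorem notMem_or_notMem_of_notMem_adj {Z Z' : Plane} (hne : Z' ≠ Z) (h : Z' ∉ 𝒯.adj Z)
    {K : Finset Plane} (hK : K ∈ 𝒯.triangles) : Z ∉ K ∨ Z' ∉ K := by
  by_contra! h'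
  exact h (𝒯.mem_adj.2 ⟨hne, K, hK, h'.1, h'.2⟩)

theorem mass_eq_zero (hΩ : IsConvexPolygon Ω) {Z Z' : Plane} (hne : Z' ≠ Z) (h : Z' ∉ 𝒯.adj Z) :
    𝒯.mass Z Z' = 0 := by
  refine integral_eq_zero_of_ae ?_
  filter_upwards [𝒯.ae_mem_cell hΩ] with x ⟨K, hK, hx⟩
  rcases notMem_or_notMem_of_notMem_adj hne h hK with h | h
  · rw [𝒯.hat_eq_zero_of_notMem hK hx h, zero_mul]; rfl
  · rw [𝒯.hat_eq_zero_of_notMem hK hx h, mul_zero]; rfl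

theorem conv_eq_zero (hΩ : IsConvexPolygon Ω) (b : Plane → Plane) {Z Z' : Plane} (hne : Z' ≠ Z)
    (h : Z' ∉ 𝒯.adj Z) : 𝒯.conv b Z Z' = 0 := by
  refine integral_eq_zero_of_ae ?_
  filter_upwards [𝒯.ae_mem_cell hΩ] with x ⟨K, hK, hx⟩
  rcases notMem_or_notMem_of_notMem_adj hne h hK with h | h
  · rw [𝒯.hat_eq_zero_of_notMem hK hx h, mul_zero]; rfl
  · rw [IsRegular.gradient_hat_eq_zero hK hx h, inner_zero_right, zero_mul]; rfl

theorem isEdgeCoef_mass (hΩ : IsConvexPolygon Ω) : 𝒯.IsEdgeCoef 𝒯.mass :=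
  ⟨mass_comm, fun _ _ _ _ hne h => mass_eq_zero hΩ hne h⟩

theorem isEdgeCoef_diff (hΩ : IsConvexPolygon Ω) (b : Plane → Plane) :
    𝒯.IsEdgeCoef (𝒯.diff b) := by
  refine ⟨fun Z Z' => ?_, fun Z _ Z' _ hne h => ?_⟩
  · simp only [diff]
    rw [min_assoc, min_comm, min_comm (0 : ℝ)]
  · simp [diff, conv_eq_zero hΩ b hne h, conv_eq_zero hΩ b hne.symm (mt 𝒯.mem_adj_comm.2 h)]

theorem isEdgeCoef_diffHat (hΩ : IsConvexPolygon Ω) (b : Plane → Plane) :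
    𝒯.IsEdgeCoef (𝒯.diffHat b) := by
  refine ⟨fun Z Z' => ?_, fun Z _ Z' _ hne h => ?_⟩
  · simp only [diffHat]
    rw [max_assoc, max_comm, max_comm (0 : ℝ)]
  · simp [diffHat, conv_eq_zero hΩ b hne h, conv_eq_zero hΩ b hne.symm (mt 𝒯.mem_adj_comm.2 h)]

theorem diff_nonpos (b : Plane → Plane) (Z Z' : Plane) : 𝒯.diff b Z Z' ≤ 0 :=
  (min_le_left _ _).trans (min_le_right _ _)

theorem diffHat_nonneg (b : Plane → Plane) (Z Z' : Plane) : 0 ≤ 𝒯.diffHat b Z Z' :=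
  (le_max_right _ _).trans (le_max_left _ _)

theorem abs_diff_le {b : Plane → Plane} {M : ℝ} (hM : ∀ Z Z', |𝒯.conv b Z Z'| ≤ M)
    (Z Z' : Plane) : |𝒯.diff b Z Z'| ≤ M := by
  rw [abs_of_nonpos (diff_nonpos b Z Z'), neg_le, diff]
  have h1 := abs_le.1 (hM Z Z')
  have h2 := abs_le.1 (hM Z' Z)
  exact le_min (le_min (by linarith) (by linarith)) (by linarith)

theorem abs_diffHat_le {b : Plane → Plane} {M : ℝ} (hM : ∀ Z Z', |𝒯.conv b Z Z'| ≤ M)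
    (Z Z' : Plane) : |𝒯.diffHat b Z Z'| ≤ M := by
  rw [abs_of_nonneg (diffHat_nonneg b Z Z'), diffHat]
  have h1 := abs_le.1 (hM Z Z')
  have h2 := abs_le.1 (hM Z' Z)
  exact max_le (max_le (by linarith) (by linarith)) (by linarith)

end Triangulation

end

end AFC

namespace AFC

noncomputable section

/-! ### Divergence-free fields and Lipschitz functions -/

theorem measurable_gradient (f : Plane → ℝ) : Measurable (gradient f) :=
  (InnerProductSpace.toDual ℝ Plane).symm.continuous.measurable.comp (measurable_fderiv ℝ f)

theorem norm_gradient_le_of_lipschitz {f : Plane → ℝ} {C : NNReal} (hf : LipschitzWith C f)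
    (x : Plane) : ‖gradient f x‖ ≤ C := by
  rw [gradient, LinearIsometryEquiv.norm_map]
  exact norm_fderiv_le_of_lipschitz ℝ hf

/-- Dilation about an interior point followed by mollification turns a continuous function that
vanishes outside a convex domain into a test function; increments are averaged. -/
theorem exists_isTestFunction {Ω : Set Plane} (hΩ : IsConvexPolygon Ω) {x₀ : Plane} (hx₀ : x₀ ∈ Ω)
    {φ : Plane → ℝ} (hφ : Continuous φ) (h0 : ∀ x ∉ Ω, φ x = 0) {s ε : ℝ} (hs : 1 < s)
    (hε : 0 < ε) : ∃ ψ : Plane → ℝ, IsTestFunction Ω ψ ∧ ∀ (x y : Plane) (c M : ℝ),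
      (∀ t ∈ Metric.ball (0 : Plane) ε,
        |φ (x₀ + s • (y - t - x₀)) - φ (x₀ + s • (x - t - x₀)) - c| ≤ M) →
      |ψ y - ψ x - c| ≤ M := by
  have hs0 : 0 < s := one_pos.trans hs
  obtain ⟨hopen, -, hconv, V, hV⟩ := hΩ
  have hcpt : IsCompact (closure Ω) := by rw [hV]; exact isCompact_convexHull V
  -- Contraction towards an interior point maps the closure to a compact subset of Ω. It contains
  -- the support of the dilated function, so there is room for mollification.
  set K : Set Plane := (fun x => x₀ + s⁻¹ • (x - x₀)) '' closure Ω with hK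
  have hKc : IsCompact K := hcpt.image (by fun_prop)
  have hKΩ : K ⊆ Ω := by
    rintro _ ⟨x, hx, rfl⟩
    have h := hconv.combo_interior_closure_mem_interior (x := x₀) (y := x) (a := 1 - s⁻¹) (b := s⁻¹)
      (by rwa [hopen.interior_eq]) hx (sub_pos.2 (inv_lt_one_of_one_lt₀ hs)) (by positivity)
      (by ring)
    rw [hopen.interior_eq] at h
    convert h using 1
    module
  obtain ⟨δ, hδ, hδΩ⟩ := hKc.exists_cthickening_subset_open hopen hKΩ
  set r := min δ ε
  have hr : 0 < r := lt_min hδ hε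
  let f : ContDiffBump (0 : Plane) := ⟨r / 2, r, half_pos hr, half_lt_self hr⟩
  set g : Plane → ℝ := fun x => φ (x₀ + s • (x - x₀)) with hg
  have hgc : Continuous g := by fun_prop
  set ρ := f.normed volume with hρ
  have hρc : Continuous ρ := f.continuous_normed
  have hρs : HasCompactSupport ρ := f.hasCompactSupport_normed
  have hsuppρ : Function.support ρ = Metric.ball 0 r := f.support_normed_eq
  set ψ := convolution ρ g (ContinuousLinearMap.lsmul ℝ ℝ) volume with hψ
  have hint : ∀ x, Integrable fun t => ρ t * g (x - t) := fun x =>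
    (hρc.mul (hgc.comp (continuous_const.sub continuous_id))).integrable_of_hasCompactSupport
      hρs.mul_right
  have hψx : ∀ x, ψ x = ∫ t, ρ t * g (x - t) := fun x => rfl
  have hsupp : tsupport ψ ⊆ Metric.cthickening δ K := by
    refine closure_minimal ?_ Metric.isClosed_cthickening
    refine (support_convolution_subset _).trans ?_
    rintro _ ⟨t, ht, y, hy, rfl⟩
    rw [hsuppρ, mem_ball_zero_iff] at ht
    have hyK : y ∈ K := by
      have h1 : x₀ + s • (y - x₀) ∈ Ω := by
        by_contra h
        exact hy (h0 _ h)
      refine ⟨_, subset_closure h1, ?_⟩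
      simp [smul_smul, inv_mul_cancel₀ hs0.ne']
    refine Metric.mem_cthickening_of_dist_le _ y _ _ hyK ?_
    rw [dist_eq_norm]
    simpa using ht.le.trans (min_le_left _ _)
  have hcs : HasCompactSupport ψ :=
    hKc.cthickening.of_isClosed_subset (isClosed_tsupport _) hsupp
  refine ⟨ψ, ⟨hρs.contDiff_convolution_left _ f.contDiff_normed hgc.locallyIntegrable, hcs,
    hsupp.trans hδΩ⟩, fun x y c M hM => ?_⟩
  have hρ1 : ∫ t, ρ t = 1 := f.integral_normed
  have hρi : Integrable ρ := hρc.integrable_of_hasCompactSupport hρs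
  -- The kernel has total mass one, so the constant c can be placed under the integral.
  have key : ψ y - ψ x - c = ∫ t, ρ t * (g (y - t) - g (x - t) - c) := by
    have hint2 : Integrable fun t => ρ t * g (y - t) - ρ t * g (x - t) := (hint y).sub (hint x)
    calc ψ y - ψ x - c = (∫ t, ρ t * g (y - t) - ρ t * g (x - t)) - ∫ t, ρ t * c := by
          rw [hψx, hψx, ← integral_sub (hint y) (hint x), integral_mul_const, hρ1, one_mul]
      _ = ∫ t, ρ t * (g (y - t) - g (x - t) - c) := by
          rw [← integral_sub hint2 (hρi.mul_const c)]
          exact integral_congr_ae (ae_of_all _ fun t => by ring)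
  rw [key, ← Real.norm_eq_abs, ← one_mul M, ← hρ1, ← integral_mul_const]
  refine norm_integral_le_of_norm_le (hρi.mul_const M) (ae_of_all _ fun t => ?_)
  rw [norm_mul, Real.norm_of_nonneg (f.nonneg_normed t)]
  by_cases ht : t ∈ Metric.ball (0 : Plane) r
  · exact mul_le_mul_of_nonneg_left (hM t (Metric.ball_subset_ball (min_le_right _ _) ht))
      (f.nonneg_normed t)
  · rw [← hsuppρ, Function.notMem_support] at ht
    change ρ t * _ ≤ ρ t * M
    rw [ht, zero_mul, zero_mul]

/-- The weak divergence condition is extended to Lipschitz functions vanishing outside Ω. Dilation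
by 1 + u n and mollification at scale u n give test functions with gradients bounded by 2C that
converge wherever φ is C¹; dominated convergence finishes. -/
theorem integral_inner_gradient_eq_zero {Ω : Set Plane} (hΩ : IsConvexPolygon Ω)
    {b : Plane → Plane} (hb : IsDivFree Ω b)
    (hbm : AEStronglyMeasurable b (volume.restrict Ω)) {B : ℝ}
    (hB : ∀ᵐ x ∂volume.restrict Ω, ‖b x‖ ≤ B) {φ : Plane → ℝ} {C : NNReal}
    (hφ : LipschitzWith C φ) (h0 : ∀ x ∉ Ω, φ x = 0)
    (hd : ∀ᵐ x ∂volume.restrict Ω, ContDiffAt ℝ 1 φ x) :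
    ∫ x in Ω, inner ℝ (b x) (gradient φ x) = 0 := by
  obtain ⟨x₀, hx₀⟩ := hΩ.2.1
  set u : ℕ → ℝ := fun n => 1 / ((n : ℝ) + 1) with hu
  have hu0 : ∀ n, 0 < u n := fun n => by positivity
  have hu1 : ∀ n, u n ≤ 1 := fun n => by
    rw [hu, div_le_one (by positivity)]
    linarith [Nat.cast_nonneg (α := ℝ) n]
  have hlim : Tendsto u atTop (𝓝 0) := tendsto_one_div_add_atTop_nhds_zero_nat
  choose ψ hψ hψ' using fun n : ℕ => exists_isTestFunction hΩ hx₀ hφ.continuous h0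
    (s := 1 + u n) (by linarith [hu0 n]) (hu0 n)
  have hdiff : ∀ n x, DifferentiableAt ℝ (ψ n) x := fun n x =>
    ((hψ n).1.differentiable (by simp)) x
  have hpt : ∀ (n : ℕ) (x t y : Plane), (x₀ + (1 + u n) • (y - t - x₀))
      - (x₀ + (1 + u n) • (x - t - x₀)) = (1 + u n) • (y - x) := fun n x t y => by module
  have hbound : ∀ n x, ‖gradient (ψ n) x‖ ≤ 2 * C := fun n x => by
    rw [gradient, LinearIsometryEquiv.norm_map]
    refine (hdiff n x).hasFDerivAt.le_of_lip' (by positivity) (Eventually.of_forall fun y => ?_)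
    have := hψ' n x y 0 (2 * C * ‖y - x‖) fun t _ => by
      rw [sub_zero, ← Real.norm_eq_abs]
      refine (hφ.norm_sub_le _ _).trans ?_
      rw [hpt, norm_smul, Real.norm_of_nonneg (by linarith [hu0 n])]
      have := hu1 n
      have h2 : (1 + u n) * ‖y - x‖ ≤ 2 * ‖y - x‖ := by gcongr; linarith
      calc (C : ℝ) * ((1 + u n) * ‖y - x‖) ≤ C * (2 * ‖y - x‖) := by gcongr
        _ = _ := by ring
    simpa using this
  have hconv : ∀ x, ContDiffAt ℝ 1 φ x →
      Tendsto (fun n => gradient (ψ n) x) atTop (𝓝 (gradient φ x)) := fun x hx => by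
    -- Strict differentiability is needed: the averaged increments of φ are based at points near x,
    -- not at x.
    have hst := hx.hasStrictFDerivAt one_ne_zero
    set l := fderiv ℝ φ x
    have hmain : Tendsto (fun n => fderiv ℝ (ψ n) x - (1 + u n) • l) atTop (𝓝 0) := by
      rw [Metric.tendsto_atTop]
      intro η hη
      have h1 := hst.isLittleO.def (show 0 < η / 4 by positivity)
      rw [nhds_prod_eq, Filter.eventually_prod_iff] at h1
      obtain ⟨p₁, hp₁, p₂, hp₂, hp⟩ := h1
      obtain ⟨δ, hδ, hball⟩ := Metric.eventually_nhds_iff_ball.1 (hp₁.and hp₂)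
      have hev : ∀ᶠ n in atTop, u n * (2 + ‖x - x₀‖) < δ / 2 := by
        have := hlim.mul_const (2 + ‖x - x₀‖)
        rw [zero_mul] at this
        exact this.eventually_lt_const (by positivity)
      obtain ⟨n₀, hn₀⟩ := eventually_atTop.1 hev
      refine ⟨n₀, fun n hn => ?_⟩
      have hn' := hn₀ n hn
      have hmem : ∀ y, ‖y - x‖ < δ / 4 → ∀ t ∈ Metric.ball (0 : Plane) (u n),
          x₀ + (1 + u n) • (y - t - x₀) ∈ Metric.ball x δ := fun y hy t ht => by
        rw [mem_ball_zero_iff] at ht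
        rw [mem_ball_iff_norm, show x₀ + (1 + u n) • (y - t - x₀) - x =
          (1 + u n) • (y - x) - (1 + u n) • t + u n • (x - x₀) by module]
        refine (norm_add_le _ _).trans_lt ?_
        have h2 := norm_sub_le ((1 + u n) • (y - x)) ((1 + u n) • t)
        rw [norm_smul, norm_smul, Real.norm_of_nonneg (by linarith [hu0 n])] at h2
        rw [norm_smul, Real.norm_of_nonneg (hu0 n).le]
        have := hu1 n
        have h3 : (1 + u n) * ‖y - x‖ ≤ 2 * ‖y - x‖ := by gcongr; linarith
        have h4 : (1 + u n) * ‖t‖ ≤ 2 * ‖t‖ := by gcongr; linarith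
        linarith
      rw [dist_zero_right]
      refine lt_of_le_of_lt (b := η / 2) ?_ (half_lt_self hη)
      refine ((hdiff n x).hasFDerivAt.sub
        ((1 + u n) • l).hasFDerivAt).le_of_lip' (half_pos hη).le ?_
      filter_upwards [Metric.ball_mem_nhds x (show 0 < δ / 4 by positivity)] with y hy
      rw [mem_ball_iff_norm] at hy
      -- The subtracted constant is the linear part of the dilated increment; the averages then keep
      -- only the small remainder.
      have := hψ' n x y (l ((1 + u n) • (y - x))) (η / 2 * ‖y - x‖) fun t ht => by
        have h5 := hp (hball _ (hmem y hy t ht)).1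
          (hball _ (hmem x (by rw [sub_self, norm_zero]; positivity) t ht)).2
        simp only [hpt, norm_smul, Real.norm_eq_abs] at h5
        refine h5.trans ?_
        rw [abs_of_nonneg (by linarith [hu0 n])]
        have := hu1 n
        have h2 : (1 + u n) * ‖y - x‖ ≤ 2 * ‖y - x‖ := by gcongr; linarith
        calc η / 4 * ((1 + u n) * ‖y - x‖) ≤ η / 4 * (2 * ‖y - x‖) := by gcongr
          _ = _ := by ring
      rw [Real.norm_eq_abs]
      convert this using 2
      simp only [Pi.sub_apply, map_smul, smul_apply, map_sub, smul_eq_mul]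
      ring
    have hlim2 : Tendsto (fun n => (1 + u n) • l) atTop (𝓝 l) := by
      have := (hlim.const_add 1).smul_const l
      simpa using this
    have hfd : Tendsto (fun n => fderiv ℝ (ψ n) x) atTop (𝓝 l) := by
      have := hmain.add hlim2
      simpa using this
    exact ((InnerProductSpace.toDual ℝ Plane).symm.continuous.tendsto l).comp hfd
  have hfin : IsFiniteMeasure (volume.restrict Ω) := by
    obtain ⟨V, hV⟩ := hΩ.2.2.2
    refine ⟨?_⟩
    rw [Measure.restrict_apply_univ]
    refine (measure_mono subset_closure).trans_lt ?_
    rw [hV]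
    exact (isCompact_convexHull V).measure_lt_top
  have hT := tendsto_integral_of_dominated_convergence (μ := volume.restrict Ω)
    (F := fun n x => inner ℝ (b x) (gradient (ψ n) x))
    (f := fun x => inner ℝ (b x) (gradient φ x)) (fun _ => B * (2 * C))
    (fun n => hbm.inner (measurable_gradient (ψ n)).aestronglyMeasurable)
    (integrable_const _) (fun n => by
      filter_upwards [hB] with x hx
      refine (norm_inner_le_norm _ _).trans ?_
      exact mul_le_mul hx (hbound n x) (norm_nonneg _) ((norm_nonneg _).trans hx))
    (by
      filter_upwards [hd] with x hx
      exact tendsto_const_nhds.inner (hconv x hx))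
  refine tendsto_nhds_unique hT ?_
  simp only [hb _ (hψ _)]
  exact tendsto_const_nhds

/-! ### Lipschitz continuity from a closed cover -/

/-- Continuous induction along the segment from x to y: the parameters satisfying the bound form a
closed set, and from each of them one can advance inside some piece. -/
theorem lipschitzWith_of_closed_cover {f : Plane → ℝ} (hf : Continuous f) {ι : Type*} [Finite ι]
    {F : ι → Set Plane} (hF : ∀ i, IsClosed (F i)) (hcov : ∀ x, ∃ i, x ∈ F i) {C : NNReal}
    (hC : ∀ i, LipschitzOnWith C f (F i)) : LipschitzWith C f := by
  refine LipschitzWith.of_dist_le_mul fun y x => ?_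
  set p : ℝ → Plane := fun t => x + t • (y - x) with hp
  have hpc : Continuous p := by fun_prop
  have hpd : ∀ s t, dist (p s) (p t) = |s - t| * dist y x := fun s t => by
    rw [dist_eq_norm, dist_eq_norm, hp]
    simp only [add_sub_add_left_eq_sub, ← sub_smul, norm_smul, Real.norm_eq_abs]
  set S : Set ℝ := {t | dist (f (p t)) (f x) ≤ C * (t * dist y x)} with hS
  have hclosed : IsClosed S := isClosed_le (by fun_prop) (by fun_prop)
  have h0 : (0 : ℝ) ∈ S := by simp [hS, hp]
  have hsub := (hclosed.inter isClosed_Icc).Icc_subset_of_forall_exists_gt (a := 0) (b := 1) h0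
    fun t ht z hz => by
      -- By finiteness one piece is met at parameters arbitrarily close to the right of t; being
      -- closed, it also contains p t.
      obtain ⟨i, hi⟩ : ∃ i, ∃ᶠ s in 𝓝[>] t, p s ∈ F i := by
        by_contra! h
        obtain ⟨s, hs⟩ := (eventually_all.2 h).exists
        obtain ⟨i, hi⟩ := hcov (p s)
        exact hs i hi
      have hti : p t ∈ F i := by
        refine (hF i).mem_of_frequently_of_tendsto hi ?_
        exact (hpc.tendsto t).mono_left nhdsWithin_le_nhds
      obtain ⟨s, hsF, hst, hsz⟩ := (hi.and_eventually (Ioc_mem_nhdsGT hz)).exists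
      refine ⟨s, ?_, hst, hsz⟩
      have h1 := (hC i).dist_le_mul _ hsF _ hti
      rw [hpd, abs_of_pos (sub_pos.2 hst)] at h1
      have h2 : dist (f (p t)) (f x) ≤ C * (t * dist y x) := ht.1
      calc dist (f (p s)) (f x) ≤ C * ((s - t) * dist y x) + C * (t * dist y x) :=
            (dist_triangle _ _ _).trans (add_le_add h1 h2)
        _ = C * (s * dist y x) := by ring
  have h1 : (1 : ℝ) ∈ S := hsub (right_mem_Icc.2 zero_le_one)
  simpa [hS, hp] using h1

end

end AFC

namespace AFC

noncomputable section

/-! ### Finite element functions -/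

theorem IsConvexPolygon.isCompact_closure {Ω : Set Plane} (hΩ : IsConvexPolygon Ω) :
    IsCompact (closure Ω) := by
  obtain ⟨V, hV⟩ := hΩ.2.2.2
  rw [hV]
  exact isCompact_convexHull V

theorem IsConvexPolygon.isFiniteMeasure {Ω : Set Plane} (hΩ : IsConvexPolygon Ω) :
    IsFiniteMeasure (volume.restrict Ω) := by
  refine ⟨?_⟩
  rw [Measure.restrict_apply_univ]
  exact (measure_mono subset_closure).trans_lt hΩ.isCompact_closure.measure_lt_top

namespace Triangulation

variable {Ω : Set Plane} {𝒯 : Triangulation Ω}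

theorem fe_exists_affine (v : 𝒯.fe) {K : Finset Plane} (hK : K ∈ 𝒯.triangles) :
    ∃ (g : Plane) (a : ℝ), ∀ x ∈ convexHull ℝ (K : Set Plane), (v : Plane → ℝ) x = inner ℝ g x + a := by
  obtain ⟨A, hA⟩ := v.2.2.1 K hK
  obtain ⟨g, a, hg⟩ := exists_inner_add_const A
  exact ⟨g, a, fun x hx => (hA hx).trans (hg x)⟩

theorem fe_hasCompactSupport (hΩ : IsConvexPolygon Ω) (v : 𝒯.fe) :
    HasCompactSupport (v : Plane → ℝ) :=
  HasCompactSupport.intro hΩ.isCompact_closure fun x hx =>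
    v.2.2.2 x fun h => hx (subset_closure h)

theorem fe_exists_bound (hΩ : IsConvexPolygon Ω) (v : 𝒯.fe) :
    ∃ M : ℝ, ∀ x, ‖(v : Plane → ℝ) x‖ ≤ M :=
  (fe_hasCompactSupport hΩ v).exists_bound_of_continuous v.2.1

/-- The triangles together with the complement of Ω form a finite closed cover on whose pieces the
function is Lipschitz. -/
theorem fe_exists_lipschitz (hΩ : IsConvexPolygon Ω) (v : 𝒯.fe) :
    ∃ C : NNReal, LipschitzWith C (v : Plane → ℝ) := by
  choose g a hg using fun K : 𝒯.triangles => fe_exists_affine v K.2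
  set C : NNReal := ∑ K, ‖g K‖₊
  refine ⟨C, lipschitzWith_of_closed_cover (ι := Option 𝒯.triangles) v.2.1
    (F := fun o => o.elim Ωᶜ fun K => convexHull ℝ ((K : Finset Plane) : Set Plane)) ?_ ?_ ?_⟩
  · rintro (_ | K)
    · exact hΩ.1.isClosed_compl
    · exact (isCompact_convexHull (K : Finset Plane)).isClosed
  · intro x
    by_cases hx : x ∈ Ω
    · obtain ⟨K, hK, hxK⟩ := 𝒯.exists_mem_convexHull (subset_closure hx)
      exact ⟨some ⟨K, hK⟩, hxK⟩
    · exact ⟨none, hx⟩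
  · rintro (_ | K)
    · refine LipschitzOnWith.of_dist_le_mul fun x hx y hy => ?_
      rw [v.2.2.2 x hx, v.2.2.2 y hy, dist_self]
      positivity
    · refine LipschitzOnWith.of_dist_le_mul fun x hx y hy => ?_
      rw [hg K x hx, hg K y hy, dist_eq_norm, dist_eq_norm, add_sub_add_right_eq_sub,
        ← inner_sub_right]
      refine (norm_inner_le_norm _ _).trans ?_
      gcongr
      exact_mod_cast Finset.single_le_sum (f := fun K => ‖g K‖₊) (fun _ _ => zero_le)
        (Finset.mem_univ K)

theorem fe_contDiffAt (v : 𝒯.fe) {K : Finset Plane} (hK : K ∈ 𝒯.triangles) {x : Plane}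
    (hx : x ∈ cell K) : ContDiffAt ℝ 1 (v : Plane → ℝ) x := by
  obtain ⟨g, a, hg⟩ := fe_exists_affine v hK
  have : ContDiffAt ℝ 1 (fun x : Plane => inner ℝ g x + a) x :=
    (contDiffAt_const.inner ℝ contDiffAt_id).add contDiffAt_const
  refine this.congr_of_eventuallyEq ?_
  filter_upwards [(isOpen_cell K).mem_nhds hx] with y hy using hg y (cell_subset_convexHull K hy)

theorem fe_ae_differentiableAt (hΩ : IsConvexPolygon Ω) (v : 𝒯.fe) :
    ∀ᵐ x ∂volume.restrict Ω, DifferentiableAt ℝ (v : Plane → ℝ) x := by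
  filter_upwards [𝒯.ae_mem_cell hΩ] with x ⟨K, hK, hx⟩
  exact (fe_contDiffAt v hK hx).differentiableAt one_ne_zero

theorem fe_memLp (hΩ : IsConvexPolygon Ω) (v : 𝒯.fe) :
    MemLp (v : Plane → ℝ) 2 (volume.restrict Ω) := by
  have := hΩ.isFiniteMeasure
  obtain ⟨M, hM⟩ := fe_exists_bound hΩ v
  exact MemLp.of_bound v.2.1.aestronglyMeasurable M (ae_of_all _ hM)

theorem fe_gradient_memLp (hΩ : IsConvexPolygon Ω) (v : 𝒯.fe) :
    MemLp (gradient (v : Plane → ℝ)) 2 (volume.restrict Ω) := by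
  have := hΩ.isFiniteMeasure
  obtain ⟨C, hC⟩ := fe_exists_lipschitz hΩ v
  exact MemLp.of_bound (measurable_gradient _).aestronglyMeasurable C
    (ae_of_all _ (norm_gradient_le_of_lipschitz hC))

/-- Equality holds only almost everywhere: where a function is not differentiable, on edges,
`gradient` has the default value 0. -/
theorem fe_gradient_add (hΩ : IsConvexPolygon Ω) (v w : 𝒯.fe) :
    gradient ((v + w : 𝒯.fe) : Plane → ℝ) =ᵐ[volume.restrict Ω]
      gradient (v : Plane → ℝ) + gradient (w : Plane → ℝ) := by
  filter_upwards [fe_ae_differentiableAt hΩ v, fe_ae_differentiableAt hΩ w] with x hv hw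
  simp only [gradient, Pi.add_apply, Submodule.coe_add, fderiv_add hv hw, map_add]

theorem fe_gradient_smul (hΩ : IsConvexPolygon Ω) (c : ℝ) (v : 𝒯.fe) :
    gradient ((c • v : 𝒯.fe) : Plane → ℝ) =ᵐ[volume.restrict Ω]
      c • gradient (v : Plane → ℝ) := by
  filter_upwards [fe_ae_differentiableAt hΩ v] with x hv
  simp [gradient, fderiv_const_smul hv]

/-- The embedding of `S_h` into `L²(Ω)`. -/
def feL2 (hΩ : IsConvexPolygon Ω) : 𝒯.fe →ₗ[ℝ] L2 Ω where
  toFun v := (fe_memLp hΩ v).toLp v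
  map_add' v w := MemLp.toLp_add (fe_memLp hΩ v) (fe_memLp hΩ w)
  map_smul' c v := MemLp.toLp_const_smul c (fe_memLp hΩ v)

/-- The gradient as a map from `S_h` to `L²(Ω)²`. -/
def feGrad (hΩ : IsConvexPolygon Ω) : 𝒯.fe →ₗ[ℝ] Lp Plane 2 (volume.restrict Ω) where
  toFun v := (fe_gradient_memLp hΩ v).toLp _
  map_add' v w := by
    rw [← MemLp.toLp_add, MemLp.toLp_eq_toLp_iff]
    exact fe_gradient_add hΩ v w
  map_smul' c v := by
    rw [RingHom.id_apply, ← MemLp.toLp_const_smul, MemLp.toLp_eq_toLp_iff]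
    exact fe_gradient_smul hΩ c v

theorem coeFn_feL2 (hΩ : IsConvexPolygon Ω) (v : 𝒯.fe) :
    feL2 hΩ v =ᵐ[volume.restrict Ω] (v : Plane → ℝ) :=
  MemLp.coeFn_toLp (fe_memLp hΩ v)

theorem coeFn_feGrad (hΩ : IsConvexPolygon Ω) (v : 𝒯.fe) :
    feGrad hΩ v =ᵐ[volume.restrict Ω] gradient (v : Plane → ℝ) :=
  MemLp.coeFn_toLp (fe_gradient_memLp hΩ v)

theorem inner_eq_ip {f g : L2 Ω} {f' g' : Plane → ℝ} (hf : f =ᵐ[volume.restrict Ω] f')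
    (hg : g =ᵐ[volume.restrict Ω] g') : inner ℝ f g = ip Ω f' g' := by
  rw [L2.inner_def, ip]
  refine integral_congr_ae ?_
  filter_upwards [hf, hg] with x hx hx'
  rw [hx, hx', real_inner_eq_re_inner, RCLike.inner_apply, conj_trivial, mul_comm]
  rfl

theorem ip_eq_inner (hΩ : IsConvexPolygon Ω) (v w : 𝒯.fe) :
    ip Ω v w = inner ℝ (feL2 hΩ v) (feL2 hΩ w) :=
  (inner_eq_ip (coeFn_feL2 hΩ v) (coeFn_feL2 hΩ w)).symm

theorem gradIp_eq_inner (hΩ : IsConvexPolygon Ω) (v w : 𝒯.fe) :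
    gradIp Ω v w = inner ℝ (feGrad hΩ v) (feGrad hΩ w) := by
  rw [L2.inner_def, gradIp]
  refine integral_congr_ae ?_
  filter_upwards [coeFn_feGrad hΩ v, coeFn_feGrad hΩ w] with x hx hx'
  rw [hx, hx']

theorem norm_feL2_sq (hΩ : IsConvexPolygon Ω) (v : 𝒯.fe) :
    ‖feL2 hΩ v‖ ^ 2 = ∑ K ∈ 𝒯.triangles, ∫ x in cell K, (v : Plane → ℝ) x ^ 2 := by
  rw [𝒯.sum_setIntegral_cell hΩ ((fe_memLp hΩ v).integrable_sq), ← real_inner_self_eq_norm_sq,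
    ← ip_eq_inner, ip]
  simp only [sq]

theorem norm_feGrad_sq (hΩ : IsConvexPolygon Ω) (v : 𝒯.fe) :
    ‖feGrad hΩ v‖ ^ 2 = ∑ K ∈ 𝒯.triangles, ∫ x in cell K, ‖gradient (v : Plane → ℝ) x‖ ^ 2 := by
  rw [𝒯.sum_setIntegral_cell hΩ ((fe_gradient_memLp hΩ v).norm.integrable_sq),
    ← real_inner_self_eq_norm_sq, ← gradIp_eq_inner, gradIp]
  simp only [real_inner_self_eq_norm_sq]

theorem fe_eq_zero {v : 𝒯.fe} (h : ∀ Z ∈ 𝒯.nodes, (v : Plane → ℝ) Z = 0) : v = 0 := by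
  refine Subtype.ext (funext fun x => ?_)
  by_cases hx : x ∈ Ω
  · obtain ⟨K, hK, hxK⟩ := 𝒯.exists_mem_convexHull (subset_closure hx)
    obtain ⟨g, a, hg⟩ := fe_exists_affine v hK
    obtain ⟨w, -, hw1, hwx⟩ := Finset.mem_convexHull'.1 hxK
    rw [hg x hxK, inner_add_const_sum hw1 hwx]
    refine Finset.sum_eq_zero fun y hy => ?_
    rw [← hg y (subset_convexHull ℝ _ hy), h y (𝒯.mem_nodes.2 ⟨K, hK, hy⟩), mul_zero]
  · exact v.2.2.2 x hx

instance : FiniteDimensional ℝ 𝒯.fe := by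
  let e : 𝒯.fe →ₗ[ℝ] (𝒯.nodes → ℝ) :=
    { toFun := fun v Z => (v : Plane → ℝ) Z
      map_add' := fun _ _ => rfl
      map_smul' := fun _ _ => rfl }
  refine FiniteDimensional.of_injective e ?_
  rw [← LinearMap.ker_eq_bot, LinearMap.ker_eq_bot']
  exact fun v hv => fe_eq_zero fun Z hZ => congrFun hv ⟨Z, hZ⟩

/-! ### Discrete norms -/

section Regular

variable {ϑ : ℝ}

/-- The constant of the local norm equivalences. -/
def locConst (ϑ : ℝ) : ℝ := 256 / ϑ ^ 4

/-- The local facts from which the inverse inequality, the jump estimate and the bounds for the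
lumped product follow by summation over triangles. -/
theorem IsRegular.fe_local (hreg : 𝒯.IsRegular ϑ) (v : 𝒯.fe) {K : Finset Plane}
    (hK : K ∈ 𝒯.triangles) : ∃ g : Plane,
      (∀ x ∈ cell K, gradient (v : Plane → ℝ) x = g) ∧
      (∀ Z ∈ K, ∀ Z' ∈ K, ((v : Plane → ℝ) Z - (v : Plane → ℝ) Z') ^ 2 ≤ (‖g‖ * 𝒯.meshSize) ^ 2) ∧
      Real.pi * 𝒯.meshSize ^ 2 * (‖g‖ * 𝒯.meshSize) ^ 2 ≤
        locConst ϑ * ∫ x in cell K, (v : Plane → ℝ) x ^ 2 ∧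
      ∀ Z ∈ K, Real.pi * 𝒯.meshSize ^ 2 * (v : Plane → ℝ) Z ^ 2 ≤
        locConst ϑ * ∫ x in cell K, (v : Plane → ℝ) x ^ 2 := by
  obtain ⟨g, a, hg⟩ := fe_exists_affine v hK
  obtain ⟨m, hm, hint, hgm, hZm⟩ := hreg.affine_le_setIntegral hK g a
  have hϑ := hreg.pos
  have hg' : ∀ Z ∈ K, (v : Plane → ℝ) Z = inner ℝ g Z + a := fun Z hZ =>
    hg Z (subset_convexHull ℝ _ hZ)
  have heq : ∫ x in cell K, (inner ℝ g x + a) ^ 2 = ∫ x in cell K, (v : Plane → ℝ) x ^ 2 :=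
    setIntegral_congr_fun (isOpen_cell K).measurableSet fun x hx => by
      simp only [hg x (cell_subset_convexHull K hx)]
  -- `locConst` is a product of two factors (4/ϑ)²: one from the bound on t, one from the disc of
  -- radius ϑh/4.
  have key : ∀ t : ℝ, |t| ≤ 4 / ϑ * m → Real.pi * 𝒯.meshSize ^ 2 * t ^ 2 ≤
      locConst ϑ * ∫ x in cell K, (v : Plane → ℝ) x ^ 2 := fun t ht => by
    have h1 : t ^ 2 ≤ (4 / ϑ * m) ^ 2 := sq_le_sq' (neg_le_of_abs_le ht) (le_of_abs_le ht)
    have hpi := Real.pi_pos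
    calc Real.pi * 𝒯.meshSize ^ 2 * t ^ 2 ≤ Real.pi * 𝒯.meshSize ^ 2 * (4 / ϑ * m) ^ 2 := by gcongr
      _ = locConst ϑ * (Real.pi * (ϑ * 𝒯.meshSize / 4) ^ 2 * m ^ 2) := by
          rw [locConst]; field_simp; ring
      _ ≤ locConst ϑ * ∫ x in cell K, (v : Plane → ℝ) x ^ 2 := by
          rw [← heq]
          exact mul_le_mul_of_nonneg_left hint (by rw [locConst]; positivity)
  refine ⟨g, fun x hx => (hasGradientAt_inner_add_const (isOpen_cell K)
    (fun y hy => hg y (cell_subset_convexHull K hy)) hx).gradient, fun Z hZ Z' hZ' => ?_,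
    key _ ?_, fun Z hZ => key _ ?_⟩
  · rw [hg' Z hZ, hg' Z' hZ', add_sub_add_right_eq_sub, ← inner_sub_right, ← sq_abs]
    refine pow_le_pow_left₀ (abs_nonneg _) ((abs_real_inner_le_norm _ _).trans ?_) 2
    gcongr
    rw [← dist_eq_norm]
    exact 𝒯.dist_le_meshSize hK (subset_convexHull ℝ _ hZ) (subset_convexHull ℝ _ hZ')
  · rwa [abs_of_nonneg (mul_nonneg (norm_nonneg g) hreg.meshSize_pos.le)]
  · rw [hg' Z hZ]; exact hZm Z hZ

/-- The inverse inequality. -/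
theorem IsRegular.inverse_inequality (hreg : 𝒯.IsRegular ϑ) (hΩ : IsConvexPolygon Ω) (v : 𝒯.fe) :
    𝒯.meshSize ^ 2 * ‖feGrad hΩ v‖ ^ 2 ≤ locConst ϑ * ‖feL2 hΩ v‖ ^ 2 := by
  rw [norm_feGrad_sq, norm_feL2_sq, Finset.mul_sum, Finset.mul_sum]
  refine Finset.sum_le_sum fun K hK => ?_
  obtain ⟨g, hg, -, h, -⟩ := hreg.fe_local v hK
  refine le_trans ?_ h
  rw [setIntegral_congr_fun (g := fun _ => ‖g‖ ^ 2) (isOpen_cell K).measurableSet fun x hx => by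
    simp only [hg x hx], setIntegral_const, smul_eq_mul]
  have h1 : volume.real (cell K) ≤ Real.pi * 𝒯.meshSize ^ 2 := by
    rw [measureReal_def, volume_cell]
    exact hreg.measureReal_convexHull_le hK
  calc 𝒯.meshSize ^ 2 * (volume.real (cell K) * ‖g‖ ^ 2)
      ≤ 𝒯.meshSize ^ 2 * (Real.pi * 𝒯.meshSize ^ 2 * ‖g‖ ^ 2) := by gcongr
    _ = _ := by ring

theorem feL2_injective (hΩ : IsConvexPolygon Ω) (hreg : 𝒯.IsRegular ϑ) :
    Function.Injective (feL2 (𝒯 := 𝒯) hΩ) := by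
  rw [← LinearMap.ker_eq_bot, LinearMap.ker_eq_bot']
  intro v hv
  have h0 : ∀ K ∈ 𝒯.triangles, 0 ≤ ∫ x in cell K, (v : Plane → ℝ) x ^ 2 := fun K _ =>
    integral_nonneg fun x => sq_nonneg _
  have hsum := norm_feL2_sq hΩ v
  rw [hv, norm_zero, zero_pow two_ne_zero, eq_comm, Finset.sum_eq_zero_iff_of_nonneg h0] at hsum
  refine fe_eq_zero fun Z hZ => ?_
  obtain ⟨K, hK, hZK⟩ := 𝒯.mem_nodes.1 hZ
  obtain ⟨-, -, -, -, h⟩ := hreg.fe_local v hK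
  have h1 := h Z hZK
  rw [hsum K hK, mul_zero] at h1
  have h2 : 0 < Real.pi * 𝒯.meshSize ^ 2 := mul_pos Real.pi_pos (pow_pos hreg.meshSize_pos 2)
  have h3 : (v : Plane → ℝ) Z ^ 2 ≤ 0 := by
    by_contra! h4
    have := mul_pos h2 h4
    linarith
  exact pow_eq_zero_iff two_ne_zero |>.1 (le_antisymm h3 (sq_nonneg _))

/-- Every edge belongs to at least one triangle. -/
theorem sum_adj_le_sum_triangles (f : Plane → Plane → ℝ) (hf : ∀ Z Z', 0 ≤ f Z Z') :
    ∑ Z ∈ 𝒯.nodes, ∑ Z' ∈ 𝒯.adj Z, f Z Z' ≤ ∑ K ∈ 𝒯.triangles, ∑ Z ∈ K, ∑ Z' ∈ K, f Z Z' := by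
  classical
  have h1 : ∀ Z ∈ 𝒯.nodes, ∑ Z' ∈ 𝒯.adj Z, f Z Z' ≤
      ∑ K ∈ 𝒯.triangles, if Z ∈ K then ∑ Z' ∈ K, f Z Z' else 0 := fun Z _ => by
    have h2 : ∀ Z' ∈ 𝒯.adj Z, f Z Z' ≤
        ∑ K ∈ 𝒯.triangles, if Z ∈ K then (if Z' ∈ K then f Z Z' else 0) else 0 := fun Z' hZ' => by
      obtain ⟨-, K, hK, hZK, hZK'⟩ := 𝒯.mem_adj.1 hZ'
      refine le_trans ?_ (Finset.single_le_sum (fun K _ => ?_) hK)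
      · simp [hZK, hZK']
      · split_ifs <;> first | exact hf _ _ | exact le_rfl
    refine (Finset.sum_le_sum h2).trans ?_
    rw [Finset.sum_comm]
    refine Finset.sum_le_sum fun K _ => ?_
    split_ifs
    · rw [← Finset.sum_filter]
      exact Finset.sum_le_sum_of_subset_of_nonneg (fun x hx => (Finset.mem_filter.1 hx).2)
        fun _ _ _ => hf _ _
    · simp
  refine (Finset.sum_le_sum h1).trans ?_
  rw [Finset.sum_comm]
  refine Finset.sum_le_sum fun K _ => ?_
  rw [← Finset.sum_filter]
  exact Finset.sum_le_sum_of_subset_of_nonneg (fun x hx => (Finset.mem_filter.1 hx).2)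
    fun _ _ _ => Finset.sum_nonneg fun _ _ => hf _ _

/-- On a triangle each of the nine pairs contributes at most (‖g‖h)², while the gradient integral is
at least (ϑh)²‖g‖². The powers of h cancel, which is special to two dimensions. -/
theorem IsRegular.sqrt_jumpSq_le (hreg : 𝒯.IsRegular ϑ) (hΩ : IsConvexPolygon Ω) (v : 𝒯.fe) :
    √(𝒯.jumpSq v) ≤ 3 / ϑ * ‖feGrad hΩ v‖ := by
  have hϑ := hreg.pos
  refine Real.sqrt_le_iff.2 ⟨by positivity, ?_⟩
  refine (sum_adj_le_sum_triangles _ fun _ _ => sq_nonneg _).trans ?_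
  rw [mul_pow, norm_feGrad_sq, Finset.mul_sum]
  refine Finset.sum_le_sum fun K hK => ?_
  obtain ⟨g, hg, h, -, -⟩ := hreg.fe_local v hK
  rw [setIntegral_congr_fun (g := fun _ => ‖g‖ ^ 2) (isOpen_cell K).measurableSet fun x hx => by
    simp only [hg x hx], setIntegral_const, smul_eq_mul]
  have h1 := hreg.le_measureReal_cell hK
  have h2 : ∑ Z ∈ K, ∑ Z' ∈ K, ((v : Plane → ℝ) Z - (v : Plane → ℝ) Z') ^ 2 ≤
      9 * (‖g‖ * 𝒯.meshSize) ^ 2 := by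
    refine (Finset.sum_le_sum fun Z hZ => Finset.sum_le_card_nsmul _ _ _ (h Z hZ)).trans_eq ?_
    rw [Finset.sum_const, 𝒯.card_eq_three K hK]
    simp only [nsmul_eq_mul]
    push_cast
    ring
  refine h2.trans ?_
  have h3 : (ϑ * 𝒯.meshSize) ^ 2 ≤ volume.real (cell K) := by
    refine le_trans (le_mul_of_one_le_left (sq_nonneg _) ?_) h1
    linarith [Real.pi_gt_three]
  calc 9 * (‖g‖ * 𝒯.meshSize) ^ 2 = (3 / ϑ) ^ 2 * ((ϑ * 𝒯.meshSize) ^ 2 * ‖g‖ ^ 2) := by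
        field_simp; ring
    _ ≤ _ := by gcongr

/-! ### The lumped inner product -/

/-- The quadrature inner product as a bilinear form. -/
def lump (𝒯 : Triangulation Ω) : 𝒯.fe →ₗ[ℝ] 𝒯.fe →ₗ[ℝ] ℝ :=
  LinearMap.mk₂ ℝ (fun v w => 𝒯.lumpIp v w)
    (fun u v w => by
      simp only [lumpIp, Submodule.coe_add, Pi.add_apply, add_mul, mul_add, Finset.sum_add_distrib])
    (fun c v w => by
      simp only [lumpIp, Submodule.coe_smul, Pi.smul_apply, smul_eq_mul, Finset.mul_sum]
      exact Finset.sum_congr rfl fun K _ => Finset.sum_congr rfl fun Z _ => by ring)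
    (fun u v w => by
      simp only [lumpIp, Submodule.coe_add, Pi.add_apply, mul_add, Finset.sum_add_distrib])
    (fun c v w => by
      simp only [lumpIp, Submodule.coe_smul, Pi.smul_apply, smul_eq_mul, Finset.mul_sum]
      exact Finset.sum_congr rfl fun K _ => Finset.sum_congr rfl fun Z _ => by ring)

theorem lump_apply (v w : 𝒯.fe) : 𝒯.lump v w = 𝒯.lumpIp v w := rfl

theorem lump_self_nonneg (v : 𝒯.fe) : 0 ≤ 𝒯.lump v v :=
  Finset.sum_nonneg fun _ _ => mul_nonneg (by positivity)
    (Finset.sum_nonneg fun _ _ => mul_self_nonneg _)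

theorem IsRegular.lump_self_le (hreg : 𝒯.IsRegular ϑ) (hΩ : IsConvexPolygon Ω) (v : 𝒯.fe) :
    𝒯.lump v v ≤ locConst ϑ * ‖feL2 hΩ v‖ ^ 2 := by
  rw [lump_apply, lumpIp, norm_feL2_sq, Finset.mul_sum]
  refine Finset.sum_le_sum fun K hK => ?_
  obtain ⟨-, -, -, -, h⟩ := hreg.fe_local v hK
  have h1 := hreg.measureReal_convexHull_le hK
  rw [measureReal_def] at h1
  have h2 : ∑ Z ∈ K, Real.pi * 𝒯.meshSize ^ 2 * (v : Plane → ℝ) Z ^ 2 ≤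
      3 * (locConst ϑ * ∫ x in cell K, (v : Plane → ℝ) x ^ 2) := by
    refine (Finset.sum_le_card_nsmul _ _ _ h).trans_eq ?_
    rw [𝒯.card_eq_three K hK, nsmul_eq_mul]
    push_cast
    ring
  rw [← Finset.mul_sum] at h2
  have h3 : 0 ≤ ∑ Z ∈ K, (v : Plane → ℝ) Z ^ 2 := by positivity
  have h4 := mul_le_mul_of_nonneg_right h1 h3
  simp only [← sq]
  linarith

theorem IsRegular.abs_lump_le (hreg : 𝒯.IsRegular ϑ) (hΩ : IsConvexPolygon Ω) (v w : 𝒯.fe) :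
    |𝒯.lump v w| ≤ locConst ϑ * ‖feL2 hΩ v‖ * ‖feL2 hΩ w‖ := by
  have hC : 0 ≤ locConst ϑ := by rw [locConst]; have := hreg.pos; positivity
  refine abs_le_of_sq_le_sq ?_ (by positivity)
  have hsymm : LinearMap.IsSymm 𝒯.lump := ⟨fun v w => by
    simp only [lump_apply, lumpIp, mul_comm, RingHom.id_apply]⟩
  refine (LinearMap.BilinForm.apply_sq_le_of_symm 𝒯.lump lump_self_nonneg hsymm v w).trans ?_
  calc _ ≤ (locConst ϑ * ‖feL2 hΩ v‖ ^ 2) * (locConst ϑ * ‖feL2 hΩ w‖ ^ 2) :=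
        mul_le_mul (hreg.lump_self_le hΩ v) (hreg.lump_self_le hΩ w) (lump_self_nonneg w)
          (by positivity)
    _ = _ := by ring

theorem IsRegular.lump_definite (hreg : 𝒯.IsRegular ϑ) (v : 𝒯.fe) (hv : 𝒯.lump v v ≤ 0) :
    v = 0 := by
  have h0 : ∀ K ∈ 𝒯.triangles, 0 ≤ 1 / 3 * (volume (convexHull ℝ (K : Set Plane))).toReal *
      ∑ Z ∈ K, (v : Plane → ℝ) Z * (v : Plane → ℝ) Z := fun _ _ => mul_nonneg (by positivity)
    (Finset.sum_nonneg fun _ _ => mul_self_nonneg _)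
  have h := (Finset.sum_eq_zero_iff_of_nonneg h0).1 (le_antisymm hv (lump_self_nonneg v))
  refine fe_eq_zero fun Z hZ => ?_
  obtain ⟨K, hK, hZK⟩ := 𝒯.mem_nodes.1 hZ
  have h1 := h K hK
  have h2 := hreg.le_measureReal_cell hK
  rw [measureReal_def, volume_cell] at h2
  have h3 : 0 < Real.pi * (ϑ * 𝒯.meshSize) ^ 2 := mul_pos Real.pi_pos (pow_pos hreg.radius_pos 2)
  rw [mul_eq_zero, or_iff_right (mul_pos (by norm_num) (h3.trans_le h2)).ne',
    Finset.sum_eq_zero_iff_of_nonneg fun _ _ => mul_self_nonneg _] at h1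
  exact mul_self_eq_zero.1 (h1 Z hZK)

/-- The defining property of the modified `L²` projection. -/
theorem IsRegular.lumpIp_proj (hreg : 𝒯.IsRegular ϑ) (hΩ : IsConvexPolygon Ω) (ψ : L2 Ω)
    (χ : 𝒯.fe) : 𝒯.lumpIp (𝒯.proj ψ) χ = inner ℝ ψ (feL2 hΩ χ) := by
  obtain ⟨w, hw, -⟩ := existsUnique_of_definite 𝒯.lump hreg.lump_definite
    (innerₗ (L2 Ω) ψ ∘ₗ feL2 hΩ)
  have hip : ∀ χ : 𝒯.fe, inner ℝ ψ (feL2 hΩ χ) = ip Ω ψ χ := fun χ =>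
    inner_eq_ip (Filter.EventuallyEq.refl _ _) (coeFn_feL2 hΩ χ)
  have H : ∃ w ∈ 𝒯.fe, ∀ χ ∈ 𝒯.fe, 𝒯.lumpIp w χ = ip Ω ψ χ :=
    ⟨w, w.2, fun χ hχ => (hw ⟨χ, hχ⟩).trans (hip ⟨χ, hχ⟩)⟩
  rw [hip, proj, dif_pos H]
  exact H.choose_spec.2 χ χ.2

end Regular

/-! ### The convection form -/

/-- Skewness is the divergence condition tested with v², a Lipschitz function vanishing outside Ω
and smooth in the cells: 0 = ∫ b·∇(v²) = 2(b·∇v, v). -/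
theorem exists_convection_form (hΩ : IsConvexPolygon Ω) {b : Plane → Plane} (hdiv : IsDivFree Ω b)
    (hbm : AEStronglyMeasurable b (volume.restrict Ω)) {B : ℝ}
    (hB : ∀ᵐ x ∂volume.restrict Ω, ‖b x‖ ≤ B) : ∃ c : 𝒯.fe →ₗ[ℝ] 𝒯.fe →ₗ[ℝ] ℝ,
      (∀ v w : 𝒯.fe, c v w = convIp Ω b v w) ∧ (∀ v, c v v = 0) ∧
      ∀ v w, |c v w| ≤ B * ‖feGrad hΩ v‖ * ‖feL2 hΩ w‖ := by
  have hfin := hΩ.isFiniteMeasure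
  have hmem : ∀ v : 𝒯.fe, MemLp (fun x => inner ℝ (b x) (gradient (v : Plane → ℝ) x)) 2
      (volume.restrict Ω) := fun v => by
    obtain ⟨C, hC⟩ := fe_exists_lipschitz hΩ v
    refine MemLp.of_bound (hbm.inner (measurable_gradient _).aestronglyMeasurable) (B * C) ?_
    filter_upwards [hB] with x hx
    refine (norm_inner_le_norm (b x) (gradient (v : Plane → ℝ) x)).trans ?_
    exact mul_le_mul hx (norm_gradient_le_of_lipschitz hC x) (norm_nonneg _)
      ((norm_nonneg _).trans hx)
  let T : 𝒯.fe →ₗ[ℝ] L2 Ω :=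
    { toFun := fun v => (hmem v).toLp _
      map_add' := fun v w => by
        rw [← MemLp.toLp_add, MemLp.toLp_eq_toLp_iff]
        filter_upwards [fe_gradient_add hΩ v w] with x hx
        rw [hx, Pi.add_apply, Pi.add_apply, inner_add_right]
      map_smul' := fun c v => by
        rw [RingHom.id_apply, ← MemLp.toLp_const_smul, MemLp.toLp_eq_toLp_iff]
        filter_upwards [fe_gradient_smul hΩ c v] with x hx
        rw [hx, Pi.smul_apply, Pi.smul_apply, inner_smul_right, smul_eq_mul] }
  have hT : ∀ v w : 𝒯.fe, inner ℝ (T v) (feL2 hΩ w) = convIp Ω b v w := fun v w =>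
    inner_eq_ip (MemLp.coeFn_toLp (hmem v)) (coeFn_feL2 hΩ w)
  have hTn : ∀ v, ‖T v‖ ≤ B * ‖feGrad hΩ v‖ := fun v => by
    refine Lp.norm_le_mul_norm_of_ae_le_mul ?_
    filter_upwards [MemLp.coeFn_toLp (hmem v), coeFn_feGrad hΩ v, hB] with x h1 h2 h3
    rw [show T v x = _ from h1, h2]
    refine (norm_inner_le_norm (b x) (gradient (v : Plane → ℝ) x)).trans ?_
    gcongr
  refine ⟨(innerₗ (L2 Ω)).compl₁₂ T (feL2 hΩ), hT, fun v => ?_, fun v w => ?_⟩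
  · rw [show (innerₗ (L2 Ω)).compl₁₂ T (feL2 hΩ) v v = convIp Ω b v v from hT v v]
    obtain ⟨C, hC⟩ := fe_exists_lipschitz hΩ v
    obtain ⟨M, hM⟩ := fe_exists_bound hΩ v
    have hM0 : 0 ≤ M := (norm_nonneg _).trans (hM 0)
    have hlip : LipschitzWith (2 * M.toNNReal * C) fun x => (v : Plane → ℝ) x ^ 2 := by
      refine LipschitzWith.of_dist_le_mul fun x y => ?_
      have h1 := hC.dist_le_mul x y
      rw [Real.dist_eq] at h1 ⊢
      rw [sq_sub_sq, abs_mul]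
      push_cast
      rw [Real.coe_toNNReal M hM0, mul_assoc]
      refine mul_le_mul ?_ h1 (abs_nonneg _) (by positivity)
      have h2 := hM x
      have h3 := hM y
      rw [Real.norm_eq_abs] at h2 h3
      exact (abs_add_le _ _).trans (by linarith)
    have h0 := integral_inner_gradient_eq_zero hΩ hdiv hbm hB hlip
      (fun x hx => by rw [v.2.2.2 x hx, zero_pow two_ne_zero]) (by
        filter_upwards [𝒯.ae_mem_cell hΩ] with x ⟨K, hK, hx⟩
        exact (fe_contDiffAt v hK hx).pow 2)
    have h1 : ∫ x in Ω, inner ℝ (b x) (gradient (fun x => (v : Plane → ℝ) x ^ 2) x) =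
        2 * convIp Ω b v v := by
      rw [convIp, ← integral_const_mul]
      refine integral_congr_ae ?_
      filter_upwards [fe_ae_differentiableAt hΩ v] with x hx
      have h2 : gradient (fun x => (v : Plane → ℝ) x ^ 2) x =
          (2 * (v : Plane → ℝ) x) • gradient (v : Plane → ℝ) x := by
        have h3 : HasFDerivAt (fun x => (v : Plane → ℝ) x ^ 2)
            ((2 * (v : Plane → ℝ) x) • fderiv ℝ (v : Plane → ℝ) x) x := by
          simpa using hx.hasFDerivAt.pow 2
        rw [gradient, h3.fderiv, map_smulₛₗ]
        rfl
      rw [h2, inner_smul_right]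
      ring
    rw [h0] at h1
    linarith
  · refine (abs_real_inner_le_norm (T v) (feL2 hΩ w)).trans ?_
    exact mul_le_mul_of_nonneg_right (hTn v) (norm_nonneg _)

end Triangulation

end

end AFC

namespace AFC

noncomputable section

/-! ### The stabilization forms -/

namespace Triangulation

variable {Ω : Set Plane} {𝒯 : Triangulation Ω}

/-- The stabilization with given coefficients as a bilinear form on `S_h`. -/
def stabForm (𝒯 : Triangulation Ω) (c : Plane → Plane → ℝ) : 𝒯.fe →ₗ[ℝ] 𝒯.fe →ₗ[ℝ] ℝ :=
  LinearMap.mk₂ ℝ (fun v z => 𝒯.stab c v z)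
    (fun u v z => by
      simp only [stab, Submodule.coe_add, Pi.add_apply, ← Finset.sum_add_distrib]
      exact Finset.sum_congr rfl fun _ _ => Finset.sum_congr rfl fun _ _ => by ring)
    (fun r v z => by
      simp only [stab, Submodule.coe_smul, Pi.smul_apply, smul_eq_mul, Finset.mul_sum]
      exact Finset.sum_congr rfl fun _ _ => Finset.sum_congr rfl fun _ _ => by ring)
    (fun u v z => by
      simp only [stab, Submodule.coe_add, Pi.add_apply, ← Finset.sum_add_distrib]
      exact Finset.sum_congr rfl fun _ _ => Finset.sum_congr rfl fun _ _ => by ring)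
    (fun r v z => by
      simp only [stab, Submodule.coe_smul, Pi.smul_apply, smul_eq_mul, Finset.mul_sum]
      exact Finset.sum_congr rfl fun _ _ => Finset.sum_congr rfl fun _ _ => by ring)

theorem stabForm_apply (c : Plane → Plane → ℝ) (v z : 𝒯.fe) :
    𝒯.stabForm c v z = 𝒯.stab c v z := rfl

theorem stab_neg (c : Plane → Plane → ℝ) (v z : Plane → ℝ) :
    𝒯.stab (fun Z Z' => -c Z Z') v z = -𝒯.stab c v z := by
  simp only [stab, neg_mul, Finset.sum_neg_distrib]

theorem stab_sub_stab_one_sub (c a : Plane → Plane → ℝ) (v z : Plane → ℝ) :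
    𝒯.stab c v z - 𝒯.stab (fun Z Z' => c Z Z' * (1 - a Z Z')) v z =
      𝒯.stab (fun Z Z' => c Z Z' * a Z Z') v z := by
  simp only [stab, ← Finset.sum_sub_distrib]
  exact Finset.sum_congr rfl fun _ _ => Finset.sum_congr rfl fun _ _ => by ring

/-- The correction factors of an artificial diffusion with nonnegative coefficients `e`. -/
def diffusionFactor (𝒯 : Triangulation Ω) (γ : Plane → ℝ) (e : Plane → Plane → ℝ)
    (v : Plane → ℝ) : Plane → Plane → ℝ :=
  𝒯.factor (fun Z Z' => e Z Z' * (v Z - v Z')) (𝒯.qCoef γ e) v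

/-- The antidiffusive part of an artificial diffusion with coefficients `e`. -/
def antidiffusion (𝒯 : Triangulation Ω) (γ : Plane → ℝ) (e : Plane → Plane → ℝ) (v : 𝒯.fe) :
    𝒯.fe →ₗ[ℝ] ℝ :=
  𝒯.stabForm (fun Z W => e Z W * 𝒯.diffusionFactor γ e v Z W) v

/-- The antidiffusive part of the mass lumping. -/
def massAntidiffusion (𝒯 : Triangulation Ω) (γ : Plane → ℝ) (v o : 𝒯.fe) : 𝒯.fe →ₗ[ℝ] ℝ :=
  𝒯.stabForm (fun Z Z' => 𝒯.mass Z Z' * 𝒯.facM γ v o Z Z') (v - o)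

theorem massAntidiffusion_apply (γ : Plane → ℝ) (v o χ : 𝒯.fe) :
    𝒯.massAntidiffusion γ v o χ = 𝒯.antiM γ v o (v - o : 𝒯.fe) χ :=
  (stab_sub_stab_one_sub _ _ _ _).symm

theorem antidiffusion_diffHat (γ : Plane → ℝ) (b : Plane → Plane) (v χ : 𝒯.fe) :
    𝒯.antidiffusion γ (𝒯.diffHat b) v χ = 𝒯.antiDHat γ b v v χ :=
  (stab_sub_stab_one_sub _ _ _ _).symm

/-- With e = -d ≥ 0 the state flux d(v_j - v_i) becomes e(v_i - v_j), the form of the co-state flux.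
Both equations thus share one analysis. -/
theorem diffusionFactor_neg_diff (γ : Plane → ℝ) (b : Plane → Plane) (v : Plane → ℝ) :
    𝒯.diffusionFactor γ (fun Z Z' => -𝒯.diff b Z Z') v = 𝒯.facD γ b v := by
  rw [diffusionFactor, facD]
  congr 1
  · ext Z Z'; ring
  · ext Z; simp only [qCoef, abs_neg]

theorem antidiffusion_neg_diff (γ : Plane → ℝ) (b : Plane → Plane) (v χ : 𝒯.fe) :
    𝒯.antidiffusion γ (fun Z Z' => -𝒯.diff b Z Z') v χ = -𝒯.antiD γ b v v χ := by
  rw [antiD, stabD, stab_sub_stab_one_sub, ← stab_neg, antidiffusion, stabForm_apply,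
    diffusionFactor_neg_diff]
  simp only [neg_mul]

/-! ### Size and Lipschitz constants of the stabilizations -/

section Regular

variable {ϑ : ℝ}

/-- The constant in the estimates of the stabilization forms. -/
def stabConst (ϑ Γ : ℝ) : ℝ :=
  9 / ϑ ^ 2 * (1 + 3 * (⌈3 / ϑ ^ 2⌉₊ : ℝ) * (3 + Γ * (⌈3 / ϑ ^ 2⌉₊ : ℝ)))

theorem stabConst_nonneg {Γ : ℝ} (hΓ : 0 ≤ Γ) : 0 ≤ stabConst ϑ Γ := by
  rw [stabConst]; positivity

theorem le_stabConst {Γ : ℝ} (hΓ : 0 ≤ Γ) : 9 / ϑ ^ 2 ≤ stabConst ϑ Γ :=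
  le_mul_of_one_le_right (by positivity) (le_add_of_nonneg_right (by positivity))

theorem IsRegular.abs_stabForm_le (hreg : 𝒯.IsRegular ϑ) (hΩ : IsConvexPolygon Ω)
    {c : Plane → Plane → ℝ} (hc : 𝒯.IsEdgeCoef c) {M : ℝ} (hM0 : 0 ≤ M)
    (hM : ∀ Z Z', |c Z Z'| ≤ M) {Γ : ℝ} (hΓ : 0 ≤ Γ) (v z : 𝒯.fe) :
    |𝒯.stabForm c v z| ≤ stabConst ϑ Γ * M * ‖feGrad hΩ v‖ * ‖feGrad hΩ z‖ := by
  have hϑ := hreg.pos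
  refine (𝒯.abs_stab_le hc hM0 hM v z).trans ?_
  calc M * √(𝒯.jumpSq v) * √(𝒯.jumpSq z)
      ≤ M * (3 / ϑ * ‖feGrad hΩ v‖) * (3 / ϑ * ‖feGrad hΩ z‖) := by
        gcongr
        · exact hreg.sqrt_jumpSq_le hΩ v
        · exact hreg.sqrt_jumpSq_le hΩ z
    _ = 9 / ϑ ^ 2 * M * ‖feGrad hΩ v‖ * ‖feGrad hΩ z‖ := by ring
    _ ≤ _ := by
        gcongr
        exact le_stabConst hΓ

theorem IsRegular.abs_stab_factor_sub_le (hreg : 𝒯.IsRegular ϑ) (hΩ : IsConvexPolygon Ω)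
    {c : Plane → Plane → ℝ} (hc : 𝒯.IsEdgeCoef c) {M : ℝ} (hM0 : 0 ≤ M)
    (hM : ∀ Z Z', |c Z Z'| ≤ M) {Γ : ℝ} (hΓ : 0 ≤ Γ) {γ : Plane → ℝ}
    (hγ0 : ∀ Z ∈ 𝒯.nodes, Z ∈ Ω → 0 ≤ γ Z) (hγ : ∀ Z ∈ 𝒯.nodes, Z ∈ Ω → γ Z ≤ Γ)
    (δ δ' v v' z : 𝒯.fe) :
    |𝒯.stab (fun Z Z' => c Z Z' * 𝒯.factor (fun Z Z' => c Z Z' * ((v : Plane → ℝ) Z -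
        (v : Plane → ℝ) Z')) (𝒯.qCoef γ c) δ Z Z') v z -
      𝒯.stab (fun Z Z' => c Z Z' * 𝒯.factor (fun Z Z' => c Z Z' * ((v' : Plane → ℝ) Z -
        (v' : Plane → ℝ) Z')) (𝒯.qCoef γ c) δ' Z Z') v' z| ≤
      stabConst ϑ Γ * M * (‖feGrad hΩ (v - v')‖ + ‖feGrad hΩ (δ - δ')‖) * ‖feGrad hΩ z‖ := by
  have hϑ := hreg.pos
  refine (𝒯.abs_stab_limited_sub_le hc hM0 hM hreg.card_adj_le (s := 1) (one_pow 2) hΓ hγ0 hγ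
    δ δ' v v' z (fun _ _ => (one_mul _).symm) (fun _ _ => (one_mul _).symm)).trans ?_
  have h1 := hreg.sqrt_jumpSq_le hΩ (v - v')
  have h2 := hreg.sqrt_jumpSq_le hΩ (δ - δ')
  have h3 := hreg.sqrt_jumpSq_le hΩ z
  set n : ℝ := (⌈3 / ϑ ^ 2⌉₊ : ℝ) with hn
  have hn0 : 0 ≤ n := Nat.cast_nonneg _
  calc _ ≤ 3 * n * (3 + Γ * n) * M * (3 / ϑ * ‖feGrad hΩ (v - v')‖ +
        3 / ϑ * ‖feGrad hΩ (δ - δ')‖) * (3 / ϑ * ‖feGrad hΩ z‖) := by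
        gcongr
        · exact h1
        · exact h2
    _ = 9 / ϑ ^ 2 * (3 * n * (3 + Γ * n)) * M * (‖feGrad hΩ (v - v')‖ + ‖feGrad hΩ (δ - δ')‖)
        * ‖feGrad hΩ z‖ := by ring
    _ ≤ _ := by
        rw [stabConst]
        gcongr
        linarith

/-- The forms of a step with convection form `c` and artificial diffusion coefficients `e`. -/
def stepForms (hΩ : IsConvexPolygon Ω) (hreg : 𝒯.IsRegular ϑ) {Γ : ℝ} (hΓ : 0 ≤ Γ)
    {γ : Plane → ℝ} (hγ0 : ∀ Z ∈ 𝒯.nodes, Z ∈ Ω → 0 ≤ γ Z)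
    (hγ : ∀ Z ∈ 𝒯.nodes, Z ∈ Ω → γ Z ≤ Γ) {M : ℝ} (hM0 : 0 ≤ M) {μ k η : ℝ} (hk : 0 ≤ k)
    (hη : 2 * stabConst ϑ Γ * (Real.pi * 𝒯.meshSize ^ 2 + k * M) ≤ k * η)
    {e : Plane → Plane → ℝ} (he : 𝒯.IsEdgeCoef e) (he0 : ∀ Z Z', 0 ≤ e Z Z')
    (heM : ∀ Z Z', |e Z Z'| ≤ M) (c : 𝒯.fe →ₗ[ℝ] 𝒯.fe →ₗ[ℝ] ℝ) (hc : ∀ v, c v v = 0) :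
    StepForms (feL2 (𝒯 := 𝒯) hΩ) (feGrad hΩ) μ k η where
  c := c
  T₁ := k • 𝒯.stabForm e
  T₂ := 𝒯.stabForm 𝒯.mass
  R := fun v o => 𝒯.massAntidiffusion γ v o + k • 𝒯.antidiffusion γ e v
  c_self := hc
  T₁_nonneg := fun v => mul_nonneg hk (𝒯.stab_self_nonneg he he0 v)
  T₂_nonneg := fun v => 𝒯.stab_self_nonneg (isEdgeCoef_mass hΩ) mass_nonneg v
  T₁_le := fun v w => by
    have hA := stabConst_nonneg (ϑ := ϑ) hΓ
    rw [LinearMap.smul_apply, LinearMap.smul_apply, smul_eq_mul, abs_mul, abs_of_nonneg hk]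
    refine (mul_le_mul_of_nonneg_left (hreg.abs_stabForm_le hΩ he hM0 heM hΓ v w) hk).trans ?_
    have h1 : k * (stabConst ϑ Γ * M) ≤ k * η := by
      have : 0 ≤ stabConst ϑ Γ * (Real.pi * 𝒯.meshSize ^ 2) := by positivity
      have : 0 ≤ stabConst ϑ Γ * (k * M) := by positivity
      linarith
    calc _ = k * (stabConst ϑ Γ * M) * ‖feGrad hΩ v‖ * ‖feGrad hΩ w‖ := by ring
      _ ≤ _ := by gcongr
  T₂_le := fun v w => by
    have hA := stabConst_nonneg (ϑ := ϑ) hΓ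
    refine (hreg.abs_stabForm_le hΩ (isEdgeCoef_mass hΩ) (by positivity) hreg.mass_le hΓ v w).trans ?_
    have h1 : stabConst ϑ Γ * (Real.pi * 𝒯.meshSize ^ 2) ≤ k * η := by
      have : 0 ≤ stabConst ϑ Γ * (Real.pi * 𝒯.meshSize ^ 2) := by positivity
      have : 0 ≤ stabConst ϑ Γ * (k * M) := by positivity
      linarith
    gcongr
  R_le := fun v o v' o' w => by
    have hA := stabConst_nonneg (ϑ := ϑ) hΓ
    have h1 : |𝒯.massAntidiffusion γ v o w - 𝒯.massAntidiffusion γ v' o' w| ≤ _ :=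
      hreg.abs_stab_factor_sub_le hΩ (isEdgeCoef_mass hΩ) (by positivity) hreg.mass_le hΓ hγ0 hγ
        v v' (v - o) (v' - o') w
    have h2 : |𝒯.antidiffusion γ e v w - 𝒯.antidiffusion γ e v' w| ≤ _ :=
      hreg.abs_stab_factor_sub_le hΩ he hM0 heM hΓ hγ0 hγ v v' v v' w
    -- The mass fluxes are those of the increment, so old values enter through them. The limiter
    -- bounds use v alone and contribute another term at most X + Y; this accounts for the factor 2
    -- in `hη`.
    have h3 : ‖feGrad hΩ (v - o - (v' - o'))‖ ≤ ‖feGrad hΩ (v - v')‖ + ‖feGrad hΩ (o - o')‖ := by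
      rw [sub_sub_sub_comm, map_sub]
      exact norm_sub_le _ _
    set X := ‖feGrad hΩ (v - v')‖
    set Y := ‖feGrad hΩ (o - o')‖
    set W := ‖feGrad hΩ w‖
    have hX : 0 ≤ X := norm_nonneg _
    have hY : 0 ≤ Y := norm_nonneg _
    have hW : 0 ≤ W := norm_nonneg _
    simp only [LinearMap.add_apply, LinearMap.smul_apply, smul_eq_mul]
    rw [add_sub_add_comm, ← mul_sub]
    refine (abs_add_le _ _).trans ?_
    rw [abs_mul, abs_of_nonneg hk]
    calc _ ≤ stabConst ϑ Γ * (Real.pi * 𝒯.meshSize ^ 2) * (X + Y + (X + Y)) * W +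
          k * (stabConst ϑ Γ * M * (X + Y + (X + Y)) * W) := by
          refine add_le_add (h1.trans ?_) (mul_le_mul_of_nonneg_left (h2.trans ?_) hk)
          · gcongr
            linarith
          · gcongr <;> linarith
      _ = 2 * stabConst ϑ Γ * (Real.pi * 𝒯.meshSize ^ 2 + k * M) * (X + Y) * W := by ring
      _ ≤ _ := by gcongr

end Regular

end Triangulation

end

end AFC

namespace AFC

noncomputable section

/-! ### The discrete schemes in abstract form -/

variable {Ω : Set Plane} {p : Problem} {d : Discretization Ω}

theorem Problem.Valid.aestronglyMeasurable_b (hp : p.Valid Ω) {t : ℝ} (ht : t ∈ Icc 0 p.tEnd) :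
    AEStronglyMeasurable (p.b t) (volume.restrict Ω) := by
  refine AEMeasurable.aestronglyMeasurable ?_
  have h : AEMeasurable (fun x i => p.b t x i) (volume.restrict Ω) :=
    aemeasurable_pi_lambda _ fun i => (hp.b_mem t ht i).1.aestronglyMeasurable.aemeasurable
  exact (WithLp.measurable_toLp 2 (Fin 2 → ℝ)).comp_aemeasurable h

theorem step_mul_cast (hN : 1 ≤ d.N₀) : step p d * d.N₀ = p.tEnd := by
  have : (d.N₀ : ℝ) ≠ 0 := by positivity
  rw [step, div_mul_cancel₀ _ this]

theorem Problem.Valid.step_pos (hp : p.Valid Ω) (hN : 1 ≤ d.N₀) : 0 < step p d :=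
  div_pos hp.tEnd_pos (by positivity)

theorem Problem.Valid.time_mem (hp : p.Valid Ω) (hN : 1 ≤ d.N₀) {m : ℕ} (hm : m ≤ d.N₀) :
    time p d m ∈ Icc 0 p.tEnd := by
  have h := hp.step_pos (d := d) hN
  refine ⟨mul_nonneg m.cast_nonneg h.le, ?_⟩
  rw [← step_mul_cast (p := p) hN, time, mul_comm]
  gcongr

/-- The state and co-state schemes are instances of the abstract forward-backward scheme. -/
theorem exists_schemeForms (hΩ : IsConvexPolygon Ω) (hp : p.Valid Ω) {B : ℝ} (hB0 : 0 ≤ B)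
    (hB : ∀ t ∈ Icc 0 p.tEnd, ∀ᵐ x ∂volume.restrict Ω, ‖p.b t x‖ ≤ B) {ϑ : ℝ}
    (hreg : d.mesh.IsRegular ϑ) {Γ : ℝ} (hΓ : 0 ≤ Γ)
    (hγ0 : ∀ Z ∈ d.mesh.nodes, Z ∈ Ω → 0 ≤ d.γ Z)
    (hγ : ∀ Z ∈ d.mesh.nodes, Z ∈ Ω → d.γ Z ≤ Γ) (hN : 1 ≤ d.N₀) {η : ℝ}
    (hη : 2 * Triangulation.stabConst ϑ Γ * (Real.pi * d.mesh.meshSize ^ 2 +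
      step p d * (B * Real.pi / ϑ * d.mesh.meshSize)) ≤ step p d * η) :
    ∃ S : SchemeForms (Triangulation.feL2 (𝒯 := d.mesh) hΩ) (Triangulation.feGrad hΩ) p.μ
        (step p d) η d.N₀,
      S.κ = Triangulation.locConst ϑ ∧ S.β = B ∧
      (∀ n ψ o y, StateStep p d n ψ o y ↔ S.IsState n ψ o y) ∧
      (∀ n y o w, CostateStep p d n y o w ↔ S.IsCostate n y o w) ∧
      ∀ n ψ o o' s s', IterStep p d n ψ o o' s s' ↔
        (S.st n).Iterates (S.stateRhs n ψ) o s.1 s'.1 ∧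
          (S.cs n).Iterates (S.costateRhs n s'.1) o' s.2 s'.2 := by
  have hk := hp.step_pos (d := d) hN
  have hϑ := hreg.pos
  have hh := hreg.meshSize_pos
  have htm : ∀ m : Fin (d.N₀ + 1), time p d m ∈ Icc 0 p.tEnd := fun m =>
    hp.time_mem hN (Nat.lt_succ_iff.1 m.2)
  choose cv hcv hcv0 hcvB using fun m : Fin (d.N₀ + 1) =>
    Triangulation.exists_convection_form (𝒯 := d.mesh) hΩ (hp.b_div _ (htm m))
      (hp.aestronglyMeasurable_b (htm m)) (hB _ (htm m))
  have hconv : ∀ (m : Fin (d.N₀ + 1)) Z Z', |d.mesh.conv (p.b (time p d m)) Z Z'| ≤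
      B * Real.pi / ϑ * d.mesh.meshSize := fun m =>
    hreg.abs_conv_le hΩ hB0 (hB _ (htm m))
  have hM0 : 0 ≤ B * Real.pi / ϑ * d.mesh.meshSize := by positivity
  have hGm : ∀ n : Fin d.N₀, MemLp (p.G (time p d ((n : ℕ) + 1))) 2 (volume.restrict Ω) := fun n => by
    have := hp.G_mem _ (htm n.succ)
    simpa using this
  have hym : ∀ n : Fin d.N₀, MemLp (p.yd (time p d ((n : ℕ) + 1))) 2 (volume.restrict Ω) :=
    fun n => by
      have := hp.yd_mem _ (htm n.succ)
      simpa using this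
  have hdata : ∀ {f : Plane → ℝ} (hf : MemLp f 2 (volume.restrict Ω)) (χ : d.mesh.fe),
      inner ℝ (hf.toLp f) (Triangulation.feL2 hΩ χ) = ip Ω f χ := fun hf χ =>
    Triangulation.inner_eq_ip (MemLp.coeFn_toLp hf) (Triangulation.coeFn_feL2 hΩ χ)
  let S : SchemeForms (Triangulation.feL2 (𝒯 := d.mesh) hΩ) (Triangulation.feGrad hΩ) p.μ
      (step p d) η d.N₀ :=
    { st := fun n => Triangulation.stepForms hΩ hreg hΓ hγ0 hγ hM0 hk.le hη
        (e := fun Z Z' => -d.mesh.diff (p.b (time p d n.succ)) Z Z')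
        ⟨fun Z Z' => by rw [(Triangulation.isEdgeCoef_diff hΩ _).symm], fun Z hZ Z' hZ' h h' => by
          rw [(Triangulation.isEdgeCoef_diff hΩ _).eq_zero Z hZ Z' hZ' h h', neg_zero]⟩
        (fun Z Z' => neg_nonneg.2 (Triangulation.diff_nonpos _ _ _))
        (fun Z Z' => by rw [abs_neg]; exact Triangulation.abs_diff_le (hconv n.succ) Z Z')
        (step p d • cv n.succ) (fun v => by simp [hcv0])
      cs := fun n => Triangulation.stepForms hΩ hreg hΓ hγ0 hγ hM0 hk.le hη
        (e := d.mesh.diffHat (p.b (time p d n.castSucc)))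
        (Triangulation.isEdgeCoef_diffHat hΩ _) (Triangulation.diffHat_nonneg _)
        (Triangulation.abs_diffHat_le (hconv n.castSucc))
        (-(step p d • cv n.castSucc)) (fun v => by simp [hcv0])
      cv := cv
      lump := d.mesh.lump
      F := fun n => step p d • (innerₗ (L2 Ω) ((hGm n).toLp _) ∘ₗ Triangulation.feL2 hΩ)
      G := fun n => -(step p d • (innerₗ (L2 Ω) ((hym n).toLp _) ∘ₗ Triangulation.feL2 hΩ))
      β := B
      κ := Triangulation.locConst ϑ
      κ_nonneg := by rw [Triangulation.locConst]; positivity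
      cv_self := hcv0
      cv_le := hcvB
      lump_nonneg := Triangulation.lump_self_nonneg
      lump_le := hreg.abs_lump_le hΩ
      st_c := fun _ => rfl
      cs_c := fun _ => rfl }
  have hst : ∀ n ψ o v y, (S.st n).Iterates (S.stateRhs n ψ) o v y ↔
      ∀ χ : d.mesh.fe, ip Ω (y - o : d.mesh.fe) χ + p.μ * step p d * gradIp Ω y χ
        + step p d * convIp Ω (p.b (time p d ((n : ℕ) + 1))) y χ
        - step p d * d.mesh.stab (d.mesh.diff (p.b (time p d ((n : ℕ) + 1)))) y χ
        + d.mesh.stab d.mesh.mass (y - o : d.mesh.fe) χ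
        - d.mesh.antiM d.γ v o (v - o : d.mesh.fe) χ
      = -step p d * d.mesh.antiD d.γ (p.b (time p d ((n : ℕ) + 1))) v v χ
        + step p d * d.mesh.lumpIp (d.mesh.proj ψ) χ
        + step p d * ip Ω (p.G (time p d ((n : ℕ) + 1))) χ := fun n ψ o v y => by
    refine forall_congr' fun χ => ?_
    have hR : (S.st n).R v o χ = d.mesh.antiM d.γ v o (v - o : d.mesh.fe) χ -
        step p d * d.mesh.antiD d.γ (p.b (time p d n.succ)) v v χ := by
      rw [sub_eq_add_neg, ← mul_neg, ← Triangulation.antidiffusion_neg_diff,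
        ← Triangulation.massAntidiffusion_apply]
      rfl
    have hT : (S.st n).T₁ y χ = -(step p d * d.mesh.stab (d.mesh.diff (p.b (time p d n.succ))) y χ) := by
      rw [← mul_neg, ← Triangulation.stab_neg]
      rfl
    have hT' : (S.st n).T₂ (y - o) χ = d.mesh.stab d.mesh.mass (y - o : d.mesh.fe) χ := rfl
    have hC : (S.st n).c y χ = step p d * convIp Ω (p.b (time p d n.succ)) y χ := by
      rw [← hcv]
      rfl
    have hF : S.stateRhs n ψ χ = step p d * d.mesh.lumpIp (d.mesh.proj ψ) χ +
        step p d * ip Ω (p.G (time p d ((n : ℕ) + 1))) χ := by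
      rw [hreg.lumpIp_proj hΩ, ← hdata (hGm n)]
      rfl
    rw [hR, hT, hT', hC, hF, ← Triangulation.ip_eq_inner, ← Triangulation.gradIp_eq_inner]
    simp only [Fin.val_succ]
    constructor <;> intro h <;> linarith
  have hcs : ∀ n y o v w, (S.cs n).Iterates (S.costateRhs n y) o v w ↔
      ∀ χ : d.mesh.fe, ip Ω (w - o : d.mesh.fe) χ + p.μ * step p d * gradIp Ω w χ
        - step p d * convIp Ω (p.b (time p d n)) w χ
        + step p d * d.mesh.stab (d.mesh.diffHat (p.b (time p d n))) w χ
        + d.mesh.stab d.mesh.mass (w - o : d.mesh.fe) χ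
        - d.mesh.antiM d.γ v o (v - o : d.mesh.fe) χ
      = step p d * d.mesh.antiDHat d.γ (p.b (time p d n)) v v χ
        + step p d * d.mesh.lumpIp y χ
        - step p d * ip Ω (p.yd (time p d ((n : ℕ) + 1))) χ := fun n y o v w => by
    refine forall_congr' fun χ => ?_
    have hR : (S.cs n).R v o χ = d.mesh.antiM d.γ v o (v - o : d.mesh.fe) χ +
        step p d * d.mesh.antiDHat d.γ (p.b (time p d n)) v v χ := by
      rw [← Triangulation.antidiffusion_diffHat, ← Triangulation.massAntidiffusion_apply]
      rfl
    have hT : (S.cs n).T₁ w χ = step p d * d.mesh.stab (d.mesh.diffHat (p.b (time p d n))) w χ := rfl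
    have hT' : (S.cs n).T₂ (w - o) χ = d.mesh.stab d.mesh.mass (w - o : d.mesh.fe) χ := rfl
    have hC : (S.cs n).c w χ = -(step p d * convIp Ω (p.b (time p d n)) w χ) := by
      have := hcv n.castSucc w χ
      rw [Fin.val_castSucc] at this
      rw [← this]
      rfl
    have hF : S.costateRhs n y χ = step p d * d.mesh.lumpIp y χ -
        step p d * ip Ω (p.yd (time p d ((n : ℕ) + 1))) χ := by
      rw [← hdata (hym n), sub_eq_add_neg]
      rfl
    rw [hR, hT, hT', hC, hF, ← Triangulation.ip_eq_inner, ← Triangulation.gradIp_eq_inner]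
    constructor <;> intro h <;> linarith
  refine ⟨S, rfl, rfl, fun n ψ o y => ?_, fun n y o w => ?_, fun n ψ o o' s s' => ?_⟩
  · refine Iff.trans (forall_congr' fun χ => ?_) (hst n ψ o y y).symm
    simp only [Triangulation.antiM, Triangulation.antiD]
    constructor <;> intro h <;> linarith
  · refine Iff.trans (forall_congr' fun χ => ?_) (hcs n y o w w).symm
    simp only [Triangulation.antiM, Triangulation.antiDHat]
    constructor <;> intro h <;> linarith
  · rw [hst, hcs]
    rfl

/-- The full scheme, multiplied by the time step. -/
theorem solvesFull_iff (hΩ : IsConvexPolygon Ω) (hk : step p d ≠ 0)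
    (Y P : Fin (d.N₀ + 1) → d.mesh.fe) (U : Fin d.N₀ → L2 Ω) :
    SolvesFull p d Y P U ↔
      SolvesGiven p d U Y P ∧ ∀ n, IsControl p d (P n.castSucc) (U n) := by
  have hstabM : ∀ (v w z χ : d.mesh.fe), d.mesh.stabM d.γ v w ((step p d)⁻¹ • z : d.mesh.fe) χ =
      (step p d)⁻¹ * d.mesh.stabM d.γ v w z χ := fun v w z χ =>
    congrArg (fun f => f χ) (map_smul (d.mesh.stabForm fun Z Z' => d.mesh.mass Z Z' *
      (1 - d.mesh.facM d.γ v w Z Z')) (step p d)⁻¹ z)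
  have hip : ∀ z χ : d.mesh.fe, ip Ω ((step p d)⁻¹ • z : d.mesh.fe) χ =
      (step p d)⁻¹ * ip Ω z χ := fun z χ => by
    rw [Triangulation.ip_eq_inner hΩ, Triangulation.ip_eq_inner hΩ, map_smul, inner_smul_left]
    rfl
  -- The divided co-state equation contains the forward difference P n.succ - P n.castSucc with a
  -- minus sign, whereas the undivided one contains the opposite difference.
  have hstabM' : ∀ (v w z z' χ : d.mesh.fe), d.mesh.stabM d.γ v w (z - z' : d.mesh.fe) χ =
      -d.mesh.stabM d.γ v w (z' - z : d.mesh.fe) χ := fun v w z z' χ => by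
    rw [← neg_sub z' z]
    exact congrArg (fun f => f χ) (map_neg (d.mesh.stabForm fun Z Z' => d.mesh.mass Z Z' *
      (1 - d.mesh.facM d.γ v w Z Z')) (z' - z))
  have hip' : ∀ z z' χ : d.mesh.fe, ip Ω (z - z' : d.mesh.fe) χ =
      -ip Ω (z' - z : d.mesh.fe) χ := fun z z' χ => by
    rw [Triangulation.ip_eq_inner hΩ, Triangulation.ip_eq_inner hΩ, ← neg_sub z' z, map_neg,
      inner_neg_left]
  have key : ∀ {a b : ℝ}, (step p d)⁻¹ * a = (step p d)⁻¹ * b ↔ a = b :=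
    mul_right_inj' (inv_ne_zero hk)
  simp only [SolvesFull, SolvesGiven, and_assoc, ← forall_and]
  refine and_congr_right fun _ => and_congr_right fun _ => forall_congr' fun n => ?_
  refine and_congr ?_ (and_congr ?_ Iff.rfl)
  · refine forall_congr' fun χ => ?_
    rw [← key, hip, hstabM]
    constructor <;> intro h
    · field_simp at h ⊢
      linarith
    · field_simp at h ⊢
      linarith
  · refine forall_congr' fun χ => ?_
    rw [← key, hip, hstabM, hip', hstabM']
    constructor <;> intro h
    · field_simp at h ⊢
      linarith
    · field_simp at h ⊢
      linarith

/-! ### Admissible controls -/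

theorem uad_nonempty (hΩ : IsConvexPolygon Ω) (hp : p.Valid Ω) : (Uad Ω p).Nonempty := by
  have := hΩ.isFiniteMeasure
  refine ⟨(memLp_const p.ua).toLp _, ?_⟩
  filter_upwards [(memLp_const (μ := volume.restrict Ω) (p := 2) p.ua).coeFn_toLp] with x hx
  rw [hx]
  exact ⟨le_rfl, hp.bounds.le⟩

/-- As an order interval of the Banach lattice L², the admissible set is closed. -/
theorem uad_eq_Icc (hΩ : IsConvexPolygon Ω) : ∃ a b : L2 Ω, Uad Ω p = Icc a b := by
  have := hΩ.isFiniteMeasure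
  have h : ∀ c : ℝ, (memLp_const (μ := volume.restrict Ω) (p := 2) c).toLp _
      =ᵐ[volume.restrict Ω] fun _ => c := fun c => MemLp.coeFn_toLp _
  refine ⟨(memLp_const p.ua).toLp _, (memLp_const p.ub).toLp _, Set.ext fun u => ?_⟩
  rw [mem_Icc, ← Lp.coeFn_le, ← Lp.coeFn_le, Uad, mem_ofPred_eq, eventually_and]
  refine and_congr ⟨fun hu => ?_, fun hu => ?_⟩ ⟨fun hu => ?_, fun hu => ?_⟩
  · filter_upwards [hu, h p.ua] with x h1 h2 using h2.trans_le h1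
  · filter_upwards [hu, h p.ua] with x h1 h2 using h2.symm.trans_le h1
  · filter_upwards [hu, h p.ub] with x h1 h2 using h1.trans_eq h2.symm
  · filter_upwards [hu, h p.ub] with x h1 h2 using h1.trans_eq h2

theorem isClosed_uad (hΩ : IsConvexPolygon Ω) : IsClosed (Uad Ω p) := by
  obtain ⟨a, b, h⟩ := uad_eq_Icc (p := p) hΩ
  rw [h]
  exact isClosed_Icc

theorem convex_uad : Convex ℝ (Uad Ω p) := by
  intro u hu v hv s t hs ht hst
  filter_upwards [hu, hv, Lp.coeFn_add (s • u) (t • v), Lp.coeFn_smul s u, Lp.coeFn_smul t v]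
    with x hx hy h1 h2 h3
  rw [h1, Pi.add_apply, h2, h3]
  exact convex_Icc p.ua p.ub hx hy hs ht hst

theorem isControl_iff (hΩ : IsConvexPolygon Ω) (w : d.mesh.fe) (u : L2 Ω) :
    IsControl p d w u ↔ u ∈ Uad Ω p ∧ ∀ v ∈ Uad Ω p,
      0 ≤ inner ℝ (p.lam • u + Triangulation.feL2 hΩ w) (v - u) := by
  refine and_congr_right fun _ => forall₂_congr fun v _ => ?_
  rw [← Triangulation.inner_eq_ip (f := p.lam • u + Triangulation.feL2 hΩ w) (g := v - u)]
  · filter_upwards [Lp.coeFn_add (p.lam • u) (Triangulation.feL2 hΩ w), Lp.coeFn_smul p.lam u,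
      Triangulation.coeFn_feL2 hΩ w] with x h1 h2 h3
    rw [h1, Pi.add_apply, h2, h3]
    rfl
  · exact Lp.coeFn_sub v u

/-- The control as a function of the co-state. -/
theorem exists_control (hΩ : IsConvexPolygon Ω) (hp : p.Valid Ω) : ∃ c : d.mesh.fe → L2 Ω,
    (∀ w u, IsControl p d w u ↔ u = c w) ∧
    ∀ w w', ‖c w - c w'‖ ≤ p.lam⁻¹ * ‖Triangulation.feL2 hΩ (w - w')‖ := by
  have hl := hp.lam_pos
  obtain ⟨π, hπ, hπ'⟩ := exists_convexProjection (uad_nonempty hΩ hp) (isClosed_uad hΩ)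
    (convex_uad (p := p))
  have key : ∀ (w : d.mesh.fe) (u v : L2 Ω),
      0 ≤ inner ℝ (p.lam • u + Triangulation.feL2 hΩ w) (v - u) ↔
      inner ℝ (-(p.lam⁻¹ • Triangulation.feL2 hΩ w) - u) (v - u) ≤ 0 := fun w u v => by
    have : p.lam • u + Triangulation.feL2 hΩ w =
        (-p.lam) • (-(p.lam⁻¹ • Triangulation.feL2 hΩ w) - u) := by
      rw [smul_sub, neg_smul, smul_neg, neg_neg, smul_inv_smul₀ hl.ne', neg_smul, sub_neg_eq_add,
        add_comm]
    rw [this, inner_smul_left, conj_trivial, neg_mul, neg_nonneg]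
    exact ⟨fun h => nonpos_of_mul_nonpos_right h hl, fun h => mul_nonpos_of_nonneg_of_nonpos hl.le h⟩
  -- The control is the projection of -w/lam; nonexpansiveness of the projection gives the Lipschitz
  -- constant 1/lam.
  refine ⟨fun w => π (-(p.lam⁻¹ • Triangulation.feL2 hΩ w)), fun w u => ?_, fun w w' => ?_⟩
  · simp only [isControl_iff hΩ, key]
    constructor
    · rintro ⟨hu, hu'⟩
      have := norm_sub_le_of_convexProjection hu
        (hπ (-(p.lam⁻¹ • Triangulation.feL2 hΩ w))) hu' (hπ' _)
      rwa [sub_self, norm_zero, norm_le_zero_iff, sub_eq_zero] at this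
    · rintro rfl
      exact ⟨hπ _, hπ' _⟩
  · refine (norm_sub_le_of_convexProjection (hπ _) (hπ _) (hπ' _) (hπ' _)).trans_eq ?_
    rw [← neg_sub', norm_neg, ← smul_sub, ← map_sub, norm_smul, Real.norm_of_nonneg (by positivity)]

end

end AFC

namespace AFC

noncomputable section

/-! ### The choice of the constants -/

/-- The lower bound on k gives h²/k ≤ h^(1-ε)/c₁ and the upper one k ≤ c₂h^(1+ε). Both exponents are
positive, so everything tends to zero with h. -/
theorem exists_meshSize_le {c₁ c₂ ε : ℝ} (hε₀ : 0 < ε) (hε₁ : ε < 1) (hc₁ : 0 < c₁) {δ : ℝ}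
    (hδ : 0 < δ) : ∃ h₀ > 0, ∀ h k : ℝ, 0 < h → h ≤ h₀ → c₁ * h ^ (1 + ε) ≤ k →
      k ≤ c₂ * h ^ (1 + ε) → k + h ^ 2 / k + h < δ := by
  have hg : Continuous fun h : ℝ => c₂ * h ^ (1 + ε) + c₁⁻¹ * h ^ (1 - ε) + h :=
    ((continuous_const.mul (Real.continuous_rpow_const (by linarith))).add
      (continuous_const.mul (Real.continuous_rpow_const (by linarith)))).add continuous_id
  have h0 := hg.tendsto 0
  rw [Real.zero_rpow (by linarith), Real.zero_rpow (by linarith)] at h0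
  obtain ⟨r, hr, hball⟩ := Metric.eventually_nhds_iff.1 (h0.eventually_lt_const
    (show c₂ * 0 + c₁⁻¹ * 0 + 0 < δ by simpa using hδ))
  refine ⟨r / 2, by positivity, fun h k hh hhr hk₁ hk₂ => ?_⟩
  have h1 : c₂ * h ^ (1 + ε) + c₁⁻¹ * h ^ (1 - ε) + h < δ := hball (by
    rw [Real.dist_eq, sub_zero, abs_of_pos hh]; linarith)
  have h2 : h ^ 2 / k ≤ c₁⁻¹ * h ^ (1 - ε) := by
    have hpos : 0 < h ^ (1 + ε) := Real.rpow_pos_of_pos hh _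
    refine (div_le_div_of_nonneg_left (sq_nonneg h) (by positivity) hk₁).trans_eq ?_
    have : h ^ 2 = h ^ (1 - ε) * h ^ (1 + ε) := by
      rw [← Real.rpow_add hh, ← Real.rpow_natCast]
      norm_num
    rw [this]
    field_simp
  linarith

theorem eventually_lt_of_continuous {f : ℝ → ℝ} (hf : Continuous f) {a : ℝ} (h : f 0 < a) :
    ∀ᶠ δ in 𝓝[>] (0 : ℝ), f δ < a :=
  ((hf.tendsto 0).mono_left nhdsWithin_le_nhds).eventually_lt_const h

/-- One threshold δ for k + h²/k + h that secures contraction, 8η ≤ μ, kκ ≤ 1 and a monotonicity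
defect of at most lam/2. All four quantities are continuous in δ and vanish at 0. -/
theorem exists_small {μ lam A β κ C T : ℝ} (hμ : 0 < μ) (hlam : 0 < lam) :
    ∃ δ > 0, C * δ < 1 ∧ 8 * (A * δ) < μ ∧ κ * δ < 1 ∧
      (√δ * β / 2 * (1 + 1 / μ) + 6 * (A * δ) / μ) * ((1 + (2 * κ * T) ^ 2) * (4 * T)) < lam / 2 := by
  have h1 := eventually_lt_of_continuous (f := fun δ => C * δ) (a := 1) (by fun_prop) (by simp)
  have h2 := eventually_lt_of_continuous (f := fun δ => 8 * (A * δ)) (a := μ) (by fun_prop)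
    (by simpa using hμ)
  have h3 := eventually_lt_of_continuous (f := fun δ => κ * δ) (a := 1) (by fun_prop) (by simp)
  have h4 := eventually_lt_of_continuous (f := fun δ => (√δ * β / 2 * (1 + 1 / μ) +
    6 * (A * δ) / μ) * ((1 + (2 * κ * T) ^ 2) * (4 * T))) (a := lam / 2) (by fun_prop) (by simpa using hlam)
  obtain ⟨δ, ⟨⟨⟨⟨h1, h2⟩, h3⟩, h4⟩, h5⟩⟩ :=
    ((((h1.and h2).and h3).and h4).and self_mem_nhdsWithin).exists
  exact ⟨δ, h5, h1, h2, h3, h4⟩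

end

end AFC

/-! ### The theorem -/

open AFC
set_option maxHeartbeats 1000000 in
theorem mainTheorem4 (Ω : Set Plane) (hΩ : IsConvexPolygon Ω) (p : Problem) (hp : p.Valid Ω)
    (σ ρ Γ ε c₁ c₂ : ℝ) (hε₀ : 0 < ε) (hε₁ : ε < 1) (hc₁ : 0 < c₁) :
    ∃ h₀ > 0, ∃ C > 0, ∀ d : Discretization Ω,
      d.mesh.ShapeRegular σ → d.mesh.QuasiUniform ρ →
      d.mesh.IsGamma d.γ → (∀ Z ∈ d.mesh.nodes, Z ∈ Ω → d.γ Z ≤ Γ) → 1 ≤ d.N₀ →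
      ∀ h k : ℝ, h = d.mesh.meshSize → k = step p d → h ≤ h₀ →
      c₁ * h ^ (1 + ε) ≤ k → k ≤ c₂ * h ^ (1 + ε) →
      -- the contraction factors are smaller than one
      C * (k + h ^ 2 / k) < 1 ∧ C * k < 1 ∧
      -- at each time level the fixed-point iteration is well defined, contractive and convergent
      (∀ (n : Fin d.N₀) (yOld wNext : d.mesh.fe), ∀ ψ ∈ Uad Ω p,
        ∃ 𝒢 : d.mesh.fe × d.mesh.fe → d.mesh.fe × d.mesh.fe,
          (∀ s s', IterStep p d n ψ yOld wNext s s' ↔ s' = 𝒢 s) ∧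
          (∀ s s', distSq d (𝒢 s) (𝒢 s') ≤ C * (k + h ^ 2 / k) * distSq d s s') ∧
          ∃ z : d.mesh.fe × d.mesh.fe,
            (∀ y w, StateStep p d n ψ yOld y ∧ CostateStep p d n y wNext w ↔ (y, w) = z) ∧
            ∀ s, Tendsto (fun j : ℕ => distSq d (𝒢^[j] s) z) atTop (𝓝 0)) ∧
      -- unique solution of the state/co-state scheme for given controls
      (∀ ψ : Fin d.N₀ → L2 Ω, (∀ n, ψ n ∈ Uad Ω p) →
        ∃! s : (Fin (d.N₀ + 1) → d.mesh.fe) × (Fin (d.N₀ + 1) → d.mesh.fe),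
          SolvesGiven p d ψ s.1 s.2) ∧
      -- the control map of a single time level, for known old state and next co-state
      (∀ (n : Fin d.N₀) (yOld wNext : d.mesh.fe), ∃ Ũ : L2 Ω → L2 Ω,
        (∀ ψ ∈ Uad Ω p, ∀ y w : d.mesh.fe, StateStep p d n ψ yOld y →
          CostateStep p d n y wNext w → ∀ u, IsControl p d w u ↔ u = Ũ ψ) ∧
        ∀ ψ₁ ∈ Uad Ω p, ∀ ψ₂ ∈ Uad Ω p, ‖Ũ ψ₁ - Ũ ψ₂‖ ≤ C * k * ‖ψ₁ - ψ₂‖) ∧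
      -- the control map of the whole scheme, as a function of the control of one time level
      (∃ Ũ : (Fin d.N₀ → L2 Ω) → Fin d.N₀ → L2 Ω,
        (∀ ψ, (∀ n, ψ n ∈ Uad Ω p) → ∀ Y P, SolvesGiven p d ψ Y P →
          ∀ n u, IsControl p d (P n.castSucc) u ↔ u = Ũ ψ n) ∧
        ∀ ψ₁ ψ₂ : Fin d.N₀ → L2 Ω, (∀ n, ψ₁ n ∈ Uad Ω p) → (∀ n, ψ₂ n ∈ Uad Ω p) →
          ∀ n, (∀ m, m ≠ n → ψ₁ m = ψ₂ m) →
            ‖Ũ ψ₁ n - Ũ ψ₂ n‖ ≤ C * k * ‖ψ₁ n - ψ₂ n‖) ∧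
      -- unique solution of the full nonlinear scheme
      ∃! s : (Fin (d.N₀ + 1) → d.mesh.fe) × (Fin (d.N₀ + 1) → d.mesh.fe) × (Fin d.N₀ → L2 Ω),
        SolvesFull p d s.1 s.2.1 s.2.2 := by
  classical
  obtain ⟨B', hB'⟩ := hp.b_bdd
  obtain ⟨ϑ, hϑ⟩ := Triangulation.exists_isRegular hΩ σ ρ
  -- The bounds for b and for the γ_i are made nonnegative; the given constants may be negative when
  -- there is nothing to bound.
  set B := max B' 0
  have hB0 : 0 ≤ B := le_max_right _ _
  have hB : ∀ t ∈ Icc 0 p.tEnd, ∀ᵐ x ∂volume.restrict Ω, ‖p.b t x‖ ≤ B := fun t ht => by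
    filter_upwards [hB' t ht] with x hx using hx.trans (le_max_left _ _)
  have hμ := hp.μ_pos
  have hl := hp.lam_pos
  have hT := hp.tEnd_pos
  set Γ' := max Γ 0
  have hΓ' : 0 ≤ Γ' := le_max_right _ _
  set A := 2 * Triangulation.stabConst ϑ Γ' with hAdef
  have hA : 0 ≤ A := mul_nonneg two_pos.le (Triangulation.stabConst_nonneg hΓ')
  set κ := Triangulation.locConst ϑ with hκdef
  have hκ : 0 ≤ κ := by rw [hκdef, Triangulation.locConst]; positivity
  -- The modulus is taken because ϑ is known to be positive only once a mesh is given.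
  set A₂ := A * (Real.pi + |B * Real.pi / ϑ|)
  have hA₂ : 0 ≤ A₂ := by positivity
  -- C₁ serves the fixed-point iteration, C₂ the control maps; the added 1 makes the final constant
  -- positive.
  set C₁ := A₂ ^ 2 * κ / p.μ with hC₁
  set C₂ := 4 * κ * p.tEnd / p.lam with hC₂
  have hC₁0 : 0 ≤ C₁ := by positivity
  have hC₂0 : 0 ≤ C₂ := by positivity
  obtain ⟨δ, hδ, hδ₁, hδ₂, hδ₃, hδ₄⟩ := exists_small (μ := p.μ) (lam := p.lam) (A := A₂) (β := B)
    (κ := κ) (C := C₁ + C₂ + 1) (T := p.tEnd) hμ hl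
  obtain ⟨h₀, hh₀, hsmall⟩ := exists_meshSize_le (c₂ := c₂) hε₀ hε₁ hc₁ hδ
  refine ⟨h₀, hh₀, C₁ + C₂ + 1, by positivity, ?_⟩
  intro d hσ hρ hγ hγΓ hN h k hh hkd hhh₀ hk₁ hk₂
  have hreg := hϑ d.mesh hσ hρ
  have hϑ0 := hreg.pos
  have hh0 : 0 < h := hh ▸ hreg.meshSize_pos
  have hk : 0 < k := hkd ▸ hp.step_pos hN
  have hkT : k * d.N₀ = p.tEnd := hkd ▸ step_mul_cast hN
  have hk_le : k ≤ p.tEnd := by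
    rw [← hkT]
    exact le_mul_of_one_le_right hk.le (by exact_mod_cast hN)
  have hs := hsmall h k hh0 hhh₀ hk₁ hk₂
  have hr : 0 < h ^ 2 / k := by positivity
  -- Chosen so that the smallness condition of `exists_schemeForms` holds with equality; its order
  -- is h²/k + h.
  set η := A * (Real.pi * h ^ 2 / k + B * Real.pi / ϑ * h) with hηdef
  have hη0 : 0 ≤ η := by positivity
  have hη_le : η ≤ A₂ * (h ^ 2 / k + h) := by
    have h1 := mul_le_mul_of_nonneg_right (le_abs_self (B * Real.pi / ϑ)) hh0.le
    have h2 : 0 ≤ |B * Real.pi / ϑ| * (h ^ 2 / k) := by positivity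
    have h3 : 0 ≤ Real.pi * h := by positivity
    calc η ≤ A * ((Real.pi + |B * Real.pi / ϑ|) * (h ^ 2 / k + h)) := by
          rw [hηdef, mul_div_assoc]
          refine mul_le_mul_of_nonneg_left ?_ hA
          linarith
      _ = _ := by ring
  have hη_small : η ≤ A₂ * δ := hη_le.trans (mul_le_mul_of_nonneg_left (by linarith) hA₂)
  have hημ : 8 * η ≤ p.μ := by linarith
  obtain ⟨S, hSκ, hSβ, hstate, hcostate, hiter⟩ := exists_schemeForms (d := d) hΩ hp hB0 hB hreg
    hΓ' (fun Z hZ hZΩ => (hγ Z hZ hZΩ).1.le)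
    (fun Z hZ hZΩ => (hγΓ Z hZ hZΩ).trans (le_max_left _ _)) hN (η := η) (by
      rw [← hh, ← hkd, hηdef]
      refine le_of_eq ?_
      field_simp
      exact hAdef.symm)
  rw [← hκdef] at hSκ
  obtain ⟨ctrl, hctrl, hctrlL⟩ := exists_control (d := d) hΩ hp
  have hI := Triangulation.feL2_injective hΩ hreg
  have hgiven : ∀ ψ Y P, SolvesGiven p d ψ Y P ↔ S.IsSolution d.y₀ d.pT ψ Y P := fun ψ Y P => by
    simp only [SolvesGiven, SchemeForms.IsSolution, hstate, hcostate]
  -- The value for which the inverse inequality yields `hinv`. As η² is of order (h²/k)² + h², θ is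
  -- of order k + h²/k.
  set θ := k * η ^ 2 * κ / (4 * p.μ * h ^ 2) with hθdef
  have hθ0 : 0 ≤ θ := by positivity
  have hθC : 2 * θ ≤ C₁ * (k + h ^ 2 / k) := by
    have h1 : η ^ 2 ≤ A₂ ^ 2 * (2 * ((h ^ 2 / k) ^ 2 + h ^ 2)) :=
      (pow_le_pow_left₀ hη0 hη_le 2).trans (by
        rw [mul_pow]
        exact mul_le_mul_of_nonneg_left add_sq_le (sq_nonneg _))
    calc 2 * θ = k * κ / (2 * p.μ * h ^ 2) * η ^ 2 := by rw [hθdef]; field_simp; ring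
      _ ≤ k * κ / (2 * p.μ * h ^ 2) * (A₂ ^ 2 * (2 * ((h ^ 2 / k) ^ 2 + h ^ 2))) := by gcongr
      _ = _ := by rw [hC₁]; field_simp; ring
  have hCs : (C₁ + C₂ + 1) * (k + h ^ 2 / k) < 1 :=
    (mul_le_mul_of_nonneg_left (by linarith) (by positivity)).trans_lt hδ₁
  have hθ1 : 2 * θ ≤ (C₁ + C₂ + 1) * (k + h ^ 2 / k) :=
    hθC.trans (mul_le_mul_of_nonneg_right (by linarith) (by positivity))
  have hinv : ∀ v : d.mesh.fe, step p d * η ^ 2 * ‖Triangulation.feGrad hΩ v‖ ^ 2 ≤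
      4 * p.μ * θ * ‖Triangulation.feL2 hΩ v‖ ^ 2 := fun v => by
    have h1 := hreg.inverse_inequality hΩ v
    rw [← hh, ← hκdef] at h1
    rw [← hkd]
    calc k * η ^ 2 * ‖Triangulation.feGrad hΩ v‖ ^ 2
        = k * η ^ 2 / h ^ 2 * (h ^ 2 * ‖Triangulation.feGrad hΩ v‖ ^ 2) := by field_simp
      _ ≤ k * η ^ 2 / h ^ 2 * (κ * ‖Triangulation.feL2 hΩ v‖ ^ 2) := by gcongr
      _ = _ := by rw [hθdef]; field_simp
  have hκk : step p d * S.κ ≤ 1 := by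
    rw [hSκ, ← hkd, mul_comm]
    exact (mul_le_mul_of_nonneg_left (by linarith) hκ).trans hδ₃.le
  have hdist : ∀ s s' : d.mesh.fe × d.mesh.fe, distSq d s s' =
      ‖Triangulation.feL2 hΩ (s.1 - s'.1)‖ ^ 2 + ‖Triangulation.feL2 hΩ (s.2 - s'.2)‖ ^ 2 :=
    fun s s' => by
      rw [distSq, Triangulation.ip_eq_inner hΩ, Triangulation.ip_eq_inner hΩ,
        real_inner_self_eq_norm_sq, real_inner_self_eq_norm_sq]
  have hcontr : ∀ {u X : ℝ}, 0 ≤ X → u ≤ p.lam⁻¹ * (4 * κ * p.tEnd * k * X) →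
      u ≤ (C₁ + C₂ + 1) * k * X := fun {u X} hX hu => by
    refine hu.trans ?_
    calc p.lam⁻¹ * (4 * κ * p.tEnd * k * X) = C₂ * k * X := by rw [hC₂]; field_simp
      _ ≤ _ := by gcongr; linarith
  subst hkd
  choose sol hsol hsol' using fun ψ => S.existsUnique_solution hI hμ hk.le (by linarith) hinv
    d.y₀ d.pT ψ
  refine ⟨hCs, ?_, ?_, fun ψ _ => ?_, fun n yOld wNext => ?_, ?_, ?_⟩
  · exact (mul_le_mul_of_nonneg_left (by linarith) (by positivity)).trans_lt hδ₁
  · intro n yOld wNext ψ _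
    obtain ⟨𝒢, h𝒢, hlip, z, hz, hlim⟩ := S.exists_iteration hI hμ hk.le hθ0 (by linarith) hinv hκk
      n ψ yOld wNext
    refine ⟨𝒢, fun s s' => (hiter n ψ yOld wNext s s').trans (h𝒢 s s'), fun s s' => ?_, z,
      fun y w => ?_, fun s => ?_⟩
    · rw [hdist, hdist]
      exact (hlip s s').trans (mul_le_mul_of_nonneg_right hθ1 (by positivity))
    · rw [hstate, hcostate]
      exact hz y w
    · simpa only [hdist] using hlim s
  · simp only [hgiven]
    exact ⟨sol ψ, hsol ψ, hsol' ψ⟩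
  · choose 𝒢 h𝒢 hlip z hz hlim using fun ψ => S.exists_iteration hI hμ hk.le hθ0 (by linarith) hinv
      hκk n ψ yOld wNext
    refine ⟨fun ψ => ctrl (z ψ).2, fun ψ _ y w hy hw u => ?_, fun ψ₁ _ ψ₂ _ => ?_⟩
    · refine (hctrl w u).trans ?_
      change _ ↔ u = ctrl (z ψ).2
      rw [← (hz ψ y w).1 ⟨(hstate _ _ _ _).1 hy, (hcostate _ _ _ _).1 hw⟩]
    · obtain ⟨hy₁, hw₁⟩ := (hz ψ₁ (z ψ₁).1 (z ψ₁).2).2 rfl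
      obtain ⟨hy₂, hw₂⟩ := (hz ψ₂ (z ψ₂).1 (z ψ₂).2).2 rfl
      -- At a single level the gain is even k²; one factor k is replaced by the final time to match
      -- C₂.
      have h1 := S.norm_costate_sub_le hμ.le hk.le hη0 hημ hy₁ hy₂ hw₁ hw₂
      refine hcontr (norm_nonneg _) ((hctrlL _ _).trans ?_)
      refine mul_le_mul_of_nonneg_left (h1.trans ?_) (inv_nonneg.2 hl.le)
      rw [hSκ]
      gcongr
  · refine ⟨fun ψ n => ctrl ((sol ψ).2 n.castSucc), fun ψ _ Y P hYP n u => ?_,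
      fun ψ₁ ψ₂ _ _ n hne => ?_⟩
    · refine (hctrl _ u).trans ?_
      change _ ↔ u = ctrl ((sol ψ).2 n.castSucc)
      rw [← hsol' ψ (Y, P) ((hgiven _ _ _).1 hYP)]
    · have h1 := S.norm_costate_sub_le_sum hμ.le hk.le hη0 hημ (hsol ψ₁) (hsol ψ₂) n.castSucc
      -- Only one control varies, so a single summand survives and the factor k is retained.
      rw [Finset.sum_eq_single n (fun m _ hm => by rw [hne m hm, sub_self, norm_zero])
        (fun hn => absurd (Finset.mem_univ n) hn), hkT, hSκ] at h1
      exact hcontr (norm_nonneg _) ((hctrlL _ _).trans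
        (mul_le_mul_of_nonneg_left h1 (inv_nonneg.2 hl.le)))
  -- The defect is increasing in k and η, which lie below δ and A₂ δ.
  · have hdef : S.defect ≤ p.lam / 2 := by
      rw [SchemeForms.defect, hkT, hSκ, hSβ]
      refine le_trans ?_ hδ₄.le
      have : √(step p d) ≤ √δ := Real.sqrt_le_sqrt (by linarith)
      gcongr
    have hopt := S.existsUnique_optimal hI hμ hk hη0 hημ (by linarith) hinv (by rw [hSβ]; exact hB0)
      hl hdef d.y₀ d.pT (uad_nonempty hΩ hp) (isClosed_uad hΩ) convex_uad
    simpa only [solvesFull_iff hΩ hk.ne', hgiven, isControl_iff hΩ] using hopt
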